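/- **Theorem.** Write $V=\{x_{ij}: 1\le i\ne j\le 4\}$. Two icosahedra (boundary complexes) $I_1,I_2$ with a common vertex set are *antimorphic* if, in their edge graphs, any two vertices are at distance one (respectively two) in $I_1$ if and only if they are at distance two (respectively one) in $I_2$. For an antimorphic pair and each triangle $\Delta=abc$ of $I_1$ there is a unique triangle $\varphi(\Delta)=ijk$ of $I_2$ such that, for a suitable naming of its vertices, $aij$, $bjk$, $cik$ are triangles of $I_2$; let $K(I_1,I_2)$ be the simplicial complex whose facets are the sets of neighbours in $I_1$ of the vertices, and the sets $(\Delta\cup\varphi(\Delta))\setminus\{y\}$ with $\Delta$ a triangle of $I_1$ and $y\in\varphi(\Delta)$. Let $$g=(x_{12}x_{21}x_{24}x_{42}x_{14}x_{41}x_{43}x_{34}x_{13}x_{31}x_{32}x_{23}),\qquad h=(x_{12}x_{14}x_{21}x_{24}x_{31})(x_{13}x_{42}x_{43}x_{32}x_{34}).$$ Let $I_1$ be the icosahedron on $V$ in which $x_{23}$ and $x_{41}$ are antipodal, $x_{23}$ has the link $x_{12}x_{14}x_{21}x_{24}x_{31}$ and $x_{41}$ has the link $x_{13}x_{42}x_{43}x_{32}x_{34}$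 (5-cycles in this cyclic order), and $x_{13}$ is adjacent to $x_{12}$ and $x_{14}$, with the remaining adjacencies obtained by applying $h$; let $I_2=g(I_1)$. (a) $I_1,I_2$ is an antimorphic pair. The complex $(S^2\times S^2)_{12}:=K(I_1,I_2)$ has 12 vertices, and its facets are the images of $x_{12}x_{14}x_{21}x_{24}x_{31}$ and $x_{12}x_{13}x_{14}x_{21}x_{31}$ under the group $\langle g,h\rangle$. For every antimorphic pair of icosahedra $J_1,J_2$, the complex $K(J_1,J_2)$ is isomorphic to $(S^2\times S^2)_{12}$. (b) The geometric carrier of $(S^2\times S^2)_{12}$ is homeomorphic to $S^2\times S^2$. (c) Let $(S^2\times S^2)'_{16}$ be the complex with vertices $x_{ij}$ $(1\le i,j\le 4)$ whose facets are the images, under $A_4$ acting on the indices, of $x_{11}x_{12}x_{13}x_{21}x_{31}$, $x_{11}x_{12}x_{14}x_{21}x_{31}$, $x_{11}x_{13}x_{14}x_{21}x_{31}$, $x_{12}x_{13}x_{23}x_{31}x_{32}$, $x_{12}x_{14}x_{21}x_{24}x_{31}$, $x_{12}x_{14}x_{24}x_{31}x_{34}$, $x_{12}x_{21}x_{24}x_{31}x_{32}$,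 $x_{12}x_{24}x_{31}x_{32}x_{34}$. It has 16 vertices and, with $x_{ij}=(x_i,x_j)$, it is a simplicial subdivision of the product cell complex $\partial T\times\partial T$, where $T$ is the tetrahedron $x_1x_2x_3x_4$. The complex $(S^2\times S^2)_{12}$ is obtained from it by a finite sequence of generalized bistellar moves. (Such a move replaces a pure $d$-dimensional complex $X$ by the complex $(X\setminus D)\cup\widehat D$, where $D\subseteq X$ and $\widehat D$ are triangulated $d$-balls with $\partial D=\partial\widehat D=\widehat D\cap X$; here $d=4$.) (d) The full automorphism group $G$ of $(S^2\times S^2)_{12}$ equals $\langle g,h\rangle$ and has order 240. It is a non-split central extension of $S_5$ by $\mathbb Z_2$, namely the one in which the preimage of $A_5$ is isomorphic to $A_5\times\mathbb Z_2$. -/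

import Mathlib

/-! ## Finite simplicial complexes -/

namespace SimplicialSurgery

/-- The simplicial complex generated by a family of finite sets: all nonempty subsets of its
members. -/
def generatedBy {V : Type*} (F : Set (Finset V)) : PreAbstractSimplicialComplex V where
  faces := {t | t.Nonempty ∧ ∃ s ∈ F, t ⊆ s}
  isRelLowerSet_faces := by
    rintro t ⟨ht, s, hs, hts⟩
    exact ⟨ht, fun u hut hu => ⟨hu, s, hs, hut.trans hts⟩⟩

/-- The vertices of a simplicial complex. -/
def vertexSet {V : Type*} (K : PreAbstractSimplicialComplex V) : Set V :=
  {v | {v} ∈ K.faces}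

/-- The geometric carrier `|K|`: the functions `V → [0, 1]` with sum `1` whose support is a simplex
of `K`, topologized as a subspace of `V → ℝ`. -/
def carrier {V : Type*} [Fintype V] (K : PreAbstractSimplicialComplex V) : Set (V → ℝ) :=
  {f | (∀ v, 0 ≤ f v) ∧ ∑ v, f v = 1 ∧ ∃ s ∈ K.faces, ∀ v, f v ≠ 0 ↔ v ∈ s}

/-- `K` triangulates the topological space `Y`. -/
def Triangulates {V : Type*} [Fintype V] (K : PreAbstractSimplicialComplex V)
    (Y : Type*) [TopologicalSpace Y] : Prop :=
  Nonempty (carrier K ≃ₜ Y)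

/-- `e` is an isomorphism between `K` and `L`; `V` and `W` are meant to be their vertex sets. -/
def IsIso {V W : Type*} (K : PreAbstractSimplicialComplex V) (L : PreAbstractSimplicialComplex W)
    (e : V ≃ W) : Prop :=
  ∀ s : Finset V, s.map e.toEmbedding ∈ L.faces ↔ s ∈ K.faces

/-- The full automorphism group of a simplicial complex with vertex set `V`. -/
def Aut {V : Type*} (K : PreAbstractSimplicialComplex V) : Subgroup (Equiv.Perm V) where
  carrier := {e | IsIso K K e}
  one_mem' := fun s => by
    have h : s.map (Equiv.toEmbedding (1 : Equiv.Perm V)) = s := by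
      exact Finset.map_refl
    rw [h]
  mul_mem' := by
    intro a b ha hb s
    have h : s.map (Equiv.toEmbedding (a * b)) = (s.map b.toEmbedding).map a.toEmbedding := by
      rw [Finset.map_map]; rfl
    rw [h]
    exact (ha _).trans (hb s)
  inv_mem' := by
    intro a ha s
    have h : (s.map (Equiv.toEmbedding a⁻¹)).map a.toEmbedding = s := by
      rw [Finset.map_map]
      ext v; simp
    have := ha (s.map (Equiv.toEmbedding a⁻¹))
    rw [h] at this
    exact this.symm

/-- The edge graph of a simplicial complex. -/
def edgeGraph {V : Type*} [DecidableEq V] (K : PreAbstractSimplicialComplex V) :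
    SimpleGraph V where
  Adj x y := x ≠ y ∧ {x, y} ∈ K.faces
  symm := ⟨fun x y h => ⟨h.1.symm, by rw [Finset.pair_comm]; exact h.2⟩⟩
  loopless := ⟨fun _ h => h.1 rfl⟩

/-- The triangles (two-dimensional simplices) of a simplicial complex. -/
def triangles {V : Type*} (K : PreAbstractSimplicialComplex V) : Set (Finset V) :=
  {s | s ∈ K.faces ∧ s.card = 3}

/-! ## Generalized bistellar moves -/

/-- `K` is pure of dimension `d`: all its maximal simplices are `d`-dimensional. -/
def IsPure {V : Type*} (d : ℕ) (K : PreAbstractSimplicialComplex V) : Prop :=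
  ∀ s, Maximal (· ∈ K.faces) s → s.card = d + 1

/-- The boundary complex of a triangulated `d`-ball (`1 ≤ d`): it is generated by the
`(d - 1)`-simplices lying in exactly one `d`-simplex. -/
def boundary {V : Type*} (d : ℕ) (D : PreAbstractSimplicialComplex V) :
    PreAbstractSimplicialComplex V :=
  generatedBy {r | r ∈ D.faces ∧ r.card = d ∧ ∃! s, s ∈ D.faces ∧ s.card = d + 1 ∧ r ⊆ s}

/-- `D` is a triangulation of the `d`-ball. -/
def IsTriangulatedBall {V : Type*} [Fintype V] (d : ℕ) (D : PreAbstractSimplicialComplex V) :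
    Prop :=
  Triangulates D (Metric.closedBall (0 : EuclideanSpace ℝ (Fin d)) 1)

/-- `X'` is obtained from the pure `d`-dimensional complex `X` by a generalized bistellar move: a
triangulated `d`-ball `D ⊆ X` is replaced by a triangulated `d`-ball `D'` such that
`∂D = ∂D' = D' ∩ X`. -/
def IsGBM {V : Type*} [Fintype V] (d : ℕ) (X X' : PreAbstractSimplicialComplex V) : Prop :=
  IsPure d X ∧ ∃ D D' : PreAbstractSimplicialComplex V,
    IsTriangulatedBall d D ∧ IsTriangulatedBall d D' ∧
    boundary d D = boundary d D' ∧ boundary d D' = D' ⊓ X ∧ D ≤ X ∧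
    X'.faces = (X.faces \ D.faces) ∪ D'.faces

/-! ## Antimorphic pairs of icosahedra -/

/-- The boundary complex of the icosahedron. The vertices are two poles `(true, none)` and
`(false, none)` and the two rings `(true, some i)` and `(false, some i)` of their neighbours. -/
def icosahedron : PreAbstractSimplicialComplex (Bool × Option (Fin 5)) :=
  generatedBy
    ({s | ∃ (b : Bool) (i : Fin 5), s = {(b, none), (b, some i), (b, some (i + 1))}} ∪
     {s | ∃ i : Fin 5, s = {(true, some i), (true, some (i + 1)), (false, some i)}} ∪
     {s | ∃ i : Fin 5, s = {(false, some i), (false, some (i + 1)), (true, some (i + 1))}})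

/-- `I` is a copy of the icosahedron with vertex set `V`. -/
def IsIcosahedron {V : Type*} (I : PreAbstractSimplicialComplex V) : Prop :=
  ∃ e : Bool × Option (Fin 5) ≃ V, IsIso icosahedron I e

/-- `f` is an antimorphism: it interchanges the distances one and two. -/
def IsAntimorphism {V W : Type*} [DecidableEq V] [DecidableEq W]
    (I₁ : PreAbstractSimplicialComplex V) (I₂ : PreAbstractSimplicialComplex W) (f : V ≃ W) :
    Prop :=
  ∀ x y : V,
    ((edgeGraph I₁).dist x y = 1 ↔ (edgeGraph I₂).dist (f x) (f y) = 2) ∧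
    ((edgeGraph I₁).dist x y = 2 ↔ (edgeGraph I₂).dist (f x) (f y) = 1)

/-- `I₁` and `I₂` are an antimorphic pair of icosahedra with common vertex set `V`. -/
def IsAntimorphicPair {V : Type*} [DecidableEq V] (I₁ I₂ : PreAbstractSimplicialComplex V) :
    Prop :=
  IsIcosahedron I₁ ∧ IsIcosahedron I₂ ∧ IsAntimorphism I₁ I₂ (Equiv.refl V)

/-- The condition `φ(abc) = ijk` relating a triangle `abc` of `I₁` to a triangle `ijk` of `I₂`:
`aij`, `bjk` and `cik` are triangles of `I₂`. -/
def Corresponds {V : Type*} [DecidableEq V] (I₁ I₂ : PreAbstractSimplicialComplex V)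
    (s t : Finset V) : Prop :=
  s ∈ triangles I₁ ∧ t ∈ triangles I₂ ∧ ∃ a b c i j k : V, s = {a, b, c} ∧ t = {i, j, k} ∧
    {a, i, j} ∈ triangles I₂ ∧ {b, j, k} ∈ triangles I₂ ∧ {c, i, k} ∈ triangles I₂

/-- The complex built from an antimorphic pair of icosahedra. Its facets are the sets of
neighbours in `I₁` of the vertices, and the sets `(Δ ∪ φ(Δ)) \ {y}` with `Δ` a triangle of `I₁` and
`y ∈ φ(Δ)`. -/
def pairComplex {V : Type*} [DecidableEq V] (I₁ I₂ : PreAbstractSimplicialComplex V) :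
    PreAbstractSimplicialComplex V :=
  generatedBy
    ({s | ∃ x, ∀ y, y ∈ s ↔ (edgeGraph I₁).Adj x y} ∪
     {s | ∃ t t' : Finset V, Corresponds I₁ I₂ t t' ∧ ∃ y ∈ t', s = (t ∪ t').erase y})

/-! ## The complex with twelve vertices -/

/-- The symbols `x i j` with `i ≠ j`. The labels `1, 2, 3, 4` of the vertices of the tetrahedron
are taken modulo `4`, i.e. `4` is the element `0` of `Fin 4`. -/
abbrev OffDiag : Type := {p : Fin 4 × Fin 4 // p.1 ≠ p.2}

/-- The vertex `x i j`. -/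
abbrev x (i j : Fin 4) (h : i ≠ j := by decide) : OffDiag := ⟨(i, j), h⟩

/-- The vertex labels of the first icosahedron. -/
def label₁ : Bool × Option (Fin 5) → OffDiag
  | (true, none) => x 2 3
  | (true, some i) => ![x 1 2, x 1 4, x 2 1, x 2 4, x 3 1] i
  | (false, some i) => ![x 1 3, x 4 2, x 4 3, x 3 2, x 3 4] i
  | (false, none) => x 4 1

/-- The vertex labels of the second icosahedron. -/
def label₂ : Bool × Option (Fin 5) → OffDiag
  | (true, none) => x 1 2
  | (true, some i) => ![x 2 1, x 4 1, x 2 4, x 4 2, x 3 2] i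
  | (false, some i) => ![x 3 1, x 1 4, x 3 4, x 2 3, x 1 3] i
  | (false, none) => x 4 3

/-- The first of two explicit antimorphic icosahedra. -/
def ico₁ : PreAbstractSimplicialComplex OffDiag := icosahedron.map label₁

/-- The second of two explicit antimorphic icosahedra. -/
def ico₂ : PreAbstractSimplicialComplex OffDiag := icosahedron.map label₂

/-- The complex `(S² × S²)₁₂`. -/
def S12 : PreAbstractSimplicialComplex OffDiag := pairComplex ico₁ ico₂

/-- The permutation `g` of order twelve. -/
def g : Equiv.Perm OffDiag :=
  [x 1 2, x 2 1, x 2 4, x 4 2, x 1 4, x 4 1, x 4 3, x 3 4, x 1 3, x 3 1, x 3 2, x 2 3].formPerm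

/-- The permutation `h` of order five. -/
def h : Equiv.Perm OffDiag :=
  [x 1 2, x 1 4, x 2 1, x 2 4, x 3 1].formPerm * [x 1 3, x 4 2, x 4 3, x 3 2, x 3 4].formPerm

/-- The group generated by `g` and `h`. -/
def groupGH : Subgroup (Equiv.Perm OffDiag) := Subgroup.closure {g, h}

/-- The two basic facets of `(S² × S²)₁₂` modulo the group generated by `g` and `h`. -/
def basicFacets12 : Set (Finset OffDiag) :=
  {{x 1 2, x 1 4, x 2 1, x 2 4, x 3 1}, {x 1 2, x 1 3, x 1 4, x 2 1, x 3 1}}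

/-! ## The subdivision with sixteen vertices -/

/-- The eight basic facets of `(S² × S²)'₁₆` modulo `A₄`; the pair `(i, j)` is the vertex
`x i j`. -/
def basicFacets16 : Set (Finset (Fin 4 × Fin 4)) :=
  {{(1, 1), (1, 2), (1, 3), (2, 1), (3, 1)},
   {(1, 1), (1, 2), (1, 4), (2, 1), (3, 1)},
   {(1, 1), (1, 3), (1, 4), (2, 1), (3, 1)},
   {(1, 2), (1, 3), (2, 3), (3, 1), (3, 2)},
   {(1, 2), (1, 4), (2, 1), (2, 4), (3, 1)},
   {(1, 2), (1, 4), (2, 4), (3, 1), (3, 4)},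
   {(1, 2), (2, 1), (2, 4), (3, 1), (3, 2)},
   {(1, 2), (2, 4), (3, 1), (3, 2), (3, 4)}}

/-- The complex `(S² × S²)'₁₆`, whose facets form the orbits of the basic facets under the action
of `A₄` on the indices. -/
def S16second : PreAbstractSimplicialComplex (Fin 4 × Fin 4) :=
  generatedBy {s | ∃ a ∈ alternatingGroup (Fin 4), ∃ b ∈ basicFacets16,
    s = b.image (Prod.map a a)}

/-- The geometric face of the standard tetrahedron in `ℝ⁴` spanned by the vertices in `A`. -/
def tetraFace (A : Finset (Fin 4)) : Set (Fin 4 → ℝ) :=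
  convexHull ℝ ((fun i => Pi.single i 1) '' (A : Set (Fin 4)))

/-- The point `(xᵢ, xⱼ)` of the product of two tetrahedra. -/
def vertexPoint (p : Fin 4 × Fin 4) : (Fin 4 → ℝ) × (Fin 4 → ℝ) :=
  (Pi.single p.1 1, Pi.single p.2 1)

/-- `K`, with its vertex `(i, j)` placed at the point `(xᵢ, xⱼ)`, is a simplicial subdivision of the
product cell complex `S²₄ × S²₄ = ∂T × ∂T`, whose cells are the products of two proper faces of the
tetrahedron `T`: the simplices form a geometric simplicial complex, each of them lies in a cell, and
together they fill `|∂T| × |∂T|`. -/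
def IsSubdivisionOfProduct (K : PreAbstractSimplicialComplex (Fin 4 × Fin 4)) : Prop :=
  ∃ G : Geometry.SimplicialComplex ℝ ((Fin 4 → ℝ) × (Fin 4 → ℝ)),
    G.faces = {s : Finset ((Fin 4 → ℝ) × (Fin 4 → ℝ)) | ∃ t ∈ K.faces,
      (s : Set ((Fin 4 → ℝ) × (Fin 4 → ℝ))) = vertexPoint '' (t : Set (Fin 4 × Fin 4))} ∧
    (∀ s ∈ G.faces, ∃ A B : Finset (Fin 4), A ≠ Finset.univ ∧ B ≠ Finset.univ ∧
      convexHull ℝ (s : Set ((Fin 4 → ℝ) × (Fin 4 → ℝ))) ⊆ tetraFace A ×ˢ tetraFace B) ∧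
    G.space = (⋃ A ∈ {A : Finset (Fin 4) | A ≠ Finset.univ}, tetraFace A) ×ˢ
      (⋃ B ∈ {B : Finset (Fin 4) | B ≠ Finset.univ}, tetraFace B)

/-! ## The 2-sphere -/

/-- The standard 2-sphere. -/
abbrev Sphere2 : Type := Metric.sphere (0 : EuclideanSpace ℝ (Fin 3)) 1

end SimplicialSurgery

open SimplicialSurgery

/-! The uniqueness statement rests on rigidity. The boundary complex of the icosahedron is flag
(`isFlag_icosahedron`), so it is determined by its edge graph. In an antimorphic pair the edges of
the second member are the pairs at distance two in the first. Hence an isomorphism between first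
members is automatically one between second members (`IsAntimorphicPair.isIso_snd`), and every
assertion about pairs reduces to the explicit pair `ico₁`, `ico₂`, where finitely many cases are
checked.

The topology comes from explicit piecewise linear maps. Placing `x i j` at `(xᵢ, xⱼ)` sends a weight
on the vertices of the 16-vertex complex to its row and column sums. If two weights have the same
sums, their difference contains an alternating circuit of length four or six
(`exists_alternating_circuit`), whose positive and negative vertices would both be faces. Inspection
of the facets excludes this, so the map is injective. Surjectivity onto `∂T × ∂T` means finding, for
given marginals, a coupling supported on a facet. By `A₄`-symmetry two cells suffice, each cut into
six simplices.

All moves have one shape: `A * ∂B * ∂C`, containing the star of `A`, is replaced by `B * ∂A * ∂C`.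
Both are balls with boundary `∂A * ∂B * ∂C`. Coordinates relative to a base vertex in each block
show this, with the sum of the block oscillations in the role of a norm. Moving the common part of
the `A`-coordinates to `B` is a homeomorphism between the whole carriers
(`IsFlip.carrierHomeomorph`). Eight such moves eliminate the four diagonal vertices.

For the symmetries, the 40 triangles of the two icosahedra are exactly the triples lying in three
facets, so automorphisms permute them. An automorphism fixing one of them vertex by vertex is the
identity, because at every edge each triangle determines the opposite one. Since `g` and `h` act
transitively on the 240 ordered triangles, they generate the full group, of order 240. Its action on
five colours of pairs of axes gives a surjection `π` onto `S₅` with kernel of order two, and its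
action on oriented triangles gives a homomorphism `ρ` to `ℤ/4`. The sign of `π` is the parity of
`ρ`. A lift of a transposition therefore has odd image in `ℤ/4` and is not an involution, which
excludes a splitting. Over `A₅` the map `(π, ρ)` identifies the preimage with `A₅ × ℤ/2`. -/

namespace SimplicialSurgery

/-! ## Rescaling along rays -/

section Rescaling

variable {E : Type*} [NormedAddCommGroup E] [NormedSpace ℝ E]

/-- A continuous positively homogeneous function that is positive away from the origin. -/
structure IsGaugeLike (N : E → ℝ) : Prop where
  cont : Continuous N
  smul : ∀ (c : ℝ) (x : E), 0 ≤ c → N (c • x) = c * N x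
  pos : ∀ x, x ≠ 0 → 0 < N x

theorem isGaugeLike_norm : IsGaugeLike (fun x : E => ‖x‖) where
  cont := continuous_norm
  smul c x hc := by rw [norm_smul, Real.norm_of_nonneg hc]
  pos x hx := norm_pos_iff.2 hx

namespace IsGaugeLike

variable {N M : E → ℝ}

theorem zero (hN : IsGaugeLike N) : N 0 = 0 := by
  simpa using hN.smul 0 0 le_rfl

/-- By compactness `N` has a positive minimum on the unit sphere, and homogeneity spreads the
resulting bound to all vectors. -/
theorem exists_norm_le [FiniteDimensional ℝ E] (hN : IsGaugeLike N) :
    ∃ C, 0 ≤ C ∧ ∀ x, ‖x‖ ≤ C * N x := by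
  have := FiniteDimensional.proper ℝ E
  by_cases hne : (Metric.sphere (0 : E) 1).Nonempty
  · obtain ⟨y, hy, hmin⟩ := (isCompact_sphere (0 : E) 1).exists_isMinOn hne hN.cont.continuousOn
    have hy0 : y ≠ 0 := by
      rintro rfl
      simp at hy
    have hNy := hN.pos y hy0
    refine ⟨(N y)⁻¹, by positivity, fun x => ?_⟩
    rcases eq_or_ne x 0 with rfl | hx
    · simp [hN.zero]
    · have hx' := norm_pos_iff.2 hx
      have h1 : N y ≤ N (‖x‖⁻¹ • x) := hmin (by
        simp [norm_smul, inv_mul_cancel₀ hx'.ne'])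
      rw [hN.smul _ _ (by positivity)] at h1
      rw [inv_mul_eq_div, le_div_iff₀ hNy]
      calc ‖x‖ * N y ≤ ‖x‖ * (‖x‖⁻¹ * N x) := by gcongr
        _ = N x := by field_simp
  -- An empty unit sphere means that the space is zero.
  · refine ⟨0, le_rfl, fun x => ?_⟩
    rcases eq_or_ne x 0 with rfl | hx
    · simp
    · exact (hne ⟨‖x‖⁻¹ • x, by simp [norm_smul, inv_mul_cancel₀ (norm_pos_iff.2 hx).ne']⟩).elim

/-- Only the origin is delicate, where the quotient degenerates. There the image has norm at most `C
* |N x|`, which tends to zero. -/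
theorem continuous_rescale [FiniteDimensional ℝ E] (hN : IsGaugeLike N) (hM : IsGaugeLike M) :
    Continuous fun x => (N x / M x) • x := by
  rw [continuous_iff_continuousAt]
  intro x
  rcases eq_or_ne x 0 with rfl | hx
  · obtain ⟨C, hC, hle⟩ := hM.exists_norm_le
    rw [ContinuousAt, smul_zero]
    have hlim : Filter.Tendsto (fun x => |N x| * C) (nhds 0) (nhds 0) := by
      have h := ((hN.cont.abs).mul_const C).tendsto 0
      simpa [hN.zero] using h
    refine squeeze_zero_norm (fun x => ?_) hlim
    rcases eq_or_ne x 0 with rfl | hx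
    · simp [hN.zero]
    · have hMx := hM.pos x hx
      rw [norm_smul, norm_div, Real.norm_eq_abs, Real.norm_of_nonneg hMx.le]
      calc |N x| / M x * ‖x‖ ≤ |N x| / M x * (C * M x) := by gcongr; exact hle x
        _ = |N x| * C := by field_simp
  · exact (hN.cont.continuousAt.div hM.cont.continuousAt (hM.pos x hx).ne').smul continuousAt_id

theorem apply_rescale (hN : IsGaugeLike N) (hM : IsGaugeLike M) (x : E) :
    M ((N x / M x) • x) = N x := by
  rcases eq_or_ne x 0 with rfl | hx
  · simp [hN.zero, hM.zero]
  · have h1 := hN.pos x hx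
    have h2 := hM.pos x hx
    rw [hM.smul _ _ (by positivity)]
    field_simp

theorem rescale_rescale (hN : IsGaugeLike N) (hM : IsGaugeLike M) (x : E) :
    (M ((N x / M x) • x) / N ((N x / M x) • x)) • ((N x / M x) • x) = x := by
  rcases eq_or_ne x 0 with rfl | hx
  · simp
  · have h1 := hN.pos x hx
    have h2 := hM.pos x hx
    rw [hN.apply_rescale hM, hN.smul _ _ (by positivity), smul_smul]
    have : N x / (N x / M x * N x) * (N x / M x) = 1 := by field_simp
    rw [this, one_smul]

/-- Rescaling along rays is a homeomorphism carrying one function to the other. -/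
noncomputable def rescale [FiniteDimensional ℝ E] (hN : IsGaugeLike N) (hM : IsGaugeLike M) :
    E ≃ₜ E where
  toFun x := (N x / M x) • x
  invFun x := (M x / N x) • x
  left_inv := hN.rescale_rescale hM
  right_inv := hM.rescale_rescale hN
  continuous_toFun := hN.continuous_rescale hM
  continuous_invFun := hM.continuous_rescale hN

/-- The unit ball of `N` is homeomorphic to the closed unit ball. -/
noncomputable def ballHomeomorph [FiniteDimensional ℝ E] (hN : IsGaugeLike N) :
    {x | N x ≤ 1} ≃ₜ Metric.closedBall (0 : E) 1 :=
  (hN.rescale isGaugeLike_norm).subtype fun x => by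
    have h : ‖hN.rescale isGaugeLike_norm x‖ = N x := hN.apply_rescale isGaugeLike_norm x
    simp [h]

/-- The unit sphere of `N` is homeomorphic to the unit sphere. -/
noncomputable def sphereHomeomorph [FiniteDimensional ℝ E] (hN : IsGaugeLike N) :
    {x | N x = 1} ≃ₜ Metric.sphere (0 : E) 1 :=
  (hN.rescale isGaugeLike_norm).subtype fun x => by
    have h : ‖hN.rescale isGaugeLike_norm x‖ = N x := hN.apply_rescale isGaugeLike_norm x
    simp [h]

end IsGaugeLike

end Rescaling

/-! ## Block oscillation -/

section Oscillation

variable {V : Type*}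

/-- The minimum of `f` over the nonempty block `X`. -/
noncomputable def blockMin (X : Finset V) (hX : X.Nonempty) (f : V → ℝ) : ℝ := X.inf' hX f

variable {X : Finset V} {hX : X.Nonempty} {f g : V → ℝ}

theorem blockMin_le {v : V} (hv : v ∈ X) : blockMin X hX f ≤ f v := Finset.inf'_le _ hv

theorem exists_eq_blockMin (X : Finset V) (hX : X.Nonempty) (f : V → ℝ) :
    ∃ v ∈ X, f v = blockMin X hX f := by
  obtain ⟨v, hv, h⟩ := X.exists_mem_eq_inf' hX f
  exact ⟨v, hv, h.symm⟩

theorem blockMin_eq_of {m : ℝ} (h : ∀ v ∈ X, m ≤ f v) (h' : ∃ v ∈ X, f v = m) :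
    blockMin X hX f = m := by
  obtain ⟨v, hv, rfl⟩ := h'
  exact le_antisymm (blockMin_le hv) (Finset.le_inf' _ _ h)

theorem blockMin_add_const {c : ℝ} (h : ∀ v ∈ X, g v = f v + c) :
    blockMin X hX g = blockMin X hX f + c := by
  apply blockMin_eq_of
  · intro v hv
    rw [h v hv]
    linarith [blockMin_le (hX := hX) (f := f) hv]
  · obtain ⟨v, hv, h'⟩ := exists_eq_blockMin X hX f
    exact ⟨v, hv, by rw [h v hv, h']⟩

theorem continuous_blockMin {Y : Type*} [TopologicalSpace Y] {F : Y → V → ℝ}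
    (hF : ∀ v ∈ X, Continuous fun y => F y v) : Continuous fun y => blockMin X hX (F y) :=
  Continuous.finset_inf'_apply (f := fun v y => F y v) hX hF

/-- The sum of the excesses of the values of `f` over the minimum of the block `X`. -/
noncomputable def oscillation (X : Finset V) (hX : X.Nonempty) (f : V → ℝ) : ℝ :=
  ∑ v ∈ X, (f v - blockMin X hX f)

theorem oscillation_nonneg : 0 ≤ oscillation X hX f :=
  Finset.sum_nonneg fun _ hv => sub_nonneg.2 (blockMin_le hv)

theorem oscillation_eq : oscillation X hX f = ∑ v ∈ X, f v - X.card * blockMin X hX f := by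
  simp [oscillation, Finset.sum_sub_distrib]

/-- Only differences inside the block matter, so coordinates may be taken relative to a base vertex
of the block. -/
theorem oscillation_congr {c : ℝ} (h : ∀ v ∈ X, g v = f v + c) :
    oscillation X hX g = oscillation X hX f := by
  unfold oscillation
  refine Finset.sum_congr rfl fun v hv => ?_
  rw [blockMin_add_const h, h v hv]
  ring

theorem oscillation_smul {c : ℝ} (hc : 0 ≤ c) (h : ∀ v ∈ X, g v = c * f v) :
    oscillation X hX g = c * oscillation X hX f := by
  have hm : blockMin X hX g = c * blockMin X hX f := by
    apply blockMin_eq_of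
    · intro v hv
      rw [h v hv]
      exact mul_le_mul_of_nonneg_left (blockMin_le hv) hc
    · obtain ⟨v, hv, h'⟩ := exists_eq_blockMin X hX f
      exact ⟨v, hv, by rw [h v hv, h']⟩
  unfold oscillation
  rw [Finset.mul_sum]
  refine Finset.sum_congr rfl fun v hv => ?_
  rw [hm, h v hv]
  ring

theorem eq_of_oscillation_eq_zero (h : oscillation X hX f = 0) {v w : V} (hv : v ∈ X)
    (hw : w ∈ X) : f v = f w := by
  have h' := (Finset.sum_eq_zero_iff_of_nonneg fun v hv =>
    sub_nonneg.2 (blockMin_le (hX := hX) (f := f) hv)).1 h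
  linarith [h' v hv, h' w hw]

theorem continuous_oscillation {Y : Type*} [TopologicalSpace Y] {F : Y → V → ℝ}
    (hF : ∀ v ∈ X, Continuous fun y => F y v) : Continuous fun y => oscillation X hX (F y) :=
  continuous_finsetSum _ fun v hv => (hF v hv).sub (continuous_blockMin hF)

end Oscillation

/-! ## Carriers -/

section Carrier

variable {V : Type*} [Fintype V]

/-- The support need only be bounded by a face: it is nonempty because the total weight is one,
hence it is itself a face. -/
theorem mem_carrier_of_forall {K : PreAbstractSimplicialComplex V} {f : V → ℝ} {t : Finset V}
    (h0 : ∀ v, 0 ≤ f v) (h1 : ∑ v, f v = 1) (ht : t ∈ K.faces) (hft : ∀ v, f v ≠ 0 → v ∈ t) :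
    f ∈ carrier K := by
  classical
  refine ⟨h0, h1, Finset.univ.filter (f · ≠ 0), (K.isRelLowerSet_faces ht).2 ?_ ?_, by simp⟩
  · intro v hv
    exact hft v (by simpa using hv)
  · by_contra hne
    rw [Finset.not_nonempty_iff_eq_empty, Finset.filter_eq_empty_iff] at hne
    have : ∑ v, f v = 0 := Finset.sum_eq_zero fun v hv => by simpa using hne hv
    linarith

/-- The carriers of a complex and of its image under an injective map are homeomorphic. -/
theorem nonempty_carrier_map_homeomorph {W : Type*} [Fintype W] [DecidableEq W]
    (K : PreAbstractSimplicialComplex V) {φ : V → W} (hφ : Function.Injective φ) :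
    Nonempty (carrier K ≃ₜ carrier (K.map φ)) := by
  classical
  have hsum : ∀ g : W → ℝ, (∀ w, w ∉ Set.range φ → g w = 0) → ∑ v, g (φ v) = ∑ w, g w := by
    intro g hg
    exact Finset.sum_of_injOn φ hφ.injOn (fun _ _ => Finset.mem_coe.2 (Finset.mem_univ _))
      (fun w _ hw => hg w (by simpa using hw)) (fun _ _ => rfl)
  have hext : ∀ (f : V → ℝ) (v : V), Function.extend φ f (0 : W → ℝ) (φ v) = f v :=
    fun f v => hφ.extend_apply f (0 : W → ℝ) v
  have hext0 : ∀ (f : V → ℝ) (w : W), w ∉ Set.range φ → Function.extend φ f (0 : W → ℝ) w = 0 :=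
    fun f w hw => Function.extend_apply' f (0 : W → ℝ) w (by simpa using hw)
  have hzero : ∀ g ∈ carrier (K.map φ), ∀ w, w ∉ Set.range φ → g w = 0 := by
    rintro g ⟨-, -, s, ⟨t, ht, rfl⟩, hs⟩ w hw
    by_contra hne
    obtain ⟨v, -, rfl⟩ := Finset.mem_image.1 ((hs w).1 hne)
    exact hw ⟨v, rfl⟩
  refine ⟨{
    toFun := fun f => ⟨Function.extend φ f.1 0, ?_⟩
    invFun := fun g => ⟨fun v => g.1 (φ v), ?_⟩
    left_inv := ?_
    right_inv := ?_
    continuous_toFun := ?_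
    continuous_invFun := ?_ }⟩
  · obtain ⟨f, h0, h1, s, hs, hfs⟩ := f
    refine mem_carrier_of_forall (t := s.image φ) ?_ ?_ ⟨s, hs, rfl⟩ ?_
    · intro w
      by_cases hw : w ∈ Set.range φ
      · obtain ⟨v, rfl⟩ := hw
        rw [hext]; exact h0 v
      · rw [hext0 f w hw]
    · rw [← hsum _ (hext0 f)]
      simpa only [hext] using h1
    · intro w hw
      by_cases hw' : w ∈ Set.range φ
      · obtain ⟨v, rfl⟩ := hw'
        rw [hext] at hw
        exact Finset.mem_image_of_mem φ ((hfs v).1 hw)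
      · exact (hw (hext0 f w hw')).elim
  · have hz := hzero g.1 g.2
    obtain ⟨g, h0, h1, s, ⟨t, ht, rfl⟩, hgs⟩ := g
    refine mem_carrier_of_forall (t := t) (fun v => h0 _) ?_ ht ?_
    · exact (hsum g hz).trans h1
    · intro v hv
      obtain ⟨v', hv', h⟩ := Finset.mem_image.1 ((hgs _).1 hv)
      rwa [← hφ h]
  · intro f
    ext v
    exact hext _ v
  · intro g
    ext w
    by_cases hw : w ∈ Set.range φ
    · obtain ⟨v, rfl⟩ := hw
      exact hext _ v
    · exact (hext0 _ w hw).trans (hzero g.1 g.2 w hw).symm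
  · refine Continuous.subtype_mk (continuous_pi fun w => ?_) _
    by_cases hw : w ∈ Set.range φ
    · obtain ⟨v, rfl⟩ := hw
      simp only [hext]
      exact (continuous_apply v).comp continuous_subtype_val
    · simp only [hext0 _ w hw]
      exact continuous_const
  · exact Continuous.subtype_mk (continuous_pi fun v =>
      Continuous.comp (g := fun g : W → ℝ => g (φ v)) (continuous_apply _)
        continuous_subtype_val) _

end Carrier

/-! ## Joins of a simplex with two boundaries of simplices -/

section JoinBall

variable {V : Type*}

/-- Three nonempty pairwise disjoint blocks of vertices. -/
structure IsBlocks (A B C : Finset V) : Prop where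
  nonemptyA : A.Nonempty
  nonemptyB : B.Nonempty
  nonemptyC : C.Nonempty
  disjAB : Disjoint A B
  disjAC : Disjoint A C
  disjBC : Disjoint B C

theorem IsBlocks.swap {A B C : Finset V} (h : IsBlocks A B C) : IsBlocks B A C :=
  ⟨h.nonemptyB, h.nonemptyA, h.nonemptyC, h.disjAB.symm, h.disjBC, h.disjAC⟩

theorem blockMin_eq_zero_of_not_subset {X s : Finset V} {hX : X.Nonempty} {f : V → ℝ}
    (h0 : ∀ v, 0 ≤ f v) (hs : ∀ v, f v ≠ 0 ↔ v ∈ s) (hXs : ¬ X ⊆ s) : blockMin X hX f = 0 := by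
  obtain ⟨x, hx, hxs⟩ := Finset.not_subset.1 hXs
  refine blockMin_eq_of (fun v _ => h0 v) ⟨x, hx, ?_⟩
  by_contra hne
  exact hxs ((hs x).1 hne)

variable [DecidableEq V]

/-- The join of the simplex `A` with the boundaries of the simplices `B` and `C`. -/
def joinBall (A B C : Finset V) : PreAbstractSimplicialComplex V where
  faces := {t | t.Nonempty ∧ t ⊆ A ∪ B ∪ C ∧ ¬ B ⊆ t ∧ ¬ C ⊆ t}
  isRelLowerSet_faces := by
    rintro t ⟨ht, hs, hB, hC⟩
    exact ⟨ht, fun u hut hu =>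
      ⟨hu, hut.trans hs, fun h => hB (h.trans hut), fun h => hC (h.trans hut)⟩⟩

variable {A B C : Finset V}

/-- The boundary is `∂A * ∂B * ∂C`. A ridge has `d` of the `d + 3` vertices and misses one of `B`
and one of `C`. If the third missing vertex lies in `A`, only that vertex can be added to obtain a
facet. If it lies in `B` or `C`, that block misses two vertices, either of which can be added, so
the ridge is interior. -/
theorem mem_boundary_joinBall (h : IsBlocks A B C) {d : ℕ} (hd : A.card + B.card + C.card = d + 3)
    (hd1 : 1 ≤ d) {t : Finset V} :
    t ∈ (boundary d (joinBall A B C)).faces ↔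
      t.Nonempty ∧ t ⊆ A ∪ B ∪ C ∧ ¬ A ⊆ t ∧ ¬ B ⊆ t ∧ ¬ C ⊆ t := by
  have hAB := Finset.disjoint_left.1 h.disjAB
  have hAC := Finset.disjoint_left.1 h.disjAC
  have hBC := Finset.disjoint_left.1 h.disjBC
  have hU : (A ∪ B ∪ C).card = d + 3 := by
    rw [Finset.card_union_of_disjoint, Finset.card_union_of_disjoint h.disjAB, hd]
    exact Finset.disjoint_union_left.2 ⟨h.disjAC, h.disjBC⟩
  constructor
  · rintro ⟨htne, r, ⟨⟨-, hrU, hrB, hrC⟩, hrd, s, ⟨hs, hsd, hrs⟩, huniq⟩, htr⟩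
    refine ⟨htne, htr.trans hrU, fun hAt => ?_, fun hB => hrB (hB.trans htr),
      fun hC => hrC (hC.trans htr)⟩
    have hAr := hAt.trans htr
    obtain ⟨b, hb, hbr⟩ := Finset.not_subset.1 hrB
    obtain ⟨c, hc, hcr⟩ := Finset.not_subset.1 hrC
    have hbc : b ≠ c := fun e => hBC hb (e ▸ hc)
    have hcard : (insert b (insert c r)).card = d + 2 := by
      rw [Finset.card_insert_of_notMem, Finset.card_insert_of_notMem hcr, hrd]
      simp [hbc, hbr]
    -- The third missing vertex. As `A ⊆ r`, it lies in the block of `b` or of `c`, and adding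
    -- either of the two vertices of that block gives distinct facets over `r`.
    obtain ⟨x, hxU, hx⟩ := Finset.exists_mem_notMem_of_card_lt_card
      (show (insert b (insert c r)).card < (A ∪ B ∪ C).card by omega)
    simp only [Finset.mem_insert, not_or] at hx
    obtain ⟨hxb, hxc, hxr⟩ := hx
    have key : ∀ y ∈ A ∪ B ∪ C, y ∉ r → ¬ B ⊆ insert y r → ¬ C ⊆ insert y r →
        insert y r = s := by
      intro y hyU hyr hB hC
      refine huniq _ ⟨⟨Finset.insert_nonempty _ _, ?_, hB, hC⟩, ?_, Finset.subset_insert _ _⟩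
      · exact Finset.insert_subset hyU hrU
      · rw [Finset.card_insert_of_notMem hyr, hrd]
    have hxBC : x ∈ B ∨ x ∈ C := by
      simp only [Finset.mem_union] at hxU
      rcases hxU with (hxA | hxB) | hxC
      · exact (hxr (hAr hxA)).elim
      · exact Or.inl hxB
      · exact Or.inr hxC
    have hne : ∀ y z : V, z ∉ r → y ≠ z → z ∉ insert y r := by
      intro y z hz hyz
      simp [hz, hyz.symm]
    rcases hxBC with hxB | hxC
    · have h1 := key x (by simp [hxB]) hxr (fun hh => hne x b hbr hxb (hh hb))
        (fun hh => hne x c hcr hxc (hh hc))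
      have h2 := key b (by simp [hb]) hbr (fun hh => hne b x hxr (Ne.symm hxb) (hh hxB))
        (fun hh => hne b c hcr hbc (hh hc))
      have : x ∈ insert b r := by rw [h2, ← h1]; simp
      exact hne b x hxr (Ne.symm hxb) this
    · have h1 := key x (by simp [hxC]) hxr (fun hh => hne x b hbr hxb (hh hb))
        (fun hh => hne x c hcr hxc (hh hc))
      have h2 := key c (by simp [hc]) hcr (fun hh => hne c b hbr (Ne.symm hbc) (hh hb))
        (fun hh => hne c x hxr (Ne.symm hxc) (hh hxC))
      have : x ∈ insert c r := by rw [h2, ← h1]; simp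
      exact hne c x hxr (Ne.symm hxc) this
  · rintro ⟨htne, htU, hA, hB, hC⟩
    obtain ⟨a, ha, hat⟩ := Finset.not_subset.1 hA
    obtain ⟨b, hb, hbt⟩ := Finset.not_subset.1 hB
    obtain ⟨c, hc, hct⟩ := Finset.not_subset.1 hC
    have hab : a ≠ b := fun e => hAB ha (e ▸ hb)
    have hac : a ≠ c := fun e => hAC ha (e ▸ hc)
    have hbc : b ≠ c := fun e => hBC hb (e ▸ hc)
    have hsub : t ⊆ (A ∪ B ∪ C) \ {a, b, c} := by
      intro v hv
      simp only [Finset.mem_sdiff, Finset.mem_insert, Finset.mem_singleton]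
      refine ⟨htU hv, ?_⟩
      rintro (rfl | rfl | rfl) <;> contradiction
    have hrd : ((A ∪ B ∪ C) \ {a, b, c}).card = d := by
      rw [Finset.card_sdiff_of_subset, hU, Finset.card_eq_three.2 ⟨a, b, c, hab, hac, hbc, rfl⟩]
      · omega
      · intro v hv
        simp only [Finset.mem_insert, Finset.mem_singleton] at hv
        rcases hv with rfl | rfl | rfl <;> simp [*]
    have hmemB : ∀ {s : Finset V}, b ∉ s → ¬ B ⊆ s := fun hs hh => hs (hh hb)
    have hmemC : ∀ {s : Finset V}, c ∉ s → ¬ C ⊆ s := fun hs hh => hs (hh hc)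
    refine ⟨htne, _, ⟨⟨htne.mono hsub, Finset.sdiff_subset, hmemB (by simp), hmemC (by simp)⟩, hrd,
      insert a ((A ∪ B ∪ C) \ {a, b, c}), ⟨⟨Finset.insert_nonempty _ _, ?_, hmemB ?_, hmemC ?_⟩,
        ?_, Finset.subset_insert _ _⟩, ?_⟩, hsub⟩
    · exact Finset.insert_subset (by simp [ha]) Finset.sdiff_subset
    · simp [hab.symm]
    · simp [hac.symm]
    · rw [Finset.card_insert_of_notMem (by simp), hrd]
    · rintro s ⟨⟨-, hsU, hsB, hsC⟩, hsd, hrs⟩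
      have hin : ∀ v ∈ A ∪ B ∪ C, v ∉ s → v = a ∨ v = b ∨ v = c := by
        intro v hv hvs
        by_contra hcon
        exact hvs (hrs (by simpa [Finset.mem_sdiff] using ⟨by simpa using hv, by simpa using hcon⟩))
      obtain ⟨b', hb', hbs⟩ := Finset.not_subset.1 hsB
      obtain ⟨c', hc', hcs⟩ := Finset.not_subset.1 hsC
      have hb_eq : b' = b := by
        rcases hin b' (by simp [hb']) hbs with rfl | rfl | rfl
        · exact (hAB ha hb').elim
        · rfl
        · exact (hBC hb' hc).elim
      have hc_eq : c' = c := by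
        rcases hin c' (by simp [hc']) hcs with rfl | rfl | rfl
        · exact (hAC ha hc').elim
        · exact (hBC hb hc').elim
        · rfl
      subst hb_eq hc_eq
      refine Finset.eq_of_subset_of_card_le ?_ ?_
      · intro v hv
        simp only [Finset.mem_insert, Finset.mem_sdiff, Finset.mem_singleton, not_or]
        by_cases hva : v = a
        · exact Or.inl hva
        · exact Or.inr ⟨hsU hv, hva, fun e => hbs (e ▸ hv), fun e => hcs (e ▸ hv)⟩
      · rw [Finset.card_insert_of_notMem (by simp), hrd, hsd]

/-- The join `∂A * ∂B * ∂C` is symmetric in `A` and `B`. -/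
theorem boundary_joinBall_swap (h : IsBlocks A B C) {d : ℕ}
    (hd : A.card + B.card + C.card = d + 3) (hd1 : 1 ≤ d) :
    boundary d (joinBall A B C) = boundary d (joinBall B A C) := by
  apply PreAbstractSimplicialComplex.ext
  ext t
  rw [mem_boundary_joinBall h hd hd1, mem_boundary_joinBall h.swap (by omega) hd1,
    Finset.union_comm A B]
  tauto

/-! ### The carrier of such a join is a ball -/

theorem sum_eq_sum_blocks [Fintype V] (h : IsBlocks A B C) {f : V → ℝ}
    (hf : ∀ v, v ∉ A ∪ B ∪ C → f v = 0) :
    ∑ v, f v = ∑ v ∈ A, f v + ∑ v ∈ B, f v + ∑ v ∈ C, f v := by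
  rw [← Finset.sum_union h.disjAB, ← Finset.sum_union
    (Finset.disjoint_union_left.2 ⟨h.disjAC, h.disjBC⟩)]
  exact (Finset.sum_subset (Finset.subset_univ _) fun v _ hv => hf v hv).symm

/-- A point is determined by the differences of its coordinates within the three blocks. Its minima
on `B` and `C` are zero, since the support contains neither block, and the minimum on `A` is
recovered from the total mass, which is the sum `N` of the oscillations plus `A.card` times that
minimum. Nonnegativity of this minimum is the condition `N ≤ 1`. -/
theorem nonempty_carrier_joinBall_homeomorph [Fintype V] (h : IsBlocks A B C) {d : ℕ}
    (hd : A.card + B.card + C.card = d + 3) :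
    ∃ N : EuclideanSpace ℝ (Fin d) → ℝ, IsGaugeLike N ∧
      Nonempty (carrier (joinBall A B C) ≃ₜ {x | N x ≤ 1}) := by
  have hAB := Finset.disjoint_left.1 h.disjAB
  have hAC := Finset.disjoint_left.1 h.disjAC
  have hBC := Finset.disjoint_left.1 h.disjBC
  obtain ⟨a, ha⟩ := h.nonemptyA
  obtain ⟨b, hb⟩ := h.nonemptyB
  obtain ⟨c, hc⟩ := h.nonemptyC
  have hab : a ≠ b := fun e => hAB ha (e ▸ hb)
  have hac : a ≠ c := fun e => hAC ha (e ▸ hc)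
  have hbc : b ≠ c := fun e => hBC hb (e ▸ hc)
  have hU : (A ∪ B ∪ C).card = d + 3 := by
    rw [Finset.card_union_of_disjoint, Finset.card_union_of_disjoint h.disjAB, hd]
    exact Finset.disjoint_union_left.2 ⟨h.disjAC, h.disjBC⟩
  -- With one base vertex removed from each block, exactly `d` coordinates remain.
  obtain ⟨R, hR⟩ : ∃ R, R = (A ∪ B ∪ C) \ {a, b, c} := ⟨_, rfl⟩
  have hRd : R.card = d := by
    rw [hR, Finset.card_sdiff_of_subset, hU, Finset.card_eq_three.2 ⟨a, b, c, hab, hac, hbc, rfl⟩]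
    · omega
    · intro v hv
      simp only [Finset.mem_insert, Finset.mem_singleton] at hv
      rcases hv with rfl | rfl | rfl <;> simp [*]
  let e : R ≃ Fin d := R.equivFinOfCardEq hRd
  let ext : EuclideanSpace ℝ (Fin d) → V → ℝ := fun u v => if hv : v ∈ R then u (e ⟨v, hv⟩) else 0
  have ext_cont : ∀ v, Continuous fun u => ext u v := by
    intro v
    by_cases hv : v ∈ R
    · simp only [ext, hv, dif_pos]
      fun_prop
    · simp only [ext, hv]
      exact continuous_const
  have hRU : ∀ v ∈ R, v ∈ A ∪ B ∪ C := fun v hv => by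
    rw [hR] at hv
    exact (Finset.mem_sdiff.1 hv).1
  have haR : a ∉ R := by simp [hR]
  have hbR : b ∉ R := by simp [hR]
  have hcR : c ∉ R := by simp [hR]
  have ext_a : ∀ u, ext u a = 0 := fun u => by simp [ext, haR]
  have ext_b : ∀ u, ext u b = 0 := fun u => by simp [ext, hbR]
  have ext_c : ∀ u, ext u c = 0 := fun u => by simp [ext, hcR]
  let N : EuclideanSpace ℝ (Fin d) → ℝ := fun u => oscillation A h.nonemptyA (ext u) +
    oscillation B h.nonemptyB (ext u) + oscillation C h.nonemptyC (ext u)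
  have hN : IsGaugeLike N := by
    refine ⟨?_, ?_, ?_⟩
    · exact ((continuous_oscillation fun v _ => ext_cont v).add
        (continuous_oscillation fun v _ => ext_cont v)).add
        (continuous_oscillation fun v _ => ext_cont v)
    · intro r u hr
      have hext : ∀ v, ext (r • u) v = r * ext u v := by
        intro v
        by_cases hv : v ∈ R <;> simp [ext, hv]
      simp only [N]
      rw [oscillation_smul hr fun v _ => hext v, oscillation_smul hr fun v _ => hext v,
        oscillation_smul hr fun v _ => hext v]
      ring
    -- If all oscillations vanish, each block is constant, with the value 0 of its base vertex.
    · intro u hu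
      by_contra hle
      have h1 := oscillation_nonneg (X := A) (hX := h.nonemptyA) (f := ext u)
      have h2 := oscillation_nonneg (X := B) (hX := h.nonemptyB) (f := ext u)
      have h3 := oscillation_nonneg (X := C) (hX := h.nonemptyC) (f := ext u)
      have hle' : oscillation A h.nonemptyA (ext u) + oscillation B h.nonemptyB (ext u) +
        oscillation C h.nonemptyC (ext u) ≤ 0 := not_lt.1 hle
      apply hu
      ext i
      have hmem : (e.symm i : V) ∈ R := (e.symm i).2
      have hval : ext u (e.symm i) = u i := by
          simp only [ext, (e.symm i).2, dif_pos, Subtype.coe_eta, Equiv.apply_symm_apply]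
      have hmem' : (e.symm i : V) ∈ A ∪ B ∪ C := by
        exact hRU _ hmem
      simp only [Finset.mem_union] at hmem'
      rw [← hval]
      rcases hmem' with (hm | hm) | hm
      · rw [eq_of_oscillation_eq_zero (hX := h.nonemptyA) (f := ext u) (by linarith) hm ha, ext_a]; rfl
      · rw [eq_of_oscillation_eq_zero (hX := h.nonemptyB) (f := ext u) (by linarith) hm hb, ext_b]; rfl
      · rw [eq_of_oscillation_eq_zero (hX := h.nonemptyC) (f := ext u) (by linarith) hm hc, ext_c]; rfl
  let base : V → V := fun v => if v ∈ A then a else if v ∈ B then b else c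
  have base_A : ∀ v ∈ A, base v = a := fun v hv => by simp [base, hv]
  have base_B : ∀ v ∈ B, base v = b := fun v hv => by
    simp only [base, hv, if_true, if_neg fun hvA => hAB hvA hv]
  have base_C : ∀ v ∈ C, base v = c := fun v hv => by
    simp only [base, if_neg fun hvA => hAC hvA hv, if_neg fun hvB => hBC hvB hv]
  let co : (V → ℝ) → EuclideanSpace ℝ (Fin d) := fun f =>
    WithLp.toLp 2 fun i => f (e.symm i) - f (base (e.symm i))
  have co_cont : Continuous co := by
    simp only [co]
    fun_prop
  have ext_co : ∀ f, ∀ v ∈ A ∪ B ∪ C, ext (co f) v = f v - f (base v) := by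
    intro f v hv
    by_cases hvR : v ∈ R
    · simp [ext, co, hvR]
    · have : v = a ∨ v = b ∨ v = c := by
        by_contra hcon
        apply hvR
        rw [hR, Finset.mem_sdiff]
        exact ⟨hv, by simpa using hcon⟩
      rcases this with rfl | rfl | rfl
      · rw [ext_a, base_A _ ha, sub_self]
      · rw [ext_b, base_B _ hb, sub_self]
      · rw [ext_c, base_C _ hc, sub_self]
  have ext_coA : ∀ f, ∀ v ∈ A, ext (co f) v = f v + -f a := fun f v hv => by
    rw [ext_co f v (by simp [hv]), base_A v hv, sub_eq_add_neg]
  have ext_coB : ∀ f, ∀ v ∈ B, ext (co f) v = f v + -f b := fun f v hv => by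
    rw [ext_co f v (by simp [hv]), base_B v hv, sub_eq_add_neg]
  have ext_coC : ∀ f, ∀ v ∈ C, ext (co f) v = f v + -f c := fun f v hv => by
    rw [ext_co f v (by simp [hv]), base_C v hv, sub_eq_add_neg]
  have N_co : ∀ f, N (co f) = oscillation A h.nonemptyA f + oscillation B h.nonemptyB f +
      oscillation C h.nonemptyC f := by
    intro f
    simp only [N]
    rw [oscillation_congr (ext_coA f), oscillation_congr (ext_coB f),
      oscillation_congr (ext_coC f)]
  have hcarrier : ∀ f ∈ carrier (joinBall A B C), blockMin B h.nonemptyB f = 0 ∧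
      blockMin C h.nonemptyC f = 0 ∧ (∀ v, v ∉ A ∪ B ∪ C → f v = 0) ∧
      N (co f) = 1 - A.card * blockMin A h.nonemptyA f := by
    rintro f ⟨h0, h1, s, ⟨-, hsU, hsB, hsC⟩, hs⟩
    have hB := blockMin_eq_zero_of_not_subset (hX := h.nonemptyB) h0 hs hsB
    have hC := blockMin_eq_zero_of_not_subset (hX := h.nonemptyC) h0 hs hsC
    have hoff : ∀ v, v ∉ A ∪ B ∪ C → f v = 0 := by
      intro v hv
      by_contra hne
      exact hv (hsU ((hs v).1 hne))
    refine ⟨hB, hC, hoff, ?_⟩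
    rw [N_co, oscillation_eq, oscillation_eq, oscillation_eq, hB, hC, ← h1,
      sum_eq_sum_blocks h hoff]
    ring
  have hApos : (0 : ℝ) < A.card := by exact_mod_cast Finset.card_pos.2 h.nonemptyA
  -- The added constants make the minima on `B` and `C` zero and the minimum on `A` equal to `(1 - N
  -- u) / A.card`, which brings the total mass to one.
  let inv : EuclideanSpace ℝ (Fin d) → V → ℝ := fun u v =>
    if v ∈ A then ext u v + (-blockMin A h.nonemptyA (ext u) + (1 - N u) / A.card)
    else if v ∈ B then ext u v + -blockMin B h.nonemptyB (ext u)
    else if v ∈ C then ext u v + -blockMin C h.nonemptyC (ext u) else 0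
  have inv_A : ∀ u, ∀ v ∈ A, inv u v =
      ext u v + (-blockMin A h.nonemptyA (ext u) + (1 - N u) / A.card) := by
    intro u v hv
    simp [inv, hv]
  have inv_B : ∀ u, ∀ v ∈ B, inv u v = ext u v + -blockMin B h.nonemptyB (ext u) := by
    intro u v hv
    simp only [inv, hv, if_true, if_neg fun hvA => hAB hvA hv]
  have inv_C : ∀ u, ∀ v ∈ C, inv u v = ext u v + -blockMin C h.nonemptyC (ext u) := by
    intro u v hv
    simp only [inv, hv, if_true, if_neg fun hvA => hAC hvA hv, if_neg fun hvB => hBC hvB hv]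
  have inv_off : ∀ u v, v ∉ A ∪ B ∪ C → inv u v = 0 := by
    intro u v hv
    simp only [Finset.mem_union, not_or] at hv
    simp [inv, hv.1.1, hv.1.2, hv.2]
  have inv_cont : ∀ v, Continuous fun u => inv u v := by
    intro v
    have hm : ∀ (X : Finset V) (hX : X.Nonempty), Continuous fun u => blockMin X hX (ext u) :=
      fun X hX => continuous_blockMin fun v _ => ext_cont v
    simp only [inv]
    split_ifs
    · exact (ext_cont v).add ((hm _ _).neg.add ((continuous_const.sub hN.cont).div_const _))
    · exact (ext_cont v).add (hm _ _).neg
    · exact (ext_cont v).add (hm _ _).neg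
    · exact continuous_const
  refine ⟨N, hN, ⟨{
    toFun := fun f => ⟨co f.1, ?_⟩
    invFun := fun u => ⟨inv u.1, ?_⟩
    left_inv := ?_
    right_inv := ?_
    continuous_toFun := ?_
    continuous_invFun := ?_ }⟩⟩
  · rw [Set.mem_ofPred_eq, (hcarrier f.1 f.2).2.2.2]
    have : 0 ≤ blockMin A h.nonemptyA f.1 := Finset.le_inf' _ _ fun v _ => f.2.1 v
    nlinarith
  · obtain ⟨u, hu⟩ := u
    have hu' : N u ≤ 1 := hu
    have hfrac : 0 ≤ (1 - N u) / A.card := div_nonneg (by linarith) hApos.le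
    have hmB : blockMin B h.nonemptyB (inv u) = 0 := by
      rw [blockMin_add_const (inv_B u)]; ring
    have hmC : blockMin C h.nonemptyC (inv u) = 0 := by
      rw [blockMin_add_const (inv_C u)]; ring
    have hmA : blockMin A h.nonemptyA (inv u) = (1 - N u) / A.card := by
      rw [blockMin_add_const (inv_A u)]; ring
    have hnn : ∀ v, 0 ≤ inv u v := by
      intro v
      by_cases hv : v ∈ A ∪ B ∪ C
      · simp only [Finset.mem_union] at hv
        rcases hv with (hv | hv) | hv
        · exact (hfrac.trans_eq hmA.symm).trans (blockMin_le hv)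
        · exact hmB.symm.le.trans (blockMin_le hv)
        · exact hmC.symm.le.trans (blockMin_le hv)
      · rw [inv_off u v hv]
    have hsum : ∑ v, inv u v = 1 := by
      have hNu : N u = oscillation A h.nonemptyA (inv u) + oscillation B h.nonemptyB (inv u) +
          oscillation C h.nonemptyC (inv u) := by
        rw [oscillation_congr (inv_A u), oscillation_congr (inv_B u),
          oscillation_congr (inv_C u)]
      rw [sum_eq_sum_blocks h (inv_off u)]
      rw [oscillation_eq, oscillation_eq, oscillation_eq, hmA, hmB, hmC] at hNu
      have : (A.card : ℝ) * ((1 - N u) / A.card) = 1 - N u := by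
        rw [mul_div_assoc', mul_div_cancel_left₀ _ hApos.ne']
      linarith
    refine ⟨hnn, hsum, Finset.univ.filter (inv u · ≠ 0), ⟨?_, ?_, ?_, ?_⟩, fun v => by
      rw [Finset.mem_filter]; exact ⟨fun hv => ⟨Finset.mem_univ _, hv⟩, fun hv => hv.2⟩⟩
    · by_contra hne
      rw [Finset.not_nonempty_iff_eq_empty, Finset.filter_eq_empty_iff] at hne
      have : ∑ v, inv u v = 0 := Finset.sum_eq_zero fun v hv => by simpa using hne hv
      linarith
    · intro v hv
      by_contra hvU
      simp [inv_off u v hvU] at hv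
    · intro hsub
      obtain ⟨v, hv, hv'⟩ := exists_eq_blockMin B h.nonemptyB (inv u)
      have := hsub hv
      simp [hv', hmB] at this
    · intro hsub
      obtain ⟨v, hv, hv'⟩ := exists_eq_blockMin C h.nonemptyC (inv u)
      have := hsub hv
      simp [hv', hmC] at this
  · rintro ⟨f, hf⟩
    obtain ⟨hB, hC, hoff, hNf⟩ := hcarrier f hf
    apply Subtype.ext
    funext v
    change inv (co f) v = f v
    by_cases hv : v ∈ A ∪ B ∪ C
    · simp only [Finset.mem_union] at hv
      rcases hv with (hv | hv) | hv
      · rw [inv_A _ v hv, ext_coA f v hv, blockMin_add_const (ext_coA f), hNf,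
          sub_sub_cancel, mul_div_cancel_left₀ _ hApos.ne']
        ring
      · rw [inv_B _ v hv, ext_coB f v hv, blockMin_add_const (ext_coB f), hB]
        ring
      · rw [inv_C _ v hv, ext_coC f v hv, blockMin_add_const (ext_coC f), hC]
        ring
    · rw [inv_off _ v hv, hoff v hv]
  · rintro ⟨u, hu⟩
    apply Subtype.ext
    change co (inv u) = u
    ext i
    have hval : ext u (e.symm i) = u i := by
          simp only [ext, (e.symm i).2, dif_pos, Subtype.coe_eta, Equiv.apply_symm_apply]
    have hmem : (e.symm i : V) ∈ A ∪ B ∪ C := by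
      exact hRU _ (e.symm i).2
    change inv u (e.symm i) - inv u (base (e.symm i)) = u i
    rw [← hval]
    simp only [Finset.mem_union] at hmem
    rcases hmem with (hm | hm) | hm
    · rw [base_A _ hm, inv_A u _ hm, inv_A u _ ha, ext_a]; ring
    · rw [base_B _ hm, inv_B u _ hm, inv_B u _ hb, ext_b]; ring
    · rw [base_C _ hm, inv_C u _ hm, inv_C u _ hc, ext_c]; ring
  · exact (co_cont.comp continuous_subtype_val).subtype_mk _
  · exact (continuous_pi fun v => (inv_cont v).comp continuous_subtype_val).subtype_mk _

theorem isTriangulatedBall_joinBall [Fintype V] (h : IsBlocks A B C) {d : ℕ}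
    (hd : A.card + B.card + C.card = d + 3) : IsTriangulatedBall d (joinBall A B C) := by
  obtain ⟨N, hN, ⟨φ⟩⟩ := nonempty_carrier_joinBall_homeomorph h hd
  exact ⟨φ.trans hN.ballHomeomorph⟩

end JoinBall

/-! ## Generalized bistellar flips -/

section Flip

variable {V : Type*} [DecidableEq V] {A B C : Finset V} {X X' : PreAbstractSimplicialComplex V}

/-- `X'` arises from `X` by replacing `A * ∂B * ∂C`, which contains the star of `A`, with
`B * ∂A * ∂C`, where `B` is not a face of `X`. -/
structure IsFlip (A B C : Finset V) (X X' : PreAbstractSimplicialComplex V) : Prop where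
  blocks : IsBlocks A B C
  sub : ∀ t ∈ (joinBall A B C).faces, t ∈ X.faces
  star : ∀ t ∈ X.faces, A ⊆ t → t ∈ (joinBall A B C).faces
  notMem : ∀ t ∈ X.faces, ¬ B ⊆ t
  faces_eq : X'.faces = (X.faces \ (joinBall A B C).faces) ∪ (joinBall B A C).faces

namespace IsFlip

/-- A face of the old ball that does not contain `A` is also a face of the new ball, so only faces
containing `A` are lost. -/
theorem mem_of_not_subset (h : IsFlip A B C X X') {t : Finset V} (ht : t ∈ X.faces)
    (hA : ¬ A ⊆ t) : t ∈ X'.faces := by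
  rw [h.faces_eq]
  by_cases htD : t ∈ (joinBall A B C).faces
  · obtain ⟨h1, h2, h3, h4⟩ := htD
    exact Or.inr ⟨h1, by rwa [Finset.union_comm B A], hA, h4⟩
  · exact Or.inl ⟨ht, htD⟩

/-- After the move every face containing `B` lies in the new ball and no face contains `A`, so the
two blocks exchange roles. -/
theorem symm (h : IsFlip A B C X X') : IsFlip B A C X' X where
  blocks := h.blocks.swap
  sub t ht := by rw [h.faces_eq]; exact Or.inr ht
  star t ht hB := by
    rw [h.faces_eq] at ht
    exact ht.resolve_left fun ht' => h.notMem t ht'.1 hB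
  notMem t ht hA := by
    rw [h.faces_eq] at ht
    rcases ht with ht | ht
    · exact ht.2 (h.star t ht.1 hA)
    · exact ht.2.2.1 hA
  faces_eq := by
    ext t
    constructor
    · intro ht
      by_cases htD : t ∈ (joinBall A B C).faces
      · exact Or.inr htD
      · refine Or.inl ⟨?_, fun htD' => htD ?_⟩
        · rw [h.faces_eq]; exact Or.inl ⟨ht, htD⟩
        · obtain ⟨h1, h2, h3, h4⟩ := htD'
          exact ⟨h1, by rwa [Finset.union_comm A B], h.notMem t ht, h4⟩
    · rintro (⟨ht, ht'⟩ | ht)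
      · rw [h.faces_eq] at ht
        exact (ht.resolve_right ht').1
      · exact h.sub t ht

/-- Since `B` is not a face of `X`, the faces of the new ball that belong to `X` are those of `∂A *
∂B * ∂C`. -/
theorem isGBM [Fintype V] (h : IsFlip A B C X X') {d : ℕ} (hX : IsPure d X)
    (hd : A.card + B.card + C.card = d + 3) (hd1 : 1 ≤ d) : IsGBM d X X' := by
  refine ⟨hX, joinBall A B C, joinBall B A C, isTriangulatedBall_joinBall h.blocks hd,
    isTriangulatedBall_joinBall h.blocks.swap (by omega),
    boundary_joinBall_swap h.blocks hd hd1, ?_, h.sub, h.faces_eq⟩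
  apply PreAbstractSimplicialComplex.ext
  ext t
  rw [mem_boundary_joinBall h.blocks.swap (by omega) hd1]
  constructor
  · rintro ⟨h1, h2, h3, h4, h5⟩
    exact ⟨⟨h1, h2, h4, h5⟩, h.sub t ⟨h1, by rwa [Finset.union_comm A B], h3, h5⟩⟩
  · rintro ⟨⟨h1, h2, h4, h5⟩, ht⟩
    exact ⟨h1, h2, h.notMem t ht, h4, h5⟩

/-- Move the common part of the coordinates in `A` to `B`. -/
noncomputable def shift (A B : Finset V) (hA : A.Nonempty) (f : V → ℝ) (v : V) : ℝ :=
  f v + (if v ∈ A then -blockMin A hA f else 0) +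
    (if v ∈ B then A.card * blockMin A hA f / B.card else 0)

theorem continuous_shift (hA : A.Nonempty) (v : V) : Continuous fun f => shift A B hA f v := by
  have hm : Continuous fun f : V → ℝ => blockMin A hA f :=
    continuous_blockMin fun v _ => continuous_apply v
  unfold shift
  split_ifs <;> fun_prop

/-- If the support contains `A`, the point lies in the old ball, and subtracting the minimum makes
some coordinate in `A` vanish, so the result lies in the new ball. Otherwise the minimum is zero and
nothing moves. -/
theorem shift_mem_carrier [Fintype V] (h : IsFlip A B C X X') {f : V → ℝ} (hf : f ∈ carrier X) :
    shift A B h.blocks.nonemptyA f ∈ carrier X' := by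
  obtain ⟨h0, h1, s, hs, hfs⟩ := hf
  have hAB := Finset.disjoint_left.1 h.blocks.disjAB
  have hAC := Finset.disjoint_left.1 h.blocks.disjAC
  have hBC := Finset.disjoint_left.1 h.blocks.disjBC
  by_cases hAs : A ⊆ s
  · obtain ⟨hsne, hsU, hsB, hsC⟩ := h.star s hs hAs
    have hm : 0 ≤ blockMin A h.blocks.nonemptyA f := Finset.le_inf' _ _ fun v _ => h0 v
    have hnn : ∀ v, 0 ≤ shift A B h.blocks.nonemptyA f v := by
      intro v
      unfold shift
      have hB0 : (0 : ℝ) ≤ if v ∈ B then A.card * blockMin A h.blocks.nonemptyA f / B.card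
          else 0 := by split_ifs <;> positivity
      have hA0 : 0 ≤ f v + if v ∈ A then -blockMin A h.blocks.nonemptyA f else 0 := by
        split_ifs with hv
        · linarith [blockMin_le (hX := h.blocks.nonemptyA) (f := f) hv]
        · linarith [h0 v]
      linarith
    have hBcard : (B.card : ℝ) ≠ 0 := by
      exact_mod_cast (Finset.card_pos.2 h.blocks.nonemptyB).ne'
    have hsum : ∑ v, shift A B h.blocks.nonemptyA f v = 1 := by
      simp only [shift, Finset.sum_add_distrib, Finset.sum_ite_mem, Finset.univ_inter,
        Finset.sum_const, nsmul_eq_mul, h1]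
      field_simp
      ring
    refine ⟨hnn, hsum, Finset.univ.filter (shift A B h.blocks.nonemptyA f · ≠ 0), ?_, by simp⟩
    refine h.symm.sub _ ⟨?_, ?_, ?_, ?_⟩
    · by_contra hne
      rw [Finset.not_nonempty_iff_eq_empty, Finset.filter_eq_empty_iff] at hne
      have : ∑ v, shift A B h.blocks.nonemptyA f v = 0 :=
        Finset.sum_eq_zero fun v hv => by simpa using hne hv
      linarith
    · intro v hv
      by_contra hvU
      simp only [Finset.mem_union, not_or] at hvU
      apply (Finset.mem_filter.1 hv).2
      have hfv : f v = 0 := by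
        by_contra hne
        have := hsU ((hfs v).1 hne)
        simp [hvU.1.1, hvU.1.2, hvU.2] at this
      simp [shift, hvU.1.1, hvU.1.2, hfv]
    · intro hsub
      obtain ⟨v, hv, hv'⟩ := exists_eq_blockMin A h.blocks.nonemptyA f
      apply (Finset.mem_filter.1 (hsub hv)).2
      simp [shift, hv, hAB hv, hv']
    · intro hsub
      obtain ⟨c, hc, hcs⟩ := Finset.not_subset.1 hsC
      apply (Finset.mem_filter.1 (hsub hc)).2
      have hfc : f c = 0 := by
        by_contra hne
        exact hcs ((hfs c).1 hne)
      have hcA : c ∉ A := fun hh => hAC hh hc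
      have hcB : c ∉ B := fun hh => hBC hh hc
      simp [shift, hfc, hcA, hcB]
  · have hm := blockMin_eq_zero_of_not_subset (hX := h.blocks.nonemptyA) h0 hfs hAs
    have : shift A B h.blocks.nonemptyA f = f := by
      funext v
      simp [shift, hm]
    rw [this]
    exact ⟨h0, h1, s, h.mem_of_not_subset hs hAs, hfs⟩

/-- As `B` is not a face of `X`, the minimum of `f` on `B` is zero. After the shift it is exactly
the amount placed there, and the second shift moves that back. -/
theorem shift_shift [Fintype V] (h : IsFlip A B C X X') {f : V → ℝ} (hf : f ∈ carrier X) :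
    shift B A h.blocks.nonemptyB (shift A B h.blocks.nonemptyA f) = f := by
  obtain ⟨h0, h1, s, hs, hfs⟩ := hf
  have hAB := Finset.disjoint_left.1 h.blocks.disjAB
  have hB := blockMin_eq_zero_of_not_subset (hX := h.blocks.nonemptyB) h0 hfs (h.notMem s hs)
  have hA0 : (A.card : ℝ) ≠ 0 := by
    exact_mod_cast (Finset.card_pos.2 h.blocks.nonemptyA).ne'
  have hB0 : (B.card : ℝ) ≠ 0 := by
    exact_mod_cast (Finset.card_pos.2 h.blocks.nonemptyB).ne'
  have hmin : blockMin B h.blocks.nonemptyB (shift A B h.blocks.nonemptyA f) =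
      A.card * blockMin A h.blocks.nonemptyA f / B.card := by
    rw [blockMin_add_const (f := f) (c := A.card * blockMin A h.blocks.nonemptyA f / B.card), hB,
      zero_add]
    intro v hv
    have hvA : v ∉ A := fun hh => hAB hh hv
    simp [shift, hv, hvA]
  funext v
  rw [shift, hmin]
  by_cases hvA : v ∈ A
  · have hvB := hAB hvA
    simp only [shift, hvA, hvB, if_true, if_false]
    field_simp
    ring
  · by_cases hvB : v ∈ B
    · simp only [shift, hvA, hvB, if_true, if_false]
      ring
    · simp [shift, hvA, hvB]

/-- A flip does not change the carrier, up to homeomorphism. -/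
noncomputable def carrierHomeomorph [Fintype V] (h : IsFlip A B C X X') :
    carrier X ≃ₜ carrier X' where
  toFun f := ⟨shift A B h.blocks.nonemptyA f.1, h.shift_mem_carrier f.2⟩
  invFun f := ⟨shift B A h.blocks.nonemptyB f.1, h.symm.shift_mem_carrier f.2⟩
  left_inv f := Subtype.ext (h.shift_shift f.2)
  right_inv f := Subtype.ext (h.symm.shift_shift f.2)
  continuous_toFun := (continuous_pi fun v =>
    (continuous_shift h.blocks.nonemptyA v).comp continuous_subtype_val).subtype_mk _
  continuous_invFun := (continuous_pi fun v =>
    (continuous_shift h.blocks.nonemptyB v).comp continuous_subtype_val).subtype_mk _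

/-- A criterion for flips in terms of facets. -/
theorem of_facets {F F' : Set (Finset V)} (h : IsBlocks A B C)
    (hstar : ∀ s ∈ F, A ⊆ s → s ⊆ A ∪ B ∪ C ∧ ¬ B ⊆ s ∧ ¬ C ⊆ s)
    (hfac : ∀ b ∈ B, ∀ c ∈ C, (A ∪ B ∪ C) \ {b, c} ∈ F)
    (hB : ∀ s ∈ F, ¬ B ⊆ s)
    (hF' : ∀ s, s ∈ F' ↔ (s ∈ F ∧ ¬ A ⊆ s) ∨ ∃ a ∈ A, ∃ c ∈ C, s = (A ∪ B ∪ C) \ {a, c}) :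
    IsFlip A B C (generatedBy F) (generatedBy F') where
  blocks := h
  sub := by
    rintro t ⟨htne, htU, htB, htC⟩
    obtain ⟨b, hb, hbt⟩ := Finset.not_subset.1 htB
    obtain ⟨c, hc, hct⟩ := Finset.not_subset.1 htC
    refine ⟨htne, _, hfac b hb c hc, fun v hv => ?_⟩
    rw [Finset.mem_sdiff]
    refine ⟨htU hv, ?_⟩
    simp only [Finset.mem_insert, Finset.mem_singleton]
    rintro (rfl | rfl) <;> contradiction
  star := by
    rintro t ⟨htne, s, hs, hts⟩ hAt
    obtain ⟨h1, h2, h3⟩ := hstar s hs (hAt.trans hts)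
    exact ⟨htne, hts.trans h1, fun hh => h2 (hh.trans hts), fun hh => h3 (hh.trans hts)⟩
  notMem := by
    rintro t ⟨-, s, hs, hts⟩ hBt
    exact hB s hs (hBt.trans hts)
  faces_eq := by
    ext t
    constructor
    · rintro ⟨htne, s, hs, hts⟩
      rcases (hF' s).1 hs with ⟨hsF, hAs⟩ | ⟨a, ha, c, hc, rfl⟩
      · by_cases htD : t ∈ (joinBall A B C).faces
        · refine Or.inr ⟨htne, ?_, fun hh => hAs (hh.trans hts), htD.2.2.2⟩
          rw [Finset.union_comm B A]
          exact htD.2.1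
        · exact Or.inl ⟨⟨htne, s, hsF, hts⟩, htD⟩
      · refine Or.inr ⟨htne, ?_, fun hh => ?_, fun hh => ?_⟩
        · rw [Finset.union_comm B A]
          exact hts.trans Finset.sdiff_subset
        · simpa using hts (hh ha)
        · simpa using hts (hh hc)
    · rintro (⟨⟨htne, s, hs, hts⟩, htD⟩ | ⟨htne, htU, htA, htC⟩)
      · refine ⟨htne, s, (hF' s).2 (Or.inl ⟨hs, fun hAs => htD ?_⟩), hts⟩
        obtain ⟨h1, h2, h3⟩ := hstar s hs hAs
        exact ⟨htne, hts.trans h1, fun hh => h2 (hh.trans hts), fun hh => h3 (hh.trans hts)⟩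
      · obtain ⟨a, ha, hat⟩ := Finset.not_subset.1 htA
        obtain ⟨c, hc, hct⟩ := Finset.not_subset.1 htC
        refine ⟨htne, _, (hF' _).2 (Or.inr ⟨a, ha, c, hc, rfl⟩), fun v hv => ?_⟩
        rw [Finset.mem_sdiff, Finset.union_comm A B]
        refine ⟨htU hv, ?_⟩
        simp only [Finset.mem_insert, Finset.mem_singleton]
        rintro (rfl | rfl) <;> contradiction

end IsFlip

end Flip

theorem isPure_generatedBy {V : Type*} {F : Set (Finset V)} {d : ℕ} (hF : ∀ s ∈ F, s.card = d + 1) :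
    IsPure d (generatedBy F) := by
  intro s hs
  obtain ⟨hne, f, hf, hsf⟩ := hs.prop
  have hfne : f.Nonempty := hne.mono hsf
  rw [← hF f hf, hs.eq_of_le ⟨hfne, f, hf, Finset.Subset.refl f⟩ hsf]

/-! ## Complexes encoded by bit masks -/

section Mask

/-- The bit representing the vertex `(i, j)`. -/
def code (p : Fin 4 × Fin 4) : ℕ := 4 * p.1.val + p.2.val

theorem code_lt (p : Fin 4 × Fin 4) : code p < 16 := by
  unfold code; omega

theorem code_injective : Function.Injective code := by
  rintro ⟨i, j⟩ ⟨k, l⟩ hh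
  simp only [code] at hh
  ext <;> simp only <;> omega

theorem exists_code_eq {n : ℕ} (hn : n < 16) : ∃ p, code p = n :=
  ⟨(⟨n / 4, by omega⟩, ⟨n % 4, by omega⟩), by simp only [code]; omega⟩

/-- The set of vertices represented by a bit mask. -/
def ofMask (m : ℕ) : Finset (Fin 4 × Fin 4) := Finset.univ.filter fun p => m.testBit (code p)

theorem mem_ofMask {m : ℕ} {p : Fin 4 × Fin 4} : p ∈ ofMask m ↔ m.testBit (code p) = true := by
  simp [ofMask]

theorem ofMask_subset_of_and_eq {a b : ℕ} (hab : a &&& b = a) : ofMask a ⊆ ofMask b := by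
  intro p hp
  rw [mem_ofMask] at hp ⊢
  rw [← hab, Nat.testBit_and] at hp
  simp_all

/-- The bound on `a` is needed because `ofMask` does not see bits from position 16 on. -/
theorem and_eq_of_ofMask_subset {a b : ℕ} (ha : a < 2 ^ 16) (hab : ofMask a ⊆ ofMask b) :
    a &&& b = a := by
  apply Nat.eq_of_testBit_eq
  intro i
  rw [Nat.testBit_and]
  by_cases hi : i < 16
  · obtain ⟨p, rfl⟩ := exists_code_eq hi
    by_cases hp : p ∈ ofMask a
    · rw [mem_ofMask.1 hp, mem_ofMask.1 (hab hp)]; rfl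
    · rw [mem_ofMask] at hp
      simp [hp]
  · rw [Nat.testBit_lt_two_pow (ha.trans_le (Nat.pow_le_pow_right (by norm_num) (by omega)))]
    simp

theorem ofMask_or (a b : ℕ) : ofMask (a ||| b) = ofMask a ∪ ofMask b := by
  ext p
  simp [mem_ofMask]

theorem ofMask_disjoint {a b : ℕ} (hab : a &&& b = 0) : Disjoint (ofMask a) (ofMask b) := by
  rw [Finset.disjoint_left]
  intro p hp hq
  rw [mem_ofMask] at hp hq
  have := congrArg (Nat.testBit · (code p)) hab
  simp [hp, hq] at this

theorem ofMask_nonempty {a : ℕ} (ha : a < 2 ^ 16) (ha0 : a ≠ 0) : (ofMask a).Nonempty := by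
  by_contra hne
  rw [Finset.not_nonempty_iff_eq_empty] at hne
  apply ha0
  simpa using (and_eq_of_ofMask_subset (b := 0) ha (by simp [hne])).symm

/-- Remove two bits from a mask. -/
def removeBits (u i j : ℕ) : ℕ := u ^^^ (2 ^ i ^^^ 2 ^ j)

/-- Exclusive or clears a bit only if it is set, and equal positions would cancel; this accounts for
the three hypotheses. -/
theorem ofMask_removeBits {u : ℕ} {p q : Fin 4 × Fin 4} (hp : p ∈ ofMask u) (hq : q ∈ ofMask u)
    (hpq : p ≠ q) : ofMask (removeBits u (code p) (code q)) = ofMask u \ {p, q} := by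
  ext r
  rw [mem_ofMask] at hp hq
  have hpq' : code p ≠ code q := fun e => hpq (code_injective e)
  simp only [removeBits, mem_ofMask, Nat.testBit_xor, Nat.testBit_two_pow, Finset.mem_sdiff,
    Finset.mem_insert, Finset.mem_singleton]
  by_cases h1 : r = p
  · subst h1
    simp [hp, hpq'.symm]
  · by_cases h2 : r = q
    · subst h2
      simp [hq, hpq']
    · have h1' : code p ≠ code r := fun e => h1 (code_injective e).symm
      have h2' : code q ≠ code r := fun e => h2 (code_injective e).symm
      simp [h1, h2, h1', h2']

/-- The positions of the bits of a mask. -/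
def bits (m : ℕ) : List ℕ := (List.range 16).filter m.testBit

theorem code_mem_bits {m : ℕ} {p : Fin 4 × Fin 4} : code p ∈ bits m ↔ p ∈ ofMask m := by
  simp [bits, mem_ofMask, code_lt]

theorem exists_of_mem_bits {m i : ℕ} (hi : i ∈ bits m) : ∃ p ∈ ofMask m, code p = i := by
  have hi' : i < 16 := by
    have := (List.mem_filter.1 hi).1
    simpa using this
  obtain ⟨p, rfl⟩ := exists_code_eq hi'
  exact ⟨p, code_mem_bits.1 hi, rfl⟩

/-- The family of sets represented by a list of masks. -/
def maskFamily (L : List ℕ) : Set (Finset (Fin 4 × Fin 4)) := {s | ∃ m ∈ L, s = ofMask m}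

/-- The complex generated by the sets represented by a list of masks. -/
def maskComplex (L : List ℕ) : PreAbstractSimplicialComplex (Fin 4 × Fin 4) :=
  generatedBy (maskFamily L)

theorem maskComplex_congr {L L' : List ℕ} (h : L ⊆ L') (h' : L' ⊆ L) :
    maskComplex L = maskComplex L' := by
  have : maskFamily L = maskFamily L' := by
    ext s
    exact ⟨fun ⟨m, hm, hs⟩ => ⟨m, h hm, hs⟩, fun ⟨m, hm, hs⟩ => ⟨m, h' hm, hs⟩⟩
  rw [maskComplex, this, maskComplex]

/-- The facets after the flip given by the masks `A`, `B`, `C`. -/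
def flipList (L : List ℕ) (A B C : ℕ) : List ℕ :=
  (L.filter fun s => A &&& s ≠ A) ++
    (bits A).flatMap fun a => (bits C).map fun c => removeBits (A ||| B ||| C) a c

/-- The conditions that make `A`, `B`, `C` a flip of a pure four-dimensional complex. -/
def FlipCheck (L : List ℕ) (A B C : ℕ) : Prop :=
  ((A < 2 ^ 16 ∧ B < 2 ^ 16 ∧ C < 2 ^ 16) ∧ (A ≠ 0 ∧ B ≠ 0 ∧ C ≠ 0)) ∧
  (A &&& B = 0 ∧ A &&& C = 0 ∧ B &&& C = 0) ∧
  (ofMask A).card + (ofMask B).card + (ofMask C).card = 7 ∧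
  (∀ s ∈ L, (ofMask s).card = 5 ∧ B &&& s ≠ B ∧
    (A &&& s = A → s &&& (A ||| B ||| C) = s ∧ C &&& s ≠ C)) ∧
  (∀ b ∈ bits B, ∀ c ∈ bits C, removeBits (A ||| B ||| C) b c ∈ L)

instance (L : List ℕ) (A B C : ℕ) : Decidable (FlipCheck L A B C) := by
  unfold FlipCheck; infer_instance

theorem FlipCheck.isFlip {L : List ℕ} {A B C : ℕ} (h : FlipCheck L A B C) :
    IsFlip (ofMask A) (ofMask B) (ofMask C) (maskComplex L) (maskComplex (flipList L A B C)) := by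
  obtain ⟨⟨⟨hA, hB, hC⟩, hA0, hB0, hC0⟩, ⟨hAB, hAC, hBC⟩, -, hL, hfac⟩ := h
  have hU : ofMask (A ||| B ||| C) = ofMask A ∪ ofMask B ∪ ofMask C := by
    rw [ofMask_or, ofMask_or]
  have dAC := ofMask_disjoint hAC
  have dBC := ofMask_disjoint hBC
  refine IsFlip.of_facets ⟨ofMask_nonempty hA hA0, ofMask_nonempty hB hB0,
    ofMask_nonempty hC hC0, ofMask_disjoint hAB, dAC, dBC⟩ ?_ ?_ ?_ ?_
  · rintro _ ⟨s, hs, rfl⟩ hAs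
    obtain ⟨-, h1, h2⟩ := hL s hs
    obtain ⟨h3, h4⟩ := h2 (and_eq_of_ofMask_subset hA hAs)
    exact ⟨hU ▸ ofMask_subset_of_and_eq h3, fun hh => h1 (and_eq_of_ofMask_subset hB hh),
      fun hh => h4 (and_eq_of_ofMask_subset hC hh)⟩
  · intro p hp q hq
    refine ⟨_, hfac _ (code_mem_bits.2 hp) _ (code_mem_bits.2 hq), ?_⟩
    rw [ofMask_removeBits (by simp [hU, hp]) (by simp [hU, hq]), hU]
    rintro rfl
    exact Finset.disjoint_left.1 dBC hp hq
  · rintro _ ⟨s, hs, rfl⟩ hBs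
    exact (hL s hs).2.1 (and_eq_of_ofMask_subset hB hBs)
  · have hrem : ∀ p ∈ ofMask A, ∀ q ∈ ofMask C,
        ofMask (removeBits (A ||| B ||| C) (code p) (code q)) =
          (ofMask A ∪ ofMask B ∪ ofMask C) \ {p, q} := by
      intro p hp q hq
      rw [ofMask_removeBits (by simp [hU, hp]) (by simp [hU, hq]), hU]
      rintro rfl
      exact Finset.disjoint_left.1 dAC hp hq
    intro s
    constructor
    · rintro ⟨m, hm, rfl⟩
      rcases List.mem_append.1 hm with hm | hm
      · obtain ⟨hmL, hmA⟩ := List.mem_filter.1 hm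
        exact Or.inl ⟨⟨m, hmL, rfl⟩, fun hh => by
          simp [and_eq_of_ofMask_subset hA hh] at hmA⟩
      · obtain ⟨a, ha, hm⟩ := List.mem_flatMap.1 hm
        obtain ⟨c, hc, rfl⟩ := List.mem_map.1 hm
        obtain ⟨p, hp, rfl⟩ := exists_of_mem_bits ha
        obtain ⟨q, hq, rfl⟩ := exists_of_mem_bits hc
        exact Or.inr ⟨p, hp, q, hq, hrem p hp q hq⟩
    · rintro (⟨⟨m, hm, rfl⟩, hmA⟩ | ⟨p, hp, q, hq, rfl⟩)
      · refine ⟨m, List.mem_append.2 (Or.inl (List.mem_filter.2 ⟨hm, ?_⟩)), rfl⟩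
        simpa using fun hh => hmA (ofMask_subset_of_and_eq hh)
      · exact ⟨_, List.mem_append.2 (Or.inr (List.mem_flatMap.2 ⟨_, code_mem_bits.2 hp,
          List.mem_map.2 ⟨_, code_mem_bits.2 hq, rfl⟩⟩)), (hrem p hp q hq).symm⟩

theorem FlipCheck.isGBM {L : List ℕ} {A B C : ℕ} (h : FlipCheck L A B C) :
    IsGBM 4 (maskComplex L) (maskComplex (flipList L A B C)) := by
  refine h.isFlip.isGBM (isPure_generatedBy ?_) h.2.2.1 (by norm_num)
  rintro _ ⟨m, hm, rfl⟩
  exact (h.2.2.2.1 m hm).1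

/-- The facets after a sequence of flips. -/
def flipChain : List ℕ → List (ℕ × ℕ × ℕ) → List ℕ
  | L, [] => L
  | L, (A, B, C) :: ms => flipChain (flipList L A B C) ms

/-- Every member of the sequence is a flip. -/
def ChainCheck : List ℕ → List (ℕ × ℕ × ℕ) → Bool
  | _, [] => true
  | L, (A, B, C) :: ms => decide (FlipCheck L A B C) && ChainCheck (flipList L A B C) ms

/-- The homeomorphism type is carried along with the moves, through the explicit map attached to
each flip. -/
theorem reflTransGen_flipChain (ms : List (ℕ × ℕ × ℕ)) : ∀ L, ChainCheck L ms = true →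
    Relation.ReflTransGen (IsGBM 4) (maskComplex L) (maskComplex (flipChain L ms)) ∧
      Nonempty (carrier (maskComplex L) ≃ₜ carrier (maskComplex (flipChain L ms))) := by
  induction ms with
  | nil => exact fun L _ => ⟨Relation.ReflTransGen.refl, ⟨Homeomorph.refl _⟩⟩
  | cons m ms ih =>
    obtain ⟨A, B, C⟩ := m
    intro L hL
    simp only [ChainCheck, Bool.and_eq_true, decide_eq_true_eq] at hL
    obtain ⟨h1, ⟨h2⟩⟩ := ih _ hL.2
    exact ⟨Relation.ReflTransGen.head hL.1.isGBM h1, ⟨hL.1.isFlip.carrierHomeomorph.trans h2⟩⟩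

end Mask

/-! ## From sixteen to twelve vertices -/

section Sixteen

/-- The facets of the complex with sixteen vertices. -/
def facets16 : List ℕ :=
  [8928, 8816, 8880, 26816, 9040, 12624, 25408, 28992, 19716, 18180, 19972, 22792, 17158, 25346,
    20742, 28930, 4123, 4119, 4125, 12426, 4182, 20550, 12370, 28738, 4365, 4363, 4359, 18700,
    12554, 8970, 14600, 11016, 59520, 47232, 55424, 27200, 14480, 14608, 10896, 11024, 626, 690,
    738, 852, 666, 2712, 794, 2840, 45192, 53384, 57480, 12434, 20620, 20676, 4252, 4308, 279,
    285, 283, 598, 2332, 2204, 2388, 2260, 20032, 19776, 18240, 10944, 22848, 6480, 22720, 6352,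
    1860, 3652, 3396, 790, 2756, 2700, 710, 654, 8370, 8418, 8306, 4250, 24770, 16582, 24714,
    16526, 55304, 59400, 47112, 20748, 27144, 25098, 18956, 16910]

/-- The facets of the complex with twelve vertices. -/
def facets12 : List ℕ :=
  [286, 598, 666, 710, 722, 790, 794, 852, 2204, 2332, 2388, 2700, 2712, 2756, 2884, 4126, 4182,
    4250, 4252, 4366, 6228, 6292, 6340, 6480, 8402, 8912, 8970, 8984, 9040, 10520, 10776, 10896,
    10944, 12370, 12426, 12434, 12554, 12610, 12624, 14480, 14600, 14608, 16582, 17030, 17034,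
    17036, 17158, 18700, 18956, 19204, 19264, 20550, 20620, 20676, 20742, 20748, 20802, 22720,
    22792, 22848, 24714, 24770, 24898, 25098, 25346, 25408, 26816, 27144, 27200, 28808, 30728,
    30848]

/-- Flips that lead from sixteen to twelve vertices. -/
def flips : List (ℕ × ℕ × ℕ) :=
  [(208, 6148, 1024), (2816, 8216, 32), (28672, 322, 32), (14, 17024, 32), (32, 208, 8706),
    (1024, 2816, 16452), (32768, 28672, 2184), (1, 14, 4368)]

/-- In the first four flips `A` is the triangle of the three `x i j` with `j ≠ i`, for one fixed
`i`, and `C` is a single vertex. The boundary of `C` is then empty, so these are ordinary bistellar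
moves on six vertices, and they remove that triangle. In the last four, `A` is a diagonal vertex `x
i i`, `B` the triangle of its row, no longer a face, and `C` the triangle of its column. The star `A
* ∂B * ∂C` becomes `B * ∂C`, and the diagonal vertex disappears. -/
theorem chainCheck_flips : ChainCheck facets16 flips = true := by decide +kernel

theorem flipChain_flips : maskComplex (flipChain facets16 flips) = maskComplex facets12 := by
  apply maskComplex_congr
  · show ∀ m ∈ flipChain facets16 flips, m ∈ facets12
    decide +kernel
  · show ∀ m ∈ facets12, m ∈ flipChain facets16 flips
    decide +kernel

/-- The even permutations of the indices. -/
def evenPerms : List (Equiv.Perm (Fin 4)) :=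
  [1, Equiv.swap 0 1 * Equiv.swap 2 3, Equiv.swap 0 2 * Equiv.swap 1 3,
    Equiv.swap 0 3 * Equiv.swap 1 2].flatMap fun a =>
      [1, Equiv.swap 0 1 * Equiv.swap 1 2, Equiv.swap 1 2 * Equiv.swap 0 1].map fun b => a * b

/-- `A₄` is the product of the Klein four-group and a cyclic group of order three. -/
theorem mem_evenPerms : ∀ a : Equiv.Perm (Fin 4), a ∈ alternatingGroup (Fin 4) ↔ a ∈ evenPerms := by
  simp only [Equiv.Perm.mem_alternatingGroup]
  decide +kernel

/-- The list of basic facets. -/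
def basicList16 : List (Finset (Fin 4 × Fin 4)) :=
  [{(1, 1), (1, 2), (1, 3), (2, 1), (3, 1)},
   {(1, 1), (1, 2), (1, 4), (2, 1), (3, 1)},
   {(1, 1), (1, 3), (1, 4), (2, 1), (3, 1)},
   {(1, 2), (1, 3), (2, 3), (3, 1), (3, 2)},
   {(1, 2), (1, 4), (2, 1), (2, 4), (3, 1)},
   {(1, 2), (1, 4), (2, 4), (3, 1), (3, 4)},
   {(1, 2), (2, 1), (2, 4), (3, 1), (3, 2)},
   {(1, 2), (2, 4), (3, 1), (3, 2), (3, 4)}]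

theorem mem_basicFacets16 {s : Finset (Fin 4 × Fin 4)} :
    s ∈ basicFacets16 ↔ s ∈ basicList16 := by
  simp only [basicFacets16, basicList16, Set.mem_insert_iff, Set.mem_singleton_iff,
    List.mem_cons, List.not_mem_nil, or_false]

/-- The list `facets16` consists of twelve blocks of eight, one block for each even permutation. -/
theorem image_basicList16 : ∀ i : Fin 12, ∀ j : Fin 8, (basicList16.getD j ∅).image
    (Prod.map (evenPerms.getD i 1) (evenPerms.getD i 1)) =
      ofMask (facets16.getD (8 * i + j) 0) := by
  decide +kernel

theorem getD_mem_evenPerms : ∀ i : Fin 12, evenPerms.getD i 1 ∈ evenPerms := by decide +kernel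

theorem getD_mem_basicList16 : ∀ i : Fin 8, basicList16.getD i ∅ ∈ basicList16 := by
  decide +kernel

theorem S16second_eq : S16second = maskComplex facets16 := by
  unfold S16second maskComplex
  congr 1
  ext s
  constructor
  · rintro ⟨a, ha, b, hb, rfl⟩
    obtain ⟨i, hi, rfl⟩ := List.mem_iff_getElem.1 ((mem_evenPerms a).1 ha)
    obtain ⟨j, hj, rfl⟩ := List.mem_iff_getElem.1 (mem_basicFacets16.1 hb)
    have hi' : i < 12 := hi
    have hj' : j < 8 := hj
    have hk : 8 * i + j < facets16.length := show _ < 96 by omega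
    have h := image_basicList16 ⟨i, hi'⟩ ⟨j, hj'⟩
    simp only [List.getD_eq_getElem _ _ hi, List.getD_eq_getElem _ _ hj,
      List.getD_eq_getElem _ _ hk] at h
    exact ⟨_, List.getElem_mem hk, h⟩
  · rintro ⟨m, hm, rfl⟩
    obtain ⟨k, hk, rfl⟩ := List.mem_iff_getElem.1 hm
    have hk' : k < 96 := hk
    have h := image_basicList16 ⟨k / 8, by omega⟩ ⟨k % 8, by omega⟩
    simp only [Nat.div_add_mod, List.getD_eq_getElem _ _ hk] at h
    exact ⟨_, (mem_evenPerms _).2 (getD_mem_evenPerms ⟨k / 8, by omega⟩), _,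
      mem_basicFacets16.2 (getD_mem_basicList16 ⟨k % 8, by omega⟩), h.symm⟩

theorem mem_maskComplex {L : List ℕ} {t : Finset (Fin 4 × Fin 4)} :
    t ∈ (maskComplex L).faces ↔ t.Nonempty ∧ ∃ m ∈ L, t ⊆ ofMask m := by
  constructor
  · rintro ⟨h1, _, ⟨m, hm, rfl⟩, h2⟩
    exact ⟨h1, m, hm, h2⟩
  · rintro ⟨h1, m, hm, h2⟩
    exact ⟨h1, _, ⟨m, hm, rfl⟩, h2⟩

theorem vertexSet_S16second : (vertexSet S16second).ncard = 16 := by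
  have : vertexSet S16second = Set.univ := by
    rw [Set.eq_univ_iff_forall]
    intro v
    rw [vertexSet, Set.mem_ofPred_eq, S16second_eq, mem_maskComplex]
    refine ⟨Finset.singleton_nonempty _, ?_⟩
    have h : ∀ v : Fin 4 × Fin 4, ∃ m ∈ facets16, m.testBit (code v) = true := by decide +kernel
    obtain ⟨m, hm, hv⟩ := h v
    exact ⟨m, hm, Finset.singleton_subset_iff.2 (mem_ofMask.2 hv)⟩
  rw [this, Set.ncard_univ]
  simp

end Sixteen

/-! ## Compactness of carriers -/

section Compact

variable {V : Type*} [Fintype V]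

theorem carrier_subset_Icc (K : PreAbstractSimplicialComplex V) :
    carrier K ⊆ Set.Icc (0 : V → ℝ) 1 := by
  rintro f ⟨h0, h1, -⟩
  refine ⟨h0, fun v => ?_⟩
  change f v ≤ 1
  rw [← h1]
  exact Finset.single_le_sum (fun v _ => h0 v) (Finset.mem_univ v)

/-- Requiring the support to lie in a face, rather than to equal it, gives the same set as a finite
union of closed sets. -/
theorem isClosed_carrier (K : PreAbstractSimplicialComplex V) : IsClosed (carrier K) := by
  have h : carrier K = ⋃ s ∈ K.faces,
      ((⋂ v, {f : V → ℝ | 0 ≤ f v}) ∩ {f | ∑ v, f v = 1}) ∩ ⋂ v ∈ {v | v ∉ s}, {f | f v = 0} := by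
    ext f
    simp only [Set.mem_iUnion, Set.mem_inter_iff, Set.mem_iInter, Set.mem_ofPred_eq]
    constructor
    · rintro ⟨h0, h1, s, hs, hfs⟩
      refine ⟨s, hs, ⟨h0, h1⟩, fun v hv => ?_⟩
      by_contra hne
      exact hv ((hfs v).1 hne)
    · rintro ⟨s, hs, ⟨h0, h1⟩, hfs⟩
      refine mem_carrier_of_forall h0 h1 hs fun v hv => ?_
      by_contra hvs
      exact hv (hfs v hvs)
  rw [h]
  refine (Set.toFinite _).isClosed_biUnion fun s _ => ?_
  refine ((isClosed_iInter fun v => ?_).inter ?_).inter (isClosed_biInter fun v _ => ?_)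
  · exact isClosed_le continuous_const (continuous_apply v)
  · exact isClosed_eq (by fun_prop) continuous_const
  · exact isClosed_eq (continuous_apply v) continuous_const

instance (K : PreAbstractSimplicialComplex V) : CompactSpace (carrier K) :=
  isCompact_iff_compactSpace.1
    (isCompact_Icc.of_isClosed_subset (isClosed_carrier K) (carrier_subset_Icc K))

end Compact

/-! ## Geometric realization -/

section Realization

variable {V E : Type*} [Fintype V] [AddCommGroup E] [Module ℝ E]

/-- The weights are indexed by vertices and not by their images, so `φ` may fail to be injective. -/
theorem mem_convexHull_image_iff {φ : V → E} {s : Finset V} {y : E} :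
    y ∈ convexHull ℝ (φ '' (s : Set V)) ↔
      ∃ f : V → ℝ, (∀ v, 0 ≤ f v) ∧ ∑ v, f v = 1 ∧ (∀ v, f v ≠ 0 → v ∈ s) ∧
        ∑ v, f v • φ v = y := by
  classical
  constructor
  · intro hy
    refine convexHull_min (t := {y | ∃ f : V → ℝ, (∀ v, 0 ≤ f v) ∧ ∑ v, f v = 1 ∧
      (∀ v, f v ≠ 0 → v ∈ s) ∧ ∑ v, f v • φ v = y}) ?_ ?_ hy
    · rintro _ ⟨v, hv, rfl⟩
      refine ⟨Pi.single v 1, fun w => ?_, by simp, fun w hw => ?_, ?_⟩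
      · by_cases hwv : w = v
        · subst hwv; simp
        · simp [hwv]
      · by_cases hwv : w = v
        · subst hwv; exact hv
        · simp [hwv] at hw
      · rw [Finset.sum_eq_single v] <;> simp +contextual
    · rintro _ ⟨f, hf0, hf1, hfs, rfl⟩ _ ⟨g, hg0, hg1, hgs, rfl⟩ a b ha hb hab
      refine ⟨fun v => a * f v + b * g v, fun v => ?_, ?_, fun v hv => ?_, ?_⟩
      · have := hf0 v
        have := hg0 v
        positivity
      · rw [Finset.sum_add_distrib, ← Finset.mul_sum, ← Finset.mul_sum, hf1, hg1]
        linarith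
      · by_contra hvs
        have h1 : f v = 0 := by
          by_contra hne
          exact hvs (hfs v hne)
        have h2 : g v = 0 := by
          by_contra hne
          exact hvs (hgs v hne)
        simp [h1, h2] at hv
      · simp only [add_smul, mul_smul, Finset.sum_add_distrib, Finset.smul_sum]
  · rintro ⟨f, h0, h1, hs, rfl⟩
    have hsum : ∑ v, f v • φ v = ∑ v ∈ s, f v • φ v := by
      refine (Finset.sum_subset (Finset.subset_univ s) fun v _ hv => ?_).symm
      have : f v = 0 := by
        by_contra hne
        exact hv (hs v hne)
      simp [this]
    have hsum1 : ∑ v ∈ s, f v = 1 := by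
      rw [← h1]
      refine Finset.sum_subset (Finset.subset_univ s) fun v _ hv => ?_
      by_contra hne
      exact hv (hs v hne)
    rw [hsum]
    exact (convex_convexHull ℝ _).sum_mem (fun v _ => h0 v) hsum1
      fun v hv => subset_convexHull ℝ _ ⟨v, hv, rfl⟩

theorem exists_mem_carrier_of_mem_convexHull {K : PreAbstractSimplicialComplex V} {φ : V → E}
    {t : Finset V} (ht : t ∈ K.faces) {y : E} (hy : y ∈ convexHull ℝ (φ '' (t : Set V))) :
    ∃ f ∈ carrier K, (∀ v, f v ≠ 0 → v ∈ t) ∧ ∑ v, f v • φ v = y := by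
  obtain ⟨f, h0, h1, hs, hy⟩ := mem_convexHull_image_iff.1 hy
  exact ⟨f, mem_carrier_of_forall h0 h1 ht hs, hs, hy⟩

/-- The linear extension of `φ` is injective on the carrier of `K`. -/
def IsEmbeddedBy (K : PreAbstractSimplicialComplex V) (φ : V → E) : Prop :=
  ∀ f ∈ carrier K, ∀ f' ∈ carrier K, ∑ v, f v • φ v = ∑ v, f' v • φ v → f = f'

/-- A small multiple of an affine relation among the vertices of `t` could be added to the
barycentre of `t` without changing its image, so injectivity forces the relation to be trivial. -/
theorem IsEmbeddedBy.affineIndependent {K : PreAbstractSimplicialComplex V} {φ : V → E}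
    (h : IsEmbeddedBy K φ) {t : Finset V} (ht : t ∈ K.faces) :
    AffineIndependent ℝ fun v : t => φ v := by
  classical
  rw [affineIndependent_iff_of_fintype]
  intro w hw hwφ
  rw [Finset.univ.weightedVSub_eq_linear_combination hw] at hwφ
  have htne : t.Nonempty := (K.isRelLowerSet_faces ht).1
  have hcard : (0 : ℝ) < t.card := by exact_mod_cast Finset.card_pos.2 htne
  obtain ⟨W, hW⟩ : ∃ W : V → ℝ, W = fun v => if hv : v ∈ t then w ⟨v, hv⟩ else 0 := ⟨_, rfl⟩
  have hWt : ∀ v : t, W v = w v := fun v => by simp [hW]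
  have hWoff : ∀ v, v ∉ t → W v = 0 := fun v hv => by simp [hW, hv]
  have hWsum : ∑ v, W v = 0 := by
    rw [← Finset.sum_subset (Finset.subset_univ t) fun v _ hv => hWoff v hv, ← hw,
      ← Finset.sum_coe_sort t]
    simp [hWt]
  have hWφ : ∑ v, W v • φ v = 0 := by
    rw [← Finset.sum_subset (Finset.subset_univ t) fun v _ hv => by simp [hWoff v hv], ← hwφ,
      ← Finset.sum_coe_sort t]
    simp [hWt]
  obtain ⟨S, hS⟩ : ∃ S, S = ∑ v, |W v| := ⟨_, rfl⟩
  have hS0 : 0 ≤ S := hS ▸ Finset.sum_nonneg fun v _ => abs_nonneg _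
  have hWS : ∀ v, |W v| ≤ S := fun v => by
    rw [hS]
    exact Finset.single_le_sum (f := fun v => |W v|) (fun v _ => abs_nonneg _)
      (Finset.mem_univ v)
  -- With this choice `ε * |W v|` stays below the barycentric weight `1 / t.card`. The summand 1
  -- keeps the denominator positive when `S = 0`.
  obtain ⟨ε, hε⟩ : ∃ ε : ℝ, ε = (t.card * (1 + S))⁻¹ := ⟨_, rfl⟩
  have hε0 : 0 < ε := by rw [hε]; positivity
  obtain ⟨f, hf⟩ : ∃ f : V → ℝ, f = fun v => if v ∈ t then (t.card : ℝ)⁻¹ else 0 := ⟨_, rfl⟩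
  have hf1 : ∑ v, f v = 1 := by
    simp only [hf, Finset.sum_ite_mem, Finset.univ_inter, Finset.sum_const, nsmul_eq_mul]
    field_simp
  have hmem : f ∈ carrier K := by
    refine mem_carrier_of_forall (fun v => ?_) hf1 ht fun v hv => ?_
    · simp only [hf]
      split_ifs <;> positivity
    · by_contra hvt
      simp [hf, hvt] at hv
  have hmem' : (fun v => f v + ε * W v) ∈ carrier K := by
    refine mem_carrier_of_forall (fun v => ?_) ?_ ht fun v hv => ?_
    · by_cases hvt : v ∈ t
      · have h1 : ε * S ≤ (t.card : ℝ)⁻¹ := by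
          have : ε * (1 + S) = (t.card : ℝ)⁻¹ := by
            rw [hε]; field_simp
          nlinarith
        have h2 : -(ε * S) ≤ ε * W v := by
          have := neg_abs_le (W v)
          have := hWS v
          nlinarith
        simp only [hf, hvt, if_true]
        linarith
      · simp [hf, hvt, hWoff v hvt]
    · rw [Finset.sum_add_distrib, ← Finset.mul_sum, hWsum, hf1]
      simp
    · by_contra hvt
      simp [hf, hvt, hWoff v hvt] at hv
  have heq := h _ hmem _ hmem' (by
    simp only [add_smul, mul_smul, Finset.sum_add_distrib, ← Finset.smul_sum, hWφ, smul_zero,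
      add_zero])
  intro v
  have hv := congrFun heq v
  have : ε * W v = 0 := by linarith
  rw [← hWt v]
  exact (mul_eq_zero.1 this).resolve_left hε0.ne'

/-- The geometric simplicial complex spanned by an embedded abstract complex. -/
def IsEmbeddedBy.realization {K : PreAbstractSimplicialComplex V} {φ : V → E}
    (h : IsEmbeddedBy K φ) : Geometry.SimplicialComplex ℝ E where
  faces := {s : Finset E | ∃ t ∈ K.faces, (s : Set E) = φ '' (t : Set V)}
  isRelLowerSet_faces := by
    classical
    rintro s ⟨t, ht, hst⟩
    refine ⟨?_, fun u hus hu => ⟨t.filter (φ · ∈ u), (K.isRelLowerSet_faces ht).2 ?_ ?_, ?_⟩⟩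
    · rw [← Finset.coe_nonempty, hst]
      exact (Finset.coe_nonempty.2 (K.isRelLowerSet_faces ht).1).image φ
    · exact Finset.filter_subset _ _
    · obtain ⟨y, hy⟩ := hu
      have : y ∈ φ '' (t : Set V) := hst ▸ Finset.mem_coe.2 (hus hy)
      obtain ⟨v, hv, rfl⟩ := this
      exact ⟨v, Finset.mem_filter.2 ⟨hv, hy⟩⟩
    · ext y
      constructor
      · intro hy
        have : y ∈ φ '' (t : Set V) := hst ▸ Finset.mem_coe.2 (hus hy)
        obtain ⟨v, hv, rfl⟩ := this
        exact ⟨v, Finset.mem_coe.2 (Finset.mem_filter.2 ⟨hv, hy⟩), rfl⟩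
      · rintro ⟨v, hv, rfl⟩
        exact (Finset.mem_filter.1 hv).2
  indep := by
    rintro s ⟨t, ht, hst⟩
    refine (h.affineIndependent ht).range.mono (s := (s : Set E)) ?_
    rw [hst]
    rintro _ ⟨v, hv, rfl⟩
    exact ⟨⟨v, hv⟩, rfl⟩
  inter_subset_convexHull := by
    classical
    rintro s s' ⟨t, ht, hst⟩ ⟨t', ht', hst'⟩ y ⟨hy, hy'⟩
    rw [hst] at hy
    rw [hst'] at hy'
    obtain ⟨f, hf, hft, hfy⟩ := exists_mem_carrier_of_mem_convexHull ht hy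
    obtain ⟨f', hf', hft', hfy'⟩ := exists_mem_carrier_of_mem_convexHull ht' hy'
    -- A common point has a single weight function, which is therefore supported in both simplices.
    obtain rfl := h f hf f' hf' (hfy.trans hfy'.symm)
    have : y ∈ convexHull ℝ (φ '' ((t ∩ t' : Finset V) : Set V)) :=
      mem_convexHull_image_iff.2 ⟨f, hf.1, hf.2.1,
        fun v hv => Finset.mem_inter.2 ⟨hft v hv, hft' v hv⟩, hfy⟩
    refine convexHull_mono ?_ this
    rw [hst, hst', Finset.coe_inter]
    exact Set.image_inter_subset φ _ _

theorem IsEmbeddedBy.mem_space {K : PreAbstractSimplicialComplex V} {φ : V → E}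
    (h : IsEmbeddedBy K φ) {y : E} :
    y ∈ h.realization.space ↔ ∃ f ∈ carrier K, ∑ v, f v • φ v = y := by
  classical
  rw [Geometry.SimplicialComplex.mem_space_iff]
  constructor
  · rintro ⟨s, ⟨t, ht, hst⟩, hy⟩
    rw [hst] at hy
    obtain ⟨f, hf, -, hfy⟩ := exists_mem_carrier_of_mem_convexHull ht hy
    exact ⟨f, hf, hfy⟩
  · rintro ⟨f, ⟨h0, h1, t, ht, hft⟩, rfl⟩
    refine ⟨t.image φ, ⟨t, ht, Finset.coe_image⟩, ?_⟩
    rw [Finset.coe_image]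
    exact mem_convexHull_image_iff.2 ⟨f, h0, h1, fun v hv => (hft v).1 hv, rfl⟩

end Realization

/-! ## The subdivision of the product of two boundaries of tetrahedra -/

section Circuit

variable {g : Fin 4 → Fin 4 → ℝ}

/-- A nonzero real matrix with vanishing row and column sums and a zero row contains an alternating
circuit of length four or six. -/
theorem exists_alternating_circuit (hrow : ∀ i, ∑ j, g i j = 0) (hcol : ∀ j, ∑ i, g i j = 0)
    {i₀ : Fin 4} (h0 : ∀ j, g i₀ j = 0) (hne : ∃ i j, g i j ≠ 0) :
    (∃ i k j l, 0 < g i j ∧ g k j < 0 ∧ 0 < g k l ∧ g i l < 0) ∨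
    (∃ i k m j l n, i ≠ k ∧ k ≠ m ∧ i ≠ m ∧ 0 < g i j ∧ g k j < 0 ∧ 0 < g k l ∧ g m l < 0 ∧
      0 < g m n ∧ g i n < 0) := by
  -- From a nonzero row one passes through a positive entry to a column, and in that column to a
  -- negative entry in another row. Iterating the resulting map `F` must close up.
  have step : ∀ i, (∃ j, g i j ≠ 0) → ∃ k j, 0 < g i j ∧ g k j < 0 := by
    rintro i ⟨j, hj⟩
    obtain ⟨j', -, hj'⟩ := Finset.exists_pos_of_sum_zero_of_exists_nonzero _ (hrow i)
      ⟨j, Finset.mem_univ _, hj⟩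
    obtain ⟨k, -, hk⟩ := Finset.exists_pos_of_sum_zero_of_exists_nonzero (fun k => -g k j')
      (by rw [Finset.sum_neg_distrib, hcol, neg_zero]) ⟨i, Finset.mem_univ i, by simpa using hj'.ne'⟩
    exact ⟨k, j', hj', by simpa using hk⟩
  choose! F J hF using step
  have next : ∀ i, (∃ j, g i j ≠ 0) → ∃ j, g (F i) j ≠ 0 := fun i hi => ⟨_, (hF i hi).2.ne⟩
  have hFne : ∀ i, (∃ j, g i j ≠ 0) → i ≠ F i := by
    intro i hi e
    have := hF i hi
    rw [← e] at this
    exact lt_asymm this.1 this.2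
  have hi0 : ∀ i, (∃ j, g i j ≠ 0) → i ≠ i₀ := by
    rintro i ⟨j, hj⟩ rfl
    exact hj (h0 j)
  obtain ⟨i, hi⟩ := hne
  have hi1 := next i hi
  have hi2 := next _ hi1
  have hi3 := next _ hi2
  -- Row `i₀` is never visited, so only three rows are available. As consecutive rows differ, a
  -- cycle of length two or three occurs.
  have h4 : F (F i) = i ∨ F (F (F i)) = F i ∨ F (F (F i)) = i := by
    have a1 := hi0 _ hi
    have a2 := hi0 _ hi1
    have a3 := hi0 _ hi2
    have a4 := hi0 _ hi3
    have b1 := hFne _ hi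
    have b2 := hFne _ hi1
    have b3 := hFne _ hi2
    generalize F (F (F i)) = i3 at *
    generalize F (F i) = i2 at *
    generalize F i = i1 at *
    clear hi hi1 hi2 hi3 hFne hi0 next hF
    omega
  by_cases h2 : F (F i) = i
  · have e1 := hF i hi
    have e2 := hF _ hi1
    rw [h2] at e2
    exact Or.inl ⟨_, _, _, _, e1.1, e1.2, e2.1, e2.2⟩
  rcases h4.resolve_left h2 with h3 | h3
  · have e1 := hF _ hi1
    have e2 := hF _ hi2
    rw [h3] at e2
    exact Or.inl ⟨_, _, _, _, e1.1, e1.2, e2.1, e2.2⟩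
  · have e1 := hF _ hi
    have e2 := hF _ hi1
    have e3 := hF _ hi2
    rw [h3] at e3
    exact Or.inr ⟨_, _, _, _, _, _, hFne _ hi, hFne _ hi1, fun e => h2 e.symm, e1.1, e1.2, e2.1,
      e2.2, e3.1, e3.2⟩

end Circuit

/-! ### Injectivity on the 16-vertex complex, and couplings supported on facets -/

section Subdivision

/-- Whether a list of vertices lies in a common facet. -/
def inFacet16 (l : List (Fin 4 × Fin 4)) : Bool :=
  facets16.any fun m => l.all fun p => m.testBit (code p)

theorem inFacet16_of {m : ℕ} (hm : m ∈ facets16) {l : List (Fin 4 × Fin 4)}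
    (hl : ∀ p ∈ l, p ∈ ofMask m) : inFacet16 l = true := by
  rw [inFacet16, List.any_eq_true]
  exact ⟨m, hm, List.all_eq_true.2 fun p hp => mem_ofMask.1 (hl p hp)⟩

/-- The two diagonals of a product of two edges of `T` are not both edges of the complex. -/
theorem no_four_circuit : ∀ i k j l : Fin 4, i ≠ k → j ≠ l →
    (inFacet16 [(i, j), (k, l)] && inFacet16 [(k, j), (i, l)]) = false := by
  decide +kernel

/-- The two triples use the same rows and the same columns, so their barycentres coincide in the
product; an embedded complex cannot contain both. -/
theorem no_six_circuit : ∀ i k m : Fin 4, i ≠ k → k ≠ m → i ≠ m → ∀ j l n : Fin 4, j ≠ l → l ≠ n →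
    j ≠ n → (inFacet16 [(i, j), (k, l), (m, n)] && inFacet16 [(k, j), (m, l), (i, n)]) = false := by
  decide +kernel

theorem exists_row_notMem : ∀ m ∈ facets16, ∃ i : Fin 4, ∀ j, m.testBit (code (i, j)) = false := by
  decide +kernel

theorem exists_col_notMem : ∀ m ∈ facets16, ∃ j : Fin 4, ∀ i, m.testBit (code (i, j)) = false := by
  decide +kernel

theorem sum_smul_vertexPoint (f : Fin 4 × Fin 4 → ℝ) :
    ∑ v, f v • vertexPoint v = (fun i => ∑ j, f (i, j), fun j => ∑ i, f (i, j)) := by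
  ext i
  · rw [Prod.fst_sum, Finset.sum_apply, Fintype.sum_prod_type]
    simp [vertexPoint, Pi.single_apply]
  · rw [Prod.snd_sum, Finset.sum_apply, Fintype.sum_prod_type_right]
    simp [vertexPoint, Pi.single_apply]

theorem exists_mask_of_mem_carrier {f : Fin 4 × Fin 4 → ℝ}
    (hf : f ∈ carrier (maskComplex facets16)) : ∃ m ∈ facets16, ∀ v, f v ≠ 0 → v ∈ ofMask m := by
  obtain ⟨-, -, s, hs, hfs⟩ := hf
  obtain ⟨-, m, hm, hsm⟩ := mem_maskComplex.1 hs
  exact ⟨m, hm, fun v hv => hsm ((hfs v).1 hv)⟩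

/-- Equal images mean equal marginals. Positive entries of `f - f'` lie in a facet carrying `f` and
negative ones in a facet carrying `f'`, so an alternating circuit in the difference contradicts
`no_four_circuit` or `no_six_circuit`. -/
theorem isEmbeddedBy_vertexPoint : IsEmbeddedBy (maskComplex facets16) vertexPoint := by
  intro f hf f' hf' heq
  rw [sum_smul_vertexPoint, sum_smul_vertexPoint, Prod.mk.injEq] at heq
  obtain ⟨m, hm, hfm⟩ := exists_mask_of_mem_carrier hf
  obtain ⟨m', hm', hfm'⟩ := exists_mask_of_mem_carrier hf'
  have hrow : ∀ i, ∑ j, f (i, j) = ∑ j, f' (i, j) := fun i => congrFun heq.1 i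
  have hcol : ∀ j, ∑ i, f (i, j) = ∑ i, f' (i, j) := fun j => congrFun heq.2 j
  by_contra hne
  obtain ⟨i₀, hi₀⟩ := exists_row_notMem m hm
  have hz : ∀ j, f (i₀, j) = 0 := by
    intro j
    by_contra hh
    have := mem_ofMask.1 (hfm _ hh)
    rw [hi₀ j] at this
    cases this
  -- The row sum of `f'` equals that of `f`, which is zero, and the entries are nonnegative.
  have hz' : ∀ j, f' (i₀, j) = 0 := by
    have : ∑ j, f' (i₀, j) = 0 := by
      rw [← hrow]
      simp [hz]
    intro j
    exact (Finset.sum_eq_zero_iff_of_nonneg fun j _ => hf'.1 (i₀, j)).1 this j (Finset.mem_univ j)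
  have hpos : ∀ v, 0 < f v - f' v → v ∈ ofMask m := fun v hv =>
    hfm v (by linarith [hf'.1 v] : 0 < f v).ne'
  have hneg : ∀ v, f v - f' v < 0 → v ∈ ofMask m' := fun v hv =>
    hfm' v (by linarith [hf.1 v] : 0 < f' v).ne'
  rcases exists_alternating_circuit (g := fun i j => f (i, j) - f' (i, j)) (i₀ := i₀)
      (fun i => by simp [hrow]) (fun j => by simp [hcol])
      (fun j => by simp [hz, hz']) (by
        by_contra! hall
        exact hne (funext fun v => sub_eq_zero.1 (hall v.1 v.2))) with
    ⟨i, k, j, l, h1, h2, h3, h4⟩ | ⟨i, k, q, j, l, n, hik, hkq, hiq, h1, h2, h3, h4, h5, h6⟩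
  · have hik : i ≠ k := by rintro rfl; exact lt_asymm h1 h2
    have hjl : j ≠ l := by rintro rfl; exact lt_asymm h1 h4
    have := no_four_circuit i k j l hik hjl
    rw [inFacet16_of hm (by simpa using ⟨hpos _ h1, hpos _ h3⟩),
      inFacet16_of hm' (by simpa using ⟨hneg _ h2, hneg _ h4⟩)] at this
    cases this
  · have hjl : j ≠ l := by rintro rfl; exact lt_asymm h2 h3
    have hln : l ≠ n := by rintro rfl; exact lt_asymm h4 h5
    have hjn : j ≠ n := by rintro rfl; exact lt_asymm h1 h6
    have := no_six_circuit i k q hik hkq hiq j l n hjl hln hjn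
    rw [inFacet16_of hm (by simpa using ⟨hpos _ h1, hpos _ h3, hpos _ h5⟩),
      inFacet16_of hm' (by simpa using ⟨hneg _ h2, hneg _ h4, hneg _ h6⟩)] at this
    cases this

/-- The boundary of the standard tetrahedron in `ℝ⁴`. -/
def tetraBoundary : Set (Fin 4 → ℝ) := {p | (∀ i, 0 ≤ p i) ∧ ∑ i, p i = 1 ∧ ∃ i, p i = 0}

theorem mem_tetraFace {A : Finset (Fin 4)} {p : Fin 4 → ℝ} :
    p ∈ tetraFace A ↔ (∀ i, 0 ≤ p i) ∧ ∑ i, p i = 1 ∧ ∀ i, p i ≠ 0 → i ∈ A := by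
  rw [tetraFace, mem_convexHull_image_iff]
  have h : ∀ f : Fin 4 → ℝ, ∑ v, f v • (Pi.single v 1 : Fin 4 → ℝ) = f := by
    intro f
    ext i
    simp [Pi.single_apply]
  simp only [h]
  constructor
  · rintro ⟨f, h0, h1, hs, rfl⟩
    exact ⟨h0, h1, hs⟩
  · rintro ⟨h0, h1, hs⟩
    exact ⟨p, h0, h1, hs, rfl⟩

theorem iUnion_tetraFace : (⋃ A ∈ {A : Finset (Fin 4) | A ≠ Finset.univ}, tetraFace A) =
    tetraBoundary := by
  ext p
  simp only [Set.mem_iUnion, Set.mem_ofPred_eq, mem_tetraFace, tetraBoundary, exists_prop]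
  constructor
  · rintro ⟨A, hA, h0, h1, hs⟩
    refine ⟨h0, h1, ?_⟩
    by_contra! hall
    exact hA (Finset.eq_univ_iff_forall.2 fun i => hs i (hall i))
  · rintro ⟨h0, h1, i, hi⟩
    refine ⟨Finset.univ.erase i, fun hh => ?_, h0, h1, fun k hk => ?_⟩
    · simpa using Finset.eq_univ_iff_forall.1 hh i
    · rw [Finset.mem_erase]
      exact ⟨fun e => hk (e ▸ hi), Finset.mem_univ _⟩

/-- `f` is a weight on the vertices of a facet with marginals `p` and `q`. -/
def IsCoupling (p q : Fin 4 → ℝ) (f : Fin 4 × Fin 4 → ℝ) : Prop :=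
  (∀ v, 0 ≤ f v) ∧ (∃ m ∈ facets16, ∀ v, f v ≠ 0 → v ∈ ofMask m) ∧
    (∀ i, ∑ j, f (i, j) = p i) ∧ ∀ j, ∑ i, f (i, j) = q j

/-- Prescribing five weights on the vertices of a facet turns the search for a coupling into linear
inequalities and identities. -/
theorem exists_isCoupling_of_entries {p q : Fin 4 → ℝ} {m : ℕ} (hm : m ∈ facets16)
    (v : Fin 5 → Fin 4 × Fin 4) (hv : ∀ k, m.testBit (code (v k)) = true) (c : Fin 5 → ℝ)
    (hc : ∀ k, 0 ≤ c k) (hp : ∀ i, ∑ k, (if (v k).1 = i then c k else 0) = p i)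
    (hq : ∀ j, ∑ k, (if (v k).2 = j then c k else 0) = q j) : ∃ f, IsCoupling p q f := by
  refine ⟨fun x => ∑ k, if v k = x then c k else 0, fun x => ?_, ⟨m, hm, fun x hx => ?_⟩,
    fun i => ?_, fun j => ?_⟩
  · exact Finset.sum_nonneg fun k _ => by split_ifs <;> simp [hc]
  · obtain ⟨k, -, hk⟩ := Finset.exists_ne_zero_of_sum_ne_zero hx
    have : v k = x := by
      by_contra hne
      simp [hne] at hk
    exact this ▸ mem_ofMask.2 (hv k)
  · rw [← hp, Finset.sum_comm]
    refine Finset.sum_congr rfl fun k _ => ?_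
    by_cases h1 : (v k).1 = i
    · rw [Finset.sum_eq_single (v k).2] <;> simp +contextual [h1, Prod.ext_iff, eq_comm]
    · simp [h1, Prod.ext_iff]
  · rw [← hq, Finset.sum_comm]
    refine Finset.sum_congr rfl fun k _ => ?_
    by_cases h1 : (v k).2 = j
    · rw [Finset.sum_eq_single (v k).1] <;> simp +contextual [h1, Prod.ext_iff, eq_comm]
    · simp [h1, Prod.ext_iff]

end Subdivision

/-! ### Surjectivity onto `∂T × ∂T`, and the homeomorphism with `S² × S²` -/

section Existence

variable {p q : Fin 4 → ℝ}

/-- The cell is the product of the triangle `{0, 2, 3}` with itself, cut into six simplices. Three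
contain a vertex `x i i` and fill the corners `1 ≤ p i + q i`; the other three fill the rest. On
each simplex the marginals force the weights, and the case distinctions express their nonnegativity.
-/
theorem exists_isCoupling_of_diagonal (hp : ∀ i, 0 ≤ p i) (hq : ∀ i, 0 ≤ q i)
    (hp1 : ∑ i, p i = 1) (hq1 : ∑ i, q i = 1) (hp0 : p 1 = 0) (hq0 : q 1 = 0) :
    ∃ f, IsCoupling p q f := by
  rw [Fin.sum_univ_four] at hp1 hq1
  have a0 := hp 0
  have a2 := hp 2
  have a3 := hp 3
  have b0 := hq 0
  have b2 := hq 2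
  have b3 := hq 3
  by_cases h0 : 1 ≤ p 2 + q 2
  · refine exists_isCoupling_of_entries (m := 19716) (by decide)
      ![(2, 2), (2, 3), (2, 0), (3, 2), (0, 2)] (by decide)
      ![p 2 + q 2 - 1, q 3, q 0, p 3, p 0] ?_ ?_ ?_ <;>
      (intro i; fin_cases i <;> simp [Fin.sum_univ_five] <;> linarith)
  by_cases h1 : 1 ≤ p 3 + q 3
  · refine exists_isCoupling_of_entries (m := 55304) (by decide)
      ![(3, 3), (3, 2), (3, 0), (2, 3), (0, 3)] (by decide)
      ![p 3 + q 3 - 1, q 2, q 0, p 2, p 0] ?_ ?_ ?_ <;>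
      (intro i; fin_cases i <;> simp [Fin.sum_univ_five] <;> linarith)
  by_cases h2 : 1 ≤ p 0 + q 0
  · refine exists_isCoupling_of_entries (m := 4365) (by decide)
      ![(0, 0), (0, 2), (0, 3), (2, 0), (3, 0)] (by decide)
      ![p 0 + q 0 - 1, q 2, q 3, p 2, p 3] ?_ ?_ ?_ <;>
      (intro i; fin_cases i <;> simp [Fin.sum_univ_five] <;> linarith)
  by_cases h3 : p 2 ≤ q 0 ∧ q 3 ≤ p 0
  · refine exists_isCoupling_of_entries (m := 20748) (by decide)
      ![(2, 0), (0, 3), (0, 2), (3, 2), (3, 0)] (by decide)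
      ![p 2, q 3, p 0 - q 3, q 2 - p 0 + q 3, q 0 - p 2] ?_ ?_ ?_ <;>
      (intro i; fin_cases i <;> simp [Fin.sum_univ_five] <;> linarith)
  by_cases h4 : q 0 ≤ p 2 ∧ q 0 ≤ p 0 - q 3 + p 2
  · refine exists_isCoupling_of_entries (m := 18700) (by decide)
      ![(2, 0), (2, 3), (0, 3), (0, 2), (3, 2)] (by decide)
      ![q 0, p 2 - q 0, q 3 - p 2 + q 0, p 0 - q 3 + p 2 - q 0, p 3] ?_ ?_ ?_ <;>
      (intro i; fin_cases i <;> simp [Fin.sum_univ_five] <;> linarith)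
  have h5 : p 0 < q 3 ∧ q 2 ≤ p 3 := by
    by_contra hcon
    rcases not_and_or.1 hcon with hcon | hcon
    · rcases le_total (p 2) (q 0) with hle | hle
      · exact h3 ⟨hle, not_lt.1 hcon⟩
      · exact h4 ⟨hle, by linarith⟩
    · rcases le_total (p 2) (q 0) with hle | hle
      · exact h3 ⟨hle, by linarith⟩
      · exact h4 ⟨hle, by linarith⟩
  refine exists_isCoupling_of_entries (m := 22792) (by decide)
    ![(2, 0), (2, 3), (0, 3), (3, 2), (3, 0)] (by decide)
    ![p 0 - q 3 + p 2, q 3 - p 0, p 0, q 2, p 3 - q 2] ?_ ?_ ?_ <;>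
    (intro i; fin_cases i <;> simp [Fin.sum_univ_five] <;> linarith)

/-- Here the cell is the product of the triangles `{1, 2, 3}` and `{0, 1, 2}`, again cut into six
simplices distinguished by the signs of the forced weights. -/
theorem exists_isCoupling_of_offDiagonal (hp : ∀ i, 0 ≤ p i) (hq : ∀ i, 0 ≤ q i)
    (hp1 : ∑ i, p i = 1) (hq1 : ∑ i, q i = 1) (hp0 : p 0 = 0) (hq0 : q 3 = 0) :
    ∃ f, IsCoupling p q f := by
  rw [Fin.sum_univ_four] at hp1 hq1
  have a1 := hp 1
  have a2 := hp 2
  have a3 := hp 3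
  have b0 := hq 0
  have b1 := hq 1
  have b2 := hq 2
  by_cases h0 : q 2 ≤ p 1
  · by_cases h1 : q 1 ≤ p 3
    · refine exists_isCoupling_of_entries (m := 12624) (by decide)
        ![(2, 0), (3, 1), (3, 0), (1, 2), (1, 0)] (by decide)
        ![p 2, q 1, p 3 - q 1, q 2, p 1 - q 2] ?_ ?_ ?_ <;>
        (intro i; fin_cases i <;> simp [Fin.sum_univ_five] <;> linarith)
    by_cases h2 : q 1 ≤ p 2 + p 3
    · refine exists_isCoupling_of_entries (m := 9040) (by decide)
        ![(1, 2), (1, 0), (3, 1), (2, 1), (2, 0)] (by decide)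
        ![q 2, p 1 - q 2, p 3, q 1 - p 3, p 2 - q 1 + p 3] ?_ ?_ ?_ <;>
        (intro i; fin_cases i <;> simp [Fin.sum_univ_five] <;> linarith)
    refine exists_isCoupling_of_entries (m := 8816) (by decide)
      ![(2, 1), (3, 1), (1, 2), (1, 0), (1, 1)] (by decide)
      ![p 2, p 3, q 2, q 0, q 1 - p 2 - p 3] ?_ ?_ ?_ <;>
      (intro i; fin_cases i <;> simp [Fin.sum_univ_five] <;> linarith)
  by_cases h1 : p 1 + p 3 ≤ q 2
  · refine exists_isCoupling_of_entries (m := 18240) (by decide)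
      ![(2, 2), (1, 2), (3, 2), (2, 1), (2, 0)] (by decide)
      ![q 2 - p 1 - p 3, p 1, p 3, q 1, q 0] ?_ ?_ ?_ <;>
      (intro i; fin_cases i <;> simp [Fin.sum_univ_five] <;> linarith)
  by_cases h2 : p 1 + p 3 ≤ q 1 + q 2
  · refine exists_isCoupling_of_entries (m := 25408) (by decide)
      ![(1, 2), (3, 2), (3, 1), (2, 1), (2, 0)] (by decide)
      ![p 1, q 2 - p 1, p 3 - q 2 + p 1, q 1 - p 3 + q 2 - p 1, q 0] ?_ ?_ ?_ <;>
      (intro i; fin_cases i <;> simp [Fin.sum_univ_five] <;> linarith)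
  refine exists_isCoupling_of_entries (m := 28992) (by decide)
    ![(2, 0), (3, 1), (1, 2), (3, 2), (3, 0)] (by decide)
    ![p 2, q 1, p 1, q 2 - p 1, p 3 - q 1 - q 2 + p 1] ?_ ?_ ?_ <;>
    (intro i; fin_cases i <;> simp [Fin.sum_univ_five] <;> linarith)

theorem comp_mem_maskComplex16 {a : Equiv.Perm (Fin 4)} (ha : a ∈ alternatingGroup (Fin 4))
    {t : Finset (Fin 4 × Fin 4)} (ht : t ∈ (maskComplex facets16).faces) :
    t.image (Prod.map a a) ∈ (maskComplex facets16).faces := by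
  rw [← S16second_eq] at ht ⊢
  obtain ⟨hne, _, ⟨a', ha', b, hb, rfl⟩, hts⟩ := ht
  refine ⟨hne.image _, _, ⟨a * a', mul_mem ha ha', b, hb, rfl⟩, ?_⟩
  refine (Finset.image_subset_image hts).trans ?_
  rw [Finset.image_image]
  exact subset_of_eq rfl

/-- `A₄` is doubly transitive on the indices. A vanishing coordinate `d` of `p` and `c` of `q` can
therefore be moved to `(1, 1)` if `d = c` and to `(0, 3)` otherwise, which leaves the two cells
treated above. -/
theorem exists_mem_carrier_of_tetraBoundary (hp : p ∈ tetraBoundary) (hq : q ∈ tetraBoundary) :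
    ∃ f ∈ carrier (maskComplex facets16), ∑ v, f v • vertexPoint v = (p, q) := by
  obtain ⟨hp0, hp1, d, hd⟩ := hp
  obtain ⟨hq0, hq1, c, hc⟩ := hq
  have h1 : ∀ d : Fin 4, ∃ a : Equiv.Perm (Fin 4), Equiv.Perm.sign a = 1 ∧ a 1 = d := by
    decide +kernel
  have h2 : ∀ d c : Fin 4, d ≠ c →
      ∃ a : Equiv.Perm (Fin 4), Equiv.Perm.sign a = 1 ∧ a 0 = d ∧ a 3 = c := by
    decide +kernel
  obtain ⟨a, ha, f, hf⟩ : ∃ a : Equiv.Perm (Fin 4), Equiv.Perm.sign a = 1 ∧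
      ∃ f, IsCoupling (p ∘ a) (q ∘ a) f := by
    by_cases hdc : d = c
    · subst hdc
      obtain ⟨a, ha, rfl⟩ := h1 d
      exact ⟨a, ha, exists_isCoupling_of_diagonal (fun _ => hp0 _) (fun _ => hq0 _)
        ((Equiv.sum_comp a p).trans hp1) ((Equiv.sum_comp a q).trans hq1) hd hc⟩
    · obtain ⟨a, ha, rfl, rfl⟩ := h2 d c hdc
      exact ⟨a, ha, exists_isCoupling_of_offDiagonal (fun _ => hp0 _) (fun _ => hq0 _)
        ((Equiv.sum_comp a p).trans hp1) ((Equiv.sum_comp a q).trans hq1) hd hc⟩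
  obtain ⟨hf0, ⟨m, hm, hfm⟩, hfp, hfq⟩ := hf
  have hrow : ∀ i, ∑ j, f (a.symm i, a.symm j) = p i := fun i => by
    rw [Equiv.sum_comp a.symm fun j => f (a.symm i, j), hfp]
    simp
  have hcol : ∀ j, ∑ i, f (a.symm i, a.symm j) = q j := fun j => by
    rw [Equiv.sum_comp a.symm fun i => f (i, a.symm j), hfq]
    simp
  refine ⟨fun x => f (a.symm x.1, a.symm x.2), ?_, ?_⟩
  · have hne : (ofMask m).Nonempty := by
      by_contra hne
      rw [Finset.not_nonempty_iff_eq_empty] at hne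
      have hz : ∀ v, f v = 0 := fun v => by
        by_contra hv
        simpa [hne] using hfm v hv
      have : p = 0 := funext fun i => by rw [← hrow]; simp [hz]
      simp [this] at hp1
    refine mem_carrier_of_forall (fun _ => hf0 _) ?_
      (comp_mem_maskComplex16 (Equiv.Perm.mem_alternatingGroup.2 ha)
        (mem_maskComplex.2 ⟨hne, m, hm, Finset.Subset.refl _⟩)) fun x hx => ?_
    · rw [Fintype.sum_prod_type, ← hp1]
      exact Finset.sum_congr rfl fun i _ => hrow i
    · exact Finset.mem_image.2 ⟨_, hfm _ hx, by simp⟩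
  · rw [sum_smul_vertexPoint]
    exact Prod.ext (funext hrow) (funext hcol)

theorem sum_smul_vertexPoint_mem {f : Fin 4 × Fin 4 → ℝ}
    (hf : f ∈ carrier (maskComplex facets16)) :
    ∑ v, f v • vertexPoint v ∈ tetraBoundary ×ˢ tetraBoundary := by
  obtain ⟨m, hm, hfm⟩ := exists_mask_of_mem_carrier hf
  have hz : ∀ v, m.testBit (code v) = false → f v = 0 := fun v hv => by
    by_contra hne
    have := mem_ofMask.1 (hfm v hne)
    rw [hv] at this
    cases this
  rw [sum_smul_vertexPoint]
  refine ⟨⟨fun i => ?_, ?_, ?_⟩,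
    fun j => ?_, ?_, ?_⟩
  · change 0 ≤ ∑ j, f (i, j)
    exact Finset.sum_nonneg fun j _ => hf.1 _
  · exact (Fintype.sum_prod_type f).symm.trans hf.2.1
  · obtain ⟨i, hi⟩ := exists_row_notMem m hm
    refine ⟨i, ?_⟩
    change ∑ j, f (i, j) = 0
    exact Finset.sum_eq_zero fun j _ => hz _ (hi j)
  · change 0 ≤ ∑ i, f (i, j)
    exact Finset.sum_nonneg fun i _ => hf.1 _
  · exact (Fintype.sum_prod_type_right f).symm.trans hf.2.1
  · obtain ⟨j, hj⟩ := exists_col_notMem m hm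
    refine ⟨j, ?_⟩
    change ∑ i, f (i, j) = 0
    exact Finset.sum_eq_zero fun i _ => hz _ (hj i)

theorem isSubdivisionOfProduct_maskComplex : IsSubdivisionOfProduct (maskComplex facets16) := by
  refine ⟨isEmbeddedBy_vertexPoint.realization, rfl, ?_, ?_⟩
  · rintro s ⟨t, ht, hst⟩
    obtain ⟨-, m, hm, htm⟩ := mem_maskComplex.1 ht
    obtain ⟨i, hi⟩ := exists_row_notMem m hm
    obtain ⟨j, hj⟩ := exists_col_notMem m hm
    have hbit : ∀ v ∈ t, m.testBit (code v) = true := fun v hv => mem_ofMask.1 (htm hv)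
    refine ⟨Finset.univ.erase i, Finset.univ.erase j,
      fun hh => by simpa using Finset.eq_univ_iff_forall.1 hh i,
      fun hh => by simpa using Finset.eq_univ_iff_forall.1 hh j, ?_⟩
    rw [hst]
    refine convexHull_min ?_ ((convex_convexHull ℝ _).prod (convex_convexHull ℝ _))
    rintro _ ⟨⟨k, l⟩, hv, rfl⟩
    have hb := hbit _ hv
    have hk : k ≠ i := by
      rintro rfl
      rw [hi l] at hb
      cases hb
    have hl : l ≠ j := by
      rintro rfl
      rw [hj k] at hb
      cases hb
    exact ⟨subset_convexHull ℝ _ ⟨k, by simpa using hk, rfl⟩,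
      subset_convexHull ℝ _ ⟨l, by simpa using hl, rfl⟩⟩
  · rw [iUnion_tetraFace]
    ext ⟨p, q⟩
    rw [IsEmbeddedBy.mem_space]
    constructor
    · rintro ⟨f, hf, hfe⟩
      rw [← hfe]
      exact sum_smul_vertexPoint_mem hf
    · rintro ⟨hp, hq⟩
      exact exists_mem_carrier_of_tetraBoundary hp hq

/-- The carrier of the complex with sixteen vertices is the product of two tetrahedral
boundaries. -/
theorem nonempty_carrier16_homeomorph :
    Nonempty (carrier (maskComplex facets16) ≃ₜ tetraBoundary × tetraBoundary) := by
  let φ : carrier (maskComplex facets16) → tetraBoundary × tetraBoundary := fun f =>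
    (⟨_, (sum_smul_vertexPoint_mem f.2).1⟩, ⟨_, (sum_smul_vertexPoint_mem f.2).2⟩)
  have hcont : Continuous fun f : carrier (maskComplex facets16) =>
      ∑ v, f.1 v • vertexPoint v :=
    continuous_finsetSum _ fun v _ =>
      ((continuous_apply v).comp continuous_subtype_val).smul continuous_const
  have hφ : Continuous φ := (hcont.fst.subtype_mk _).prodMk (hcont.snd.subtype_mk _)
  have hinj : Function.Injective φ := by
    intro f f' hff
    refine Subtype.ext (isEmbeddedBy_vertexPoint f.1 f.2 f'.1 f'.2 ?_)
    exact Prod.ext (congrArg (fun x => x.1.1) hff) (congrArg (fun x => x.2.1) hff)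
  have hsurj : Function.Surjective φ := by
    rintro ⟨⟨p, hp⟩, ⟨q, hq⟩⟩
    obtain ⟨f, hf, hfe⟩ := exists_mem_carrier_of_tetraBoundary hp hq
    refine ⟨⟨f, hf⟩, Prod.ext (Subtype.ext ?_) (Subtype.ext ?_)⟩
    · exact congrArg Prod.fst hfe
    · exact congrArg Prod.snd hfe
  exact ⟨Continuous.homeoOfEquivCompactToT2 (f := Equiv.ofBijective φ ⟨hinj, hsurj⟩) hφ⟩

/-- The boundary of the tetrahedron is a sphere. -/
theorem nonempty_tetraBoundary_homeomorph : Nonempty (tetraBoundary ≃ₜ Sphere2) := by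
  have hne : (Finset.univ : Finset (Fin 4)).Nonempty := Finset.univ_nonempty
  let ext : EuclideanSpace ℝ (Fin 3) → Fin 4 → ℝ := fun u i =>
    if hi : i.val < 3 then u ⟨i, hi⟩ else 0
  have ext_cont : ∀ i, Continuous fun u => ext u i := by
    intro i
    by_cases hi : i.val < 3
    · simp only [ext, hi, dif_pos]
      fun_prop
    · simp only [ext, hi]
      exact continuous_const
  have ext_last : ∀ u, ext u 3 = 0 := fun u => rfl
  have ext_cast : ∀ u (i : Fin 3), ext u i.castSucc = u i := fun u i => by
    simp [ext]
  -- On `∂T` the coordinates have minimum 0 and sum 1, so their oscillation is 1. It depends only on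
  -- the three differences `p i - p 3`, which become the coordinates.
  let N : EuclideanSpace ℝ (Fin 3) → ℝ := fun u => oscillation Finset.univ hne (ext u)
  have hN : IsGaugeLike N := by
    refine ⟨continuous_oscillation fun v _ => ext_cont v, fun r u hr => ?_, fun u hu => ?_⟩
    · refine oscillation_smul hr fun i _ => ?_
      by_cases hi : i.val < 3 <;> simp [ext, hi]
    · refine oscillation_nonneg.lt_of_ne fun h0 => hu ?_
      ext i
      rw [← ext_cast u i]
      exact eq_of_oscillation_eq_zero (f := ext u) h0.symm (Finset.mem_univ _) (Finset.mem_univ 3)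
  let co : (Fin 4 → ℝ) → EuclideanSpace ℝ (Fin 3) := fun p =>
    WithLp.toLp 2 fun i => p i.castSucc - p 3
  have co_cont : Continuous co := by
    simp only [co]
    fun_prop
  have ext_co : ∀ p i, ext (co p) i = p i + -p 3 := by
    intro p i
    refine Fin.lastCases ?_ (fun k => ?_) i
    · change (0 : ℝ) = p 3 + -p 3
      ring
    · rw [ext_cast, ← sub_eq_add_neg]
  have hmin : ∀ p ∈ tetraBoundary, blockMin Finset.univ hne p = 0 := by
    rintro p ⟨h0, -, i, hi⟩
    exact blockMin_eq_of (fun v _ => h0 v) ⟨i, Finset.mem_univ i, hi⟩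
  let inv : EuclideanSpace ℝ (Fin 3) → Fin 4 → ℝ := fun u i =>
    ext u i + -blockMin Finset.univ hne (ext u)
  have inv_min : ∀ u, blockMin Finset.univ hne (inv u) = 0 := by
    intro u
    rw [blockMin_add_const (g := inv u) (f := ext u) fun v _ => rfl]
    ring
  have inv_cont : Continuous inv := continuous_pi fun v =>
    (ext_cont v).add (continuous_blockMin fun v _ => ext_cont v).neg
  refine ⟨Homeomorph.trans (Y := {x | N x = 1}) {
    toFun := fun p => ⟨co p.1, ?_⟩
    invFun := fun u => ⟨inv u.1, ?_⟩
    left_inv := ?_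
    right_inv := ?_
    continuous_toFun := ?_
    continuous_invFun := ?_ } hN.sphereHomeomorph⟩
  · obtain ⟨p, hp⟩ := p
    change oscillation _ hne (ext (co p)) = 1
    rw [oscillation_congr (f := p) fun i _ => ext_co p i, oscillation_eq, hmin p hp, hp.2.1]
    ring
  · obtain ⟨u, hu⟩ := u
    refine ⟨fun i => ?_, ?_, ?_⟩
    · rw [← inv_min u]
      exact blockMin_le (Finset.mem_univ i)
    · have hu' : oscillation _ hne (ext u) = 1 := hu
      refine Eq.trans ?_ hu'
      exact Finset.sum_congr rfl fun i _ => (sub_eq_add_neg _ _).symm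
    · obtain ⟨i, -, hi⟩ := exists_eq_blockMin Finset.univ hne (inv u)
      exact ⟨i, hi.trans (inv_min u)⟩
  · rintro ⟨p, hp⟩
    apply Subtype.ext
    funext i
    change ext (co p) i + -blockMin _ hne (ext (co p)) = p i
    rw [blockMin_add_const (f := p) fun i _ => ext_co p i, hmin p hp, ext_co]
    ring
  · rintro ⟨u, hu⟩
    apply Subtype.ext
    change co (inv u) = u
    ext i
    change (ext u i.castSucc + _) - (ext u 3 + _) = u i
    rw [ext_cast, ext_last]
    ring
  · exact (co_cont.comp continuous_subtype_val).subtype_mk _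
  · exact (inv_cont.comp continuous_subtype_val).subtype_mk _

theorem triangulates_maskComplex12 : Triangulates (maskComplex facets12) (Sphere2 × Sphere2) := by
  obtain ⟨e1⟩ := nonempty_carrier16_homeomorph
  obtain ⟨e2⟩ := nonempty_tetraBoundary_homeomorph
  obtain ⟨-, ⟨e3⟩⟩ := reflTransGen_flipChain flips facets16 chainCheck_flips
  rw [flipChain_flips] at e3
  exact ⟨e3.symm.trans (e1.trans (e2.prodCongr e2))⟩

end Existence

/-! ## Isomorphisms -/

section Iso

variable {V W : Type*} {K K₁ K₂ : PreAbstractSimplicialComplex V}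
  {L L₁ L₂ : PreAbstractSimplicialComplex W} {e : V ≃ W}

theorem map_symm_map (e : V ≃ W) (s : Finset W) :
    (s.map e.symm.toEmbedding).map e.toEmbedding = s := by
  rw [Finset.map_map]
  ext v
  simp

theorem map_map_symm (e : V ≃ W) (s : Finset V) :
    (s.map e.toEmbedding).map e.symm.toEmbedding = s := map_symm_map e.symm s

theorem IsIso.symm (h : IsIso K L e) : IsIso L K e.symm := by
  intro s
  rw [← h (s.map e.symm.toEmbedding), map_symm_map]

theorem IsIso.trans {U : Type*} {M : PreAbstractSimplicialComplex U} {e' : W ≃ U}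
    (h : IsIso K L e) (h' : IsIso L M e') : IsIso K M (e.trans e') := by
  intro s
  rw [← h s, ← h' (s.map e.toEmbedding), Finset.map_map]
  rfl

theorem isIso_map [DecidableEq W] (K : PreAbstractSimplicialComplex V) (e : V ≃ W) :
    IsIso K (K.map e) e := by
  intro s
  constructor
  · rintro ⟨t, ht, hts⟩
    have : t.map e.toEmbedding = s.map e.toEmbedding := by
      rw [← hts, Finset.map_eq_image]
      rfl
    rwa [← Finset.map_injective e.toEmbedding this]
  · intro hs
    exact ⟨s, hs, (Finset.map_eq_image e.toEmbedding s).symm⟩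

theorem isIso_of_forall (h : ∀ s ∈ K.faces, s.map e.toEmbedding ∈ L.faces)
    (h' : ∀ s ∈ L.faces, s.map e.symm.toEmbedding ∈ K.faces) : IsIso K L e := by
  intro s
  refine ⟨fun hs => ?_, h s⟩
  have := h' _ hs
  rwa [map_map_symm] at this

theorem IsIso.mem_triangles (h : IsIso K L e) {s : Finset V} :
    s.map e.toEmbedding ∈ triangles L ↔ s ∈ triangles K := by
  simp only [triangles, Set.mem_ofPred_eq, h s, Finset.card_map]

variable [DecidableEq V] [DecidableEq W]

theorem map_pair (e : V ≃ W) (a b : V) : ({a, b} : Finset V).map e.toEmbedding = {e a, e b} := by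
  simp [Finset.map_insert]

theorem map_triple (e : V ≃ W) (a b c : V) :
    ({a, b, c} : Finset V).map e.toEmbedding = {e a, e b, e c} := by
  simp [Finset.map_insert]

theorem IsIso.adj_iff (h : IsIso K L e) {a b : V} :
    (edgeGraph L).Adj (e a) (e b) ↔ (edgeGraph K).Adj a b := by
  simp only [edgeGraph, ← map_pair, h _, ne_eq, EmbeddingLike.apply_eq_iff_eq]

theorem IsIso.corresponds (h₁ : IsIso K₁ L₁ e) (h₂ : IsIso K₂ L₂ e) {s t : Finset V}
    (h : Corresponds K₁ K₂ s t) :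
    Corresponds L₁ L₂ (s.map e.toEmbedding) (t.map e.toEmbedding) := by
  obtain ⟨hs, ht, a, b, c, i, j, k, rfl, rfl, h1, h2, h3⟩ := h
  refine ⟨h₁.mem_triangles.2 hs, h₂.mem_triangles.2 ht, e a, e b, e c, e i, e j, e k,
    map_triple e a b c, map_triple e i j k, ?_, ?_, ?_⟩
  · rw [← map_triple]; exact h₂.mem_triangles.2 h1
  · rw [← map_triple]; exact h₂.mem_triangles.2 h2
  · rw [← map_triple]; exact h₂.mem_triangles.2 h3

theorem IsIso.pairComplex_mem (h₁ : IsIso K₁ L₁ e) (h₂ : IsIso K₂ L₂ e) {s : Finset V}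
    (hs : s ∈ (pairComplex K₁ K₂).faces) :
    s.map e.toEmbedding ∈ (pairComplex L₁ L₂).faces := by
  obtain ⟨hne, f, hf, hsf⟩ := hs
  refine ⟨hne.map, f.map e.toEmbedding, ?_, Finset.map_subset_map.2 hsf⟩
  rcases hf with ⟨x, hx⟩ | ⟨t, t', ht, y, hy, rfl⟩
  · refine Or.inl ⟨e x, fun y => ?_⟩
    obtain ⟨y, rfl⟩ := e.surjective y
    rw [h₁.adj_iff, ← hx]
    exact Finset.mem_map' e.toEmbedding
  · refine Or.inr ⟨_, _, h₁.corresponds h₂ ht, e y, (Finset.mem_map' e.toEmbedding).2 hy, ?_⟩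
    rw [Finset.map_erase, Finset.map_union]
    rfl

theorem IsIso.pairComplex (h₁ : IsIso K₁ L₁ e) (h₂ : IsIso K₂ L₂ e) :
    IsIso (pairComplex K₁ K₂) (pairComplex L₁ L₂) e :=
  isIso_of_forall (fun _ => h₁.pairComplex_mem h₂) fun _ => h₁.symm.pairComplex_mem h₂.symm

theorem existsUnique_corresponds (h₁ : IsIso K₁ L₁ e) (h₂ : IsIso K₂ L₂ e)
    (h : ∀ s ∈ triangles K₁, ∃! t, Corresponds K₁ K₂ s t) :
    ∀ s ∈ triangles L₁, ∃! t, Corresponds L₁ L₂ s t := by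
  intro s hs
  obtain ⟨t, ht, hu⟩ := h (s.map e.symm.toEmbedding) (h₁.symm.mem_triangles.2 hs)
  refine ⟨t.map e.toEmbedding, ?_, fun t' ht' => ?_⟩
  · have := h₁.corresponds h₂ ht
    rwa [map_symm_map] at this
  · have := hu _ (h₁.symm.corresponds h₂.symm ht')
    rw [← this, map_symm_map]

end Iso

/-! ## Clique complexes and the icosahedron -/

section Clique

theorem dist_eq_two_iff {V : Type*} {G : SimpleGraph V} {a b : V} :
    G.dist a b = 2 ↔ a ≠ b ∧ ¬ G.Adj a b ∧ ∃ c, G.Adj a c ∧ G.Adj c b := by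
  constructor
  · intro h
    -- Unreachable vertices have distance 0 by convention, so distance two forces a path.
    have hr : G.Reachable a b := SimpleGraph.Reachable.of_dist_ne_zero (by omega)
    obtain ⟨p, hp⟩ := hr.exists_walk_length_eq_dist
    refine ⟨?_, ?_, ?_⟩
    · rintro rfl
      simp at h
    · intro hadj
      rw [SimpleGraph.dist_eq_one_iff_adj.2 hadj] at h
      omega
    · rw [h] at hp
      match p, hp with
      | .cons h1 (.cons h2 .nil), _ => exact ⟨_, h1, h2⟩
  · rintro ⟨hne, hadj, c, h1, h2⟩
    have hle : G.dist a b ≤ 2 := SimpleGraph.dist_le (.cons h1 (.cons h2 .nil))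
    have h0 : G.dist a b ≠ 0 := fun h => hne
      ((SimpleGraph.Reachable.dist_eq_zero_iff (h1.reachable.trans h2.reachable)).1 h)
    have h1' : G.dist a b ≠ 1 := fun h => hadj (SimpleGraph.dist_eq_one_iff_adj.1 h)
    omega

variable {V : Type*} [DecidableEq V]

/-- A complex is flag if its faces are the nonempty cliques of its edge graph. -/
def IsFlag (K : PreAbstractSimplicialComplex V) : Prop :=
  ∀ s : Finset V, s.Nonempty → (∀ a ∈ s, ∀ b ∈ s, a ≠ b → (edgeGraph K).Adj a b) → s ∈ K.faces

theorem adj_of_mem_faces {K : PreAbstractSimplicialComplex V} {s : Finset V} (hs : s ∈ K.faces)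
    {a b : V} (ha : a ∈ s) (hb : b ∈ s) (hab : a ≠ b) : (edgeGraph K).Adj a b := by
  refine ⟨hab, (K.isRelLowerSet_faces hs).2 ?_ ⟨a, by simp⟩⟩
  intro v hv
  simp only [Finset.mem_insert, Finset.mem_singleton] at hv
  rcases hv with rfl | rfl <;> assumption

/-- The faces of a flag complex are the nonempty cliques of its graph, so graph isomorphisms
suffice. -/
theorem IsFlag.isIso {W : Type*} [DecidableEq W] {K : PreAbstractSimplicialComplex V}
    {L : PreAbstractSimplicialComplex W} {e : V ≃ W} (hK : IsFlag K) (hL : IsFlag L)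
    (h : ∀ a b, (edgeGraph L).Adj (e a) (e b) ↔ (edgeGraph K).Adj a b) : IsIso K L e := by
  refine isIso_of_forall (fun s hs => ?_) fun s hs => ?_
  · refine hL _ (K.isRelLowerSet_faces hs).1.map ?_
    intro a ha b hb hab
    obtain ⟨a, ha', rfl⟩ := Finset.mem_map.1 ha
    obtain ⟨b, hb', rfl⟩ := Finset.mem_map.1 hb
    exact (h a b).2 (adj_of_mem_faces hs ha' hb' fun hh => hab (by rw [hh]))
  · refine hK _ (L.isRelLowerSet_faces hs).1.map ?_
    intro a ha b hb hab
    obtain ⟨a, ha', rfl⟩ := Finset.mem_map.1 ha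
    obtain ⟨b, hb', rfl⟩ := Finset.mem_map.1 hb
    refine (h _ _).1 ?_
    simpa using adj_of_mem_faces hs ha' hb' fun hh => hab (by rw [hh])

theorem IsFlag.of_isIso {W : Type*} [DecidableEq W] {K : PreAbstractSimplicialComplex V}
    {L : PreAbstractSimplicialComplex W} {e : V ≃ W} (hK : IsFlag K) (h : IsIso K L e) :
    IsFlag L := by
  intro s hne hs
  rw [← map_symm_map e s, h]
  refine hK _ hne.map ?_
  intro a ha b hb hab
  obtain ⟨a, ha', rfl⟩ := Finset.mem_map.1 ha
  obtain ⟨b, hb', rfl⟩ := Finset.mem_map.1 hb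
  exact h.symm.adj_iff.2 (hs a ha' b hb' fun hh => hab (by rw [hh]))

theorem IsFlag.mem_triangles {K : PreAbstractSimplicialComplex V} (hK : IsFlag K) {a b c : V} :
    {a, b, c} ∈ triangles K ↔
      (edgeGraph K).Adj a b ∧ (edgeGraph K).Adj b c ∧ (edgeGraph K).Adj a c := by
  constructor
  · rintro ⟨hs, hcard⟩
    have hab : a ≠ b := by
      rintro rfl
      have := Finset.card_le_two (a := a) (b := c)
      simp_all
    have hac : a ≠ c := by
      rintro rfl
      have := Finset.card_le_two (a := b) (b := a)
      simp_all
    have hbc : b ≠ c := by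
      rintro rfl
      have := Finset.card_le_two (a := a) (b := b)
      simp_all
    exact ⟨adj_of_mem_faces hs (by simp) (by simp) hab, adj_of_mem_faces hs (by simp) (by simp) hbc,
      adj_of_mem_faces hs (by simp) (by simp) hac⟩
  · rintro ⟨h1, h2, h3⟩
    refine ⟨hK _ ⟨a, by simp⟩ ?_, Finset.card_eq_three.2 ⟨a, b, c, h1.1, h3.1, h2.1, rfl⟩⟩
    intro u hu v hv huv
    simp only [Finset.mem_insert, Finset.mem_singleton] at hu hv
    rcases hu with rfl | rfl | rfl <;> rcases hv with rfl | rfl | rfl <;>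
      first | exact absurd rfl huv | assumption | (apply SimpleGraph.Adj.symm; assumption)

end Clique

/-! ### The icosahedron as a flag complex, and rigidity of antimorphic pairs -/

section Icosahedron

/-- The adjacency relation of the icosahedron. -/
def icoAdj : Bool × Option (Fin 5) → Bool × Option (Fin 5) → Bool
  | (_, none), (_, none) => false
  | (b, none), (c, some _) => b == c
  | (b, some _), (c, none) => b == c
  | (true, some i), (true, some j) => i == j + 1 || j == i + 1
  | (false, some i), (false, some j) => i == j + 1 || j == i + 1
  | (true, some i), (false, some j) => i == j || i == j + 1
  | (false, some i), (true, some j) => i == j || j == i + 1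

/-- The generating triangles of the icosahedron. -/
def IsIcoTriangle (s : Finset (Bool × Option (Fin 5))) : Prop :=
  ((∃ (b : Bool) (i : Fin 5), s = {(b, none), (b, some i), (b, some (i + 1))}) ∨
    (∃ i : Fin 5, s = {(true, some i), (true, some (i + 1)), (false, some i)})) ∨
    (∃ i : Fin 5, s = {(false, some i), (false, some (i + 1)), (true, some (i + 1))})

instance : DecidablePred IsIcoTriangle := fun s => by
  unfold IsIcoTriangle; infer_instance

theorem mem_icosahedron {s : Finset (Bool × Option (Fin 5))} :
    s ∈ icosahedron.faces ↔ s.Nonempty ∧ ∃ t, IsIcoTriangle t ∧ s ⊆ t := Iff.rfl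

theorem isIcoTriangle_of_icoAdj : ∀ a b, icoAdj a b = true → ∀ c, icoAdj a c = true →
    icoAdj b c = true → IsIcoTriangle {a, b, c} := by
  decide +kernel

theorem icoAdj_of_isIcoTriangle {t : Finset (Bool × Option (Fin 5))} (ht : IsIcoTriangle t) :
    ∀ a ∈ t, ∀ b ∈ t, a ≠ b → icoAdj a b = true := by
  rcases ht with (⟨b, i, rfl⟩ | ⟨i, rfl⟩) | ⟨i, rfl⟩
  · revert b i; decide +kernel
  · revert i; decide +kernel
  · revert i; decide +kernel

theorem exists_icoAdj : ∀ a, ∃ b, icoAdj a b = true := by decide +kernel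

theorem exists_icoAdj_icoAdj : ∀ a b, icoAdj a b = true →
    ∃ c, icoAdj a c = true ∧ icoAdj b c = true := by
  decide +kernel

theorem icoAdj_cliqueFree : ∀ a b, icoAdj a b = true → ∀ c, icoAdj a c = true → icoAdj b c = true →
    ∀ d, icoAdj a d = true → icoAdj b d = true → icoAdj c d = false := by
  decide +kernel

theorem icoAdj_irrefl : ∀ a, icoAdj a a = false := by decide +kernel

theorem ne_of_icoAdj {a b : Bool × Option (Fin 5)} (h : icoAdj a b = true) : a ≠ b := by
  rintro rfl
  rw [icoAdj_irrefl] at h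
  cases h

theorem edgeGraph_icosahedron_adj {a b : Bool × Option (Fin 5)} :
    (edgeGraph icosahedron).Adj a b ↔ icoAdj a b = true := by
  constructor
  · rintro ⟨hab, -, t, ht, hsub⟩
    exact icoAdj_of_isIcoTriangle ht a (hsub (by simp)) b (hsub (by simp)) hab
  · intro h
    obtain ⟨c, hac, hbc⟩ := exists_icoAdj_icoAdj a b h
    refine ⟨ne_of_icoAdj h, ⟨a, by simp⟩, _, isIcoTriangle_of_icoAdj a b h c hac hbc, ?_⟩
    intro v hv
    simp only [Finset.mem_insert, Finset.mem_singleton] at hv ⊢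
    tauto

/-- The graph has no four pairwise adjacent vertices, every three pairwise adjacent vertices span a
triangle, and every vertex and edge lies in a triangle. -/
theorem isFlag_icosahedron : IsFlag icosahedron := by
  intro s hne hs
  simp only [edgeGraph_icosahedron_adj] at hs
  refine mem_icosahedron.2 ⟨hne, ?_⟩
  have key : ∃ a b c, icoAdj a b = true ∧ icoAdj a c = true ∧ icoAdj b c = true ∧
      s ⊆ {a, b, c} := by
    obtain ⟨a, ha⟩ := hne
    by_cases h1 : s ⊆ {a}
    · obtain ⟨b, hb⟩ := exists_icoAdj a
      obtain ⟨c, hac, hbc⟩ := exists_icoAdj_icoAdj a b hb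
      exact ⟨a, b, c, hb, hac, hbc, h1.trans (by simp)⟩
    obtain ⟨b, hb, hba⟩ := Finset.not_subset.1 h1
    have hab := hs a ha b hb (by simpa [eq_comm] using hba)
    by_cases h2 : s ⊆ {a, b}
    · obtain ⟨c, hac, hbc⟩ := exists_icoAdj_icoAdj a b hab
      refine ⟨a, b, c, hab, hac, hbc, h2.trans ?_⟩
      intro v hv
      simp only [Finset.mem_insert, Finset.mem_singleton] at hv ⊢
      tauto
    obtain ⟨c, hc, hcab⟩ := Finset.not_subset.1 h2
    simp only [Finset.mem_insert, Finset.mem_singleton, not_or] at hcab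
    have hac := hs a ha c hc (Ne.symm hcab.1)
    have hbc := hs b hb c hc (Ne.symm hcab.2)
    refine ⟨a, b, c, hab, hac, hbc, fun d hd => ?_⟩
    by_contra hcon
    simp only [Finset.mem_insert, Finset.mem_singleton, not_or] at hcon
    have := icoAdj_cliqueFree a b hab c hac hbc d (hs a ha d hd (Ne.symm hcon.1))
      (hs b hb d hd (Ne.symm hcon.2.1))
    rw [hs c hc d hd (Ne.symm hcon.2.2)] at this
    cases this
  obtain ⟨a, b, c, hab, hac, hbc, hsub⟩ := key
  exact ⟨_, isIcoTriangle_of_icoAdj a b hab c hac hbc, hsub⟩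

theorem IsIcosahedron.isFlag {V : Type*} [DecidableEq V] {I : PreAbstractSimplicialComplex V}
    (h : IsIcosahedron I) : IsFlag I := by
  obtain ⟨e, he⟩ := h
  exact isFlag_icosahedron.of_isIso he

/-- An isomorphism between the first members of two antimorphic pairs is an isomorphism between
the second members. -/
theorem IsAntimorphicPair.isIso_snd {V W : Type*} [DecidableEq V] [DecidableEq W]
    {I₁ I₂ : PreAbstractSimplicialComplex V} {J₁ J₂ : PreAbstractSimplicialComplex W}
    (hI : IsAntimorphicPair I₁ I₂) (hJ : IsAntimorphicPair J₁ J₂) {e : V ≃ W}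
    (he : IsIso I₁ J₁ e) : IsIso I₂ J₂ e := by
  refine hI.2.1.isFlag.isIso hJ.2.1.isFlag fun a b => ?_
  rw [← SimpleGraph.dist_eq_one_iff_adj, ← SimpleGraph.dist_eq_one_iff_adj]
  have h1 := (hI.2.2 a b).2
  have h2 := (hJ.2.2 (e a) (e b)).2
  simp only [Equiv.refl_apply] at h1 h2
  -- Adjacency in the second member becomes a condition on the first: distinct, nonadjacent, with a
  -- common neighbour. The map `e` preserves it.
  rw [← h1, ← h2, dist_eq_two_iff, dist_eq_two_iff, he.adj_iff, e.injective.ne_iff]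
  refine and_congr_right fun _ => and_congr_right fun _ => ?_
  constructor
  · rintro ⟨c, hc⟩
    obtain ⟨c, rfl⟩ := e.surjective c
    exact ⟨c, he.adj_iff.1 hc.1, he.adj_iff.1 hc.2⟩
  · rintro ⟨c, hc⟩
    exact ⟨e c, he.adj_iff.2 hc.1, he.adj_iff.2 hc.2⟩

end Icosahedron

/-! ## The vertices of the complex with twelve vertices -/

section OffDiagCode

theorem natBeq_iff {a b : ℕ} : a.beq b = true ↔ a = b :=
  ⟨Nat.eq_of_beq_eq_true, fun h => h ▸ Nat.beq_refl a⟩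

/-- The number representing an off-diagonal vertex. -/
def num (v : OffDiag) : ℕ := code v.1

/-- The numbers of the off-diagonal vertices. -/
def nums : List ℕ := [1, 2, 3, 4, 6, 7, 8, 9, 11, 12, 13, 14]

theorem num_injective : Function.Injective num := fun _ _ h => Subtype.ext (code_injective h)

theorem num_mem_nums : ∀ v : OffDiag, num v ∈ nums := by decide +kernel

theorem exists_num_eq : ∀ n ∈ nums, ∃ v : OffDiag, num v = n := by decide +kernel

/-- The set of off-diagonal vertices represented by a bit mask. -/
def offMask (m : ℕ) : Finset OffDiag := Finset.univ.filter fun v => m.testBit (num v)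

theorem mem_offMask {m : ℕ} {v : OffDiag} : v ∈ offMask m ↔ m.testBit (num v) = true := by
  simp [offMask]

theorem offMask_subset_of_and_eq {a b : ℕ} (hab : a &&& b = a) : offMask a ⊆ offMask b := by
  intro p hp
  rw [mem_offMask] at hp ⊢
  rw [← hab, Nat.testBit_and] at hp
  simp_all

/-- The number 31710 is the mask of all twelve off-diagonal vertices. -/
theorem image_offMask {m : ℕ} (hm : m &&& 31710 = m) :
    (offMask m).image Subtype.val = ofMask m := by
  ext p
  simp only [Finset.mem_image, mem_offMask, mem_ofMask]
  constructor
  · rintro ⟨v, hv, rfl⟩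
    exact hv
  · intro hp
    have hd : ∀ p : Fin 4 × Fin 4, Nat.testBit 31710 (code p) = true → p.1 ≠ p.2 := by
      decide +kernel
    refine ⟨⟨p, hd p ?_⟩, hp, rfl⟩
    rw [← hm, Nat.testBit_and] at hp
    simp_all

theorem and_eq_of_offMask_subset {a b : ℕ} (ha : a &&& 31710 = a)
    (hab : offMask a ⊆ offMask b) : a &&& b = a := by
  refine and_eq_of_ofMask_subset (lt_of_le_of_lt (ha ▸ Nat.and_le_right) (by norm_num)) ?_
  intro p hp
  rw [← image_offMask ha, Finset.mem_image] at hp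
  obtain ⟨v, hv, rfl⟩ := hp
  exact mem_ofMask.2 (mem_offMask.1 (hab hv))

theorem offMask_injOn {a b : ℕ} (ha : a &&& 31710 = a) (hb : b &&& 31710 = b)
    (hab : offMask a = offMask b) : a = b := by
  rw [← and_eq_of_offMask_subset ha hab.le, Nat.and_comm, and_eq_of_offMask_subset hb hab.ge]

theorem testBit_two_pow_num {v w : OffDiag} : (2 ^ num v).testBit (num w) = true ↔ w = v := by
  rw [Nat.testBit_two_pow, decide_eq_true_eq]
  exact ⟨fun h => (num_injective h).symm, fun h => h ▸ rfl⟩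

/-- The mask of three vertices. -/
def mask₃ (a b c : ℕ) : ℕ := 2 ^ a ||| 2 ^ b ||| 2 ^ c

theorem offMask_mask₃ (a b c : OffDiag) : offMask (mask₃ (num a) (num b) (num c)) = {a, b, c} := by
  ext v
  simp only [mem_offMask, mask₃, Nat.testBit_or, Bool.or_eq_true, testBit_two_pow_num,
    Finset.mem_insert, Finset.mem_singleton, or_assoc]

theorem mask₃_and : ∀ a ∈ nums, ∀ b ∈ nums, ∀ c ∈ nums,
    mask₃ a b c &&& 31710 = mask₃ a b c := by
  decide +kernel

theorem offMask_union_erase {m n : ℕ} {v : OffDiag} (hv : v ∈ offMask n) :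
    (offMask m ∪ offMask n).erase v = offMask ((m ||| n) ^^^ 2 ^ num v) := by
  ext w
  simp only [Finset.mem_erase, Finset.mem_union, mem_offMask, Nat.testBit_xor, Nat.testBit_or]
  by_cases hw : w = v
  · subst hw
    rw [testBit_two_pow_num.2 rfl]
    simp [mem_offMask.1 hv]
  · have : (2 ^ num v).testBit (num w) = false := by
      rw [← Bool.not_eq_true, testBit_two_pow_num]
      exact hw
    simp [this, hw]

end OffDiagCode

/-! ## The explicit antimorphic pair -/

section Pair

/-- The neighbours in the first icosahedron, as masks. -/
def nbr₁ : List ℕ :=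
  [0, 20620, 666, 17158, 2756, 0, 14480, 4182, 27144, 2332, 0, 9040, 24770, 22848, 12554, 0]

/-- The neighbours in the second icosahedron, as masks. -/
def nbr₂ : List ℕ :=
  [0, 9040, 22848, 14480, 12554, 0, 17158, 27144, 4182, 24770, 0, 20620, 2332, 666, 2756, 0]

/-- The adjacency relation given by a list of masks. -/
def adjOf (N : List ℕ) (a b : ℕ) : Bool := (N.getD a 0).testBit b

/-- The first labelling as a bijection. -/
noncomputable def labelEquiv₁ : Bool × Option (Fin 5) ≃ OffDiag :=
  Equiv.ofBijective label₁ (by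
    rw [Fintype.bijective_iff_injective_and_card]
    decide +kernel)

/-- The second labelling as a bijection. -/
noncomputable def labelEquiv₂ : Bool × Option (Fin 5) ≃ OffDiag :=
  Equiv.ofBijective label₂ (by
    rw [Fintype.bijective_iff_injective_and_card]
    decide +kernel)

theorem isIso_ico₁ : IsIso icosahedron ico₁ labelEquiv₁ := isIso_map icosahedron labelEquiv₁

theorem isIso_ico₂ : IsIso icosahedron ico₂ labelEquiv₂ := isIso_map icosahedron labelEquiv₂

theorem isIcosahedron_ico₁ : IsIcosahedron ico₁ := ⟨_, isIso_ico₁⟩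

theorem isIcosahedron_ico₂ : IsIcosahedron ico₂ := ⟨_, isIso_ico₂⟩

theorem edgeGraph_ico₁_adj (v w : OffDiag) :
    (edgeGraph ico₁).Adj v w ↔ adjOf nbr₁ (num v) (num w) = true := by
  obtain ⟨a, rfl⟩ := labelEquiv₁.surjective v
  obtain ⟨b, rfl⟩ := labelEquiv₁.surjective w
  rw [isIso_ico₁.adj_iff, edgeGraph_icosahedron_adj]
  have : ∀ a b, icoAdj a b = adjOf nbr₁ (num (label₁ a)) (num (label₁ b)) := by decide +kernel
  rw [this]
  rfl

theorem edgeGraph_ico₂_adj (v w : OffDiag) :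
    (edgeGraph ico₂).Adj v w ↔ adjOf nbr₂ (num v) (num w) = true := by
  obtain ⟨a, rfl⟩ := labelEquiv₂.surjective v
  obtain ⟨b, rfl⟩ := labelEquiv₂.surjective w
  rw [isIso_ico₂.adj_iff, edgeGraph_icosahedron_adj]
  have : ∀ a b, icoAdj a b = adjOf nbr₂ (num (label₂ a)) (num (label₂ b)) := by decide +kernel
  rw [this]
  rfl

theorem dist_eq_two_iff_of_adjOf {G H : SimpleGraph OffDiag} {N N' : List ℕ}
    (hG : ∀ v w, G.Adj v w ↔ adjOf N (num v) (num w) = true)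
    (hH : ∀ v w, H.Adj v w ↔ adjOf N' (num v) (num w) = true)
    (h : ∀ a ∈ nums, ∀ b ∈ nums, adjOf N' a b =
      (!a.beq b && !adjOf N a b && nums.any fun c => adjOf N a c && adjOf N c b)) (v w : OffDiag) :
    H.dist v w = 1 ↔ G.dist v w = 2 := by
  rw [SimpleGraph.dist_eq_one_iff_adj, dist_eq_two_iff, hH, h _ (num_mem_nums v) _ (num_mem_nums w)]
  simp only [Bool.and_eq_true, Bool.not_eq_true', hG, List.any_eq_true, and_assoc]
  refine and_congr ?_ (and_congr (by simp) ?_)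
  · rw [← Bool.not_eq_true, natBeq_iff]
    exact num_injective.ne_iff
  · constructor
    · rintro ⟨c, hc, h1, h2⟩
      obtain ⟨u, rfl⟩ := exists_num_eq c hc
      exact ⟨u, h1, h2⟩
    · rintro ⟨u, h1, h2⟩
      exact ⟨num u, num_mem_nums u, h1, h2⟩

theorem isAntimorphicPair_ico : IsAntimorphicPair ico₁ ico₂ := by
  refine ⟨isIcosahedron_ico₁, isIcosahedron_ico₂, fun v w => ⟨?_, ?_⟩⟩
  · exact dist_eq_two_iff_of_adjOf edgeGraph_ico₂_adj edgeGraph_ico₁_adj (by decide +kernel) v w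
  · exact (dist_eq_two_iff_of_adjOf edgeGraph_ico₁_adj edgeGraph_ico₂_adj
      (by decide +kernel) v w).symm

/-- Three numbers form a triangle of the clique complex. -/
def triOf (N : List ℕ) (a b c : ℕ) : Bool := adjOf N a b && (adjOf N b c && adjOf N a c)

theorem mem_triangles_ico₁ {a b c : OffDiag} :
    {a, b, c} ∈ triangles ico₁ ↔ triOf nbr₁ (num a) (num b) (num c) = true := by
  simp only [isIcosahedron_ico₁.isFlag.mem_triangles, edgeGraph_ico₁_adj, triOf, Bool.and_eq_true]

theorem mem_triangles_ico₂ {a b c : OffDiag} :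
    {a, b, c} ∈ triangles ico₂ ↔ triOf nbr₂ (num a) (num b) (num c) = true := by
  simp only [isIcosahedron_ico₂.isFlag.mem_triangles, edgeGraph_ico₂_adj, triOf, Bool.and_eq_true]

/-- The triangles `abc` of the first icosahedron with the corresponding triangles `ijk`. -/
def correspondence : List ((ℕ × ℕ × ℕ) × (ℕ × ℕ × ℕ)) :=
  [((1, 2, 3), (4, 8, 12)), ((1, 7, 2), (6, 9, 14)), ((7, 2, 4), (3, 11, 12)), ((6, 7, 4), (1,
    9, 13)), ((3, 2, 9), (7, 11, 14)), ((9, 2, 4), (1, 6, 8)), ((8, 3, 9), (1, 4, 13)), ((6, 4,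
    11), (2, 8, 12)), ((11, 9, 4), (3, 7, 13)), ((8, 9, 11), (2, 6, 14)), ((12, 1, 7), (3, 4,
    13)), ((12, 7, 6), (2, 11, 14)), ((13, 6, 11), (7, 9, 14)), ((13, 8, 11), (3, 4, 12)), ((13,
    12, 6), (1, 4, 8)), ((14, 1, 3), (7, 9, 13)), ((14, 3, 8), (2, 11, 12)), ((14, 1, 12), (2,
    6, 8)), ((8, 14, 13), (1, 6, 9)), ((13, 14, 12), (3, 7, 11))]

/-- The masks of the triangles of the first icosahedron and of the corresponding triangles. -/
def correspondenceMasks : List (ℕ × ℕ) :=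
  [(14, 4368), (134, 16960), (148, 6152), (208, 8706), (524, 18560), (532, 322), (776, 8210),
    (2128, 4356), (2576, 8328), (2816, 16452), (4226, 8216), (4288, 18436), (10304, 17024),
    (10496, 4120), (12352, 274), (16394, 8832), (16648, 6148), (20482, 324), (24832, 578),
    (28672, 2184)]

theorem correspondenceMasks_eq : correspondenceMasks = correspondence.map fun p =>
    (mask₃ p.1.1 p.1.2.1 p.1.2.2, mask₃ p.2.1 p.2.2.1 p.2.2.2) := by
  decide +kernel

theorem correspondence_spec : ∀ p ∈ correspondence,
    ((p.1.1 ∈ nums ∧ p.1.2.1 ∈ nums ∧ p.1.2.2 ∈ nums) ∧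
      p.2.1 ∈ nums ∧ p.2.2.1 ∈ nums ∧ p.2.2.2 ∈ nums) ∧
    (triOf nbr₁ p.1.1 p.1.2.1 p.1.2.2 = true ∧ triOf nbr₂ p.2.1 p.2.2.1 p.2.2.2 = true) ∧
    triOf nbr₂ p.1.1 p.2.1 p.2.2.1 = true ∧ triOf nbr₂ p.1.2.1 p.2.2.1 p.2.2.2 = true ∧
    triOf nbr₂ p.1.2.2 p.2.1 p.2.2.2 = true := by
  decide +kernel

theorem exists_correspondenceMasks : ∀ a ∈ nums, ∀ b ∈ nums, ∀ c ∈ nums,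
    triOf nbr₁ a b c = true → ∃ p ∈ correspondenceMasks, p.1 = mask₃ a b c := by
  decide +kernel

/-- The conditions are interleaved with the quantifiers to cut the enumeration down to adjacent
triangles. -/
theorem mem_correspondenceMasks : ∀ a ∈ nums, ∀ i ∈ nums, ∀ j ∈ nums,
    triOf nbr₂ a i j = true → ∀ k ∈ nums, triOf nbr₂ i j k = true → ∀ b ∈ nums,
    (triOf nbr₂ b j k && adjOf nbr₁ a b) = true → ∀ c ∈ nums,
    (triOf nbr₂ c i k && triOf nbr₁ a b c) = true →
    (correspondenceMasks.any fun p => p.1.beq (mask₃ a b c) && p.2.beq (mask₃ i j k)) = true := by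
  decide +kernel

theorem correspondenceMasks_unique : ∀ p ∈ correspondenceMasks, ∀ q ∈ correspondenceMasks,
    p.1 = q.1 → p.2 = q.2 := by
  decide +kernel

theorem correspondenceMasks_and : ∀ p ∈ correspondenceMasks,
    p.1 &&& 31710 = p.1 ∧ p.2 &&& 31710 = p.2 := by
  decide +kernel

theorem corresponds_iff {s t : Finset OffDiag} : Corresponds ico₁ ico₂ s t ↔
    ∃ p ∈ correspondenceMasks, s = offMask p.1 ∧ t = offMask p.2 := by
  constructor
  · rintro ⟨hs, ht, a, b, c, i, j, k, rfl, rfl, h1, h2, h3⟩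
    rw [mem_triangles_ico₁] at hs
    rw [mem_triangles_ico₂] at ht h1 h2 h3
    have hab : adjOf nbr₁ (num a) (num b) = true := by
      have := hs
      simp only [triOf, Bool.and_eq_true] at this
      exact this.1
    have := mem_correspondenceMasks _ (num_mem_nums a) _ (num_mem_nums i) _ (num_mem_nums j) h1
      _ (num_mem_nums k) ht _ (num_mem_nums b) (by rw [h2, hab]; rfl) _ (num_mem_nums c)
      (by rw [h3, hs]; rfl)
    obtain ⟨p, hp, hpq⟩ := List.any_eq_true.1 this
    rw [Bool.and_eq_true, natBeq_iff, natBeq_iff] at hpq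
    exact ⟨p, hp, by rw [hpq.1, offMask_mask₃], by rw [hpq.2, offMask_mask₃]⟩
  · rintro ⟨p, hp, rfl, rfl⟩
    rw [correspondenceMasks_eq] at hp
    obtain ⟨⟨⟨a, b, c⟩, i, j, k⟩, hq, rfl⟩ := List.mem_map.1 hp
    obtain ⟨⟨⟨ha, hb, hc⟩, hi, hj, hk⟩, ⟨h1, h2⟩, h3, h4, h5⟩ := correspondence_spec _ hq
    obtain ⟨a, rfl⟩ := exists_num_eq _ ha
    obtain ⟨b, rfl⟩ := exists_num_eq _ hb
    obtain ⟨c, rfl⟩ := exists_num_eq _ hc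
    obtain ⟨i, rfl⟩ := exists_num_eq _ hi
    obtain ⟨j, rfl⟩ := exists_num_eq _ hj
    obtain ⟨k, rfl⟩ := exists_num_eq _ hk
    simp only [offMask_mask₃]
    exact ⟨mem_triangles_ico₁.2 h1, mem_triangles_ico₂.2 h2, a, b, c, i, j, k, rfl, rfl,
      mem_triangles_ico₂.2 h3, mem_triangles_ico₂.2 h4, mem_triangles_ico₂.2 h5⟩

theorem existsUnique_corresponds_ico {s : Finset OffDiag} (hs : s ∈ triangles ico₁) :
    ∃! t, Corresponds ico₁ ico₂ s t := by
  obtain ⟨a, b, c, -, -, -, rfl⟩ := Finset.card_eq_three.1 hs.2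
  obtain ⟨p, hp, hpm⟩ := exists_correspondenceMasks _ (num_mem_nums a) _ (num_mem_nums b) _
    (num_mem_nums c) (mem_triangles_ico₁.1 hs)
  have hsp : {a, b, c} = offMask p.1 := by rw [hpm, offMask_mask₃]
  refine ⟨offMask p.2, corresponds_iff.2 ⟨p, hp, hsp, rfl⟩, fun t ht => ?_⟩
  obtain ⟨q, hq, h1, rfl⟩ := corresponds_iff.1 ht
  rw [correspondenceMasks_unique q hq p hp (offMask_injOn (correspondenceMasks_and q hq).1
    (correspondenceMasks_and p hp).1 (h1 ▸ hsp))]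

/-- All antimorphic pairs of icosahedra are isomorphic. -/
theorem IsAntimorphicPair.exists_isIso {V : Type*} [DecidableEq V]
    {I₁ I₂ : PreAbstractSimplicialComplex V} (hI : IsAntimorphicPair I₁ I₂) :
    ∃ e : OffDiag ≃ V, IsIso ico₁ I₁ e ∧ IsIso ico₂ I₂ e := by
  obtain ⟨e, he⟩ := hI.1
  have h1 : IsIso ico₁ I₁ (labelEquiv₁.symm.trans e) := isIso_ico₁.symm.trans he
  exact ⟨_, h1, isAntimorphicPair_ico.isIso_snd hI h1⟩

theorem IsAntimorphicPair.existsUnique_corresponds {V : Type*} [DecidableEq V]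
    {I₁ I₂ : PreAbstractSimplicialComplex V} (hI : IsAntimorphicPair I₁ I₂) :
    ∀ s ∈ triangles I₁, ∃! t, Corresponds I₁ I₂ s t := by
  obtain ⟨e, h1, h2⟩ := hI.exists_isIso
  exact SimplicialSurgery.existsUnique_corresponds h1 h2 fun s hs =>
    existsUnique_corresponds_ico hs

theorem IsAntimorphicPair.isIso_pairComplex {V : Type*} [DecidableEq V]
    {I₁ I₂ : PreAbstractSimplicialComplex V} (hI : IsAntimorphicPair I₁ I₂) :
    ∃ e : OffDiag ≃ V, IsIso S12 (SimplicialSurgery.pairComplex I₁ I₂) e := by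
  obtain ⟨e, h1, h2⟩ := hI.exists_isIso
  exact ⟨e, h1.pairComplex h2⟩

end Pair

/-! ## The facets of the complex with twelve vertices -/

section Facets

/-- The family of facets of the complex with twelve vertices. -/
def facetFamily : Set (Finset OffDiag) := {s | ∃ m ∈ facets12, s = offMask m}

theorem nbr₁_mem_facets12 : ∀ a ∈ nums, nbr₁.getD a 0 ∈ facets12 := by decide +kernel

theorem or_xor_mem_facets12 : ∀ p ∈ correspondenceMasks, ∀ a ∈ nums, p.2.testBit a = true →
    (p.1 ||| p.2) ^^^ 2 ^ a ∈ facets12 := by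
  decide +kernel

theorem facets12_cases : ∀ m ∈ facets12, (nums.any fun a => m.beq (nbr₁.getD a 0)) = true ∨
    (correspondenceMasks.any fun p => nums.any fun a =>
      p.2.testBit a && m.beq ((p.1 ||| p.2) ^^^ 2 ^ a)) = true := by
  decide +kernel

theorem eq_offMask_iff {N : List ℕ} {v : OffDiag} {s : Finset OffDiag} :
    s = offMask (N.getD (num v) 0) ↔ ∀ w, w ∈ s ↔ adjOf N (num v) (num w) = true := by
  rw [Finset.ext_iff]
  simp only [mem_offMask, adjOf]

/-- The 12 neighbour sets and 3 sets for each of the 20 triangles account for the 72 facets. -/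
theorem S12_eq : S12 = generatedBy facetFamily := by
  rw [S12, pairComplex]
  congr 1
  ext s
  simp only [Set.mem_union, Set.mem_ofPred_eq, edgeGraph_ico₁_adj, ← eq_offMask_iff,
    corresponds_iff, facetFamily]
  constructor
  · rintro (⟨v, rfl⟩ | ⟨_, _, ⟨p, hp, rfl, rfl⟩, y, hy, rfl⟩)
    · exact ⟨_, nbr₁_mem_facets12 _ (num_mem_nums v), rfl⟩
    · exact ⟨_, or_xor_mem_facets12 p hp _ (num_mem_nums y) (mem_offMask.1 hy),
        offMask_union_erase hy⟩
  · rintro ⟨m, hm, rfl⟩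
    rcases facets12_cases m hm with h | h
    · obtain ⟨a, ha, h⟩ := List.any_eq_true.1 h
      obtain ⟨v, rfl⟩ := exists_num_eq a ha
      exact Or.inl ⟨v, by rw [natBeq_iff] at h; rw [h]⟩
    · obtain ⟨p, hp, h⟩ := List.any_eq_true.1 h
      obtain ⟨a, ha, h⟩ := List.any_eq_true.1 h
      obtain ⟨v, rfl⟩ := exists_num_eq a ha
      rw [Bool.and_eq_true, natBeq_iff] at h
      exact Or.inr ⟨_, _, ⟨p, hp, rfl, rfl⟩, v, mem_offMask.2 h.1, by
        rw [h.2, offMask_union_erase (mem_offMask.2 h.1)]⟩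

theorem mem_S12 {t : Finset OffDiag} :
    t ∈ S12.faces ↔ t.Nonempty ∧ ∃ m ∈ facets12, t ⊆ offMask m := by
  rw [S12_eq]
  constructor
  · rintro ⟨ht, _, ⟨m, hm, rfl⟩, h⟩
    exact ⟨ht, m, hm, h⟩
  · rintro ⟨ht, m, hm, h⟩
    exact ⟨ht, _, ⟨m, hm, rfl⟩, h⟩

theorem facets12_and : ∀ m ∈ facets12, m &&& 31710 = m := by decide +kernel

theorem card_offMask_facets12 : ∀ m ∈ facets12, (offMask m).card = 5 := by decide +kernel

/-- All generating sets have five elements, so they are recognised by cardinality; hence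
automorphisms permute them. -/
theorem mem_facetFamily_iff {s : Finset OffDiag} :
    s ∈ facetFamily ↔ s ∈ S12.faces ∧ s.card = 5 := by
  rw [mem_S12]
  constructor
  · rintro ⟨m, hm, rfl⟩
    have := card_offMask_facets12 m hm
    exact ⟨⟨Finset.card_pos.1 (by omega), m, hm, subset_rfl⟩, this⟩
  · rintro ⟨⟨-, m, hm, h⟩, hc⟩
    exact ⟨m, hm, Finset.eq_of_subset_of_card_le h (by rw [hc, card_offMask_facets12 m hm])⟩

theorem map_S12 : S12.map Subtype.val = maskComplex facets12 := by
  ext t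
  rw [mem_maskComplex]
  constructor
  · rintro ⟨s, hs, rfl⟩
    obtain ⟨hne, m, hm, h⟩ := mem_S12.1 hs
    refine ⟨hne.image _, m, hm, ?_⟩
    rw [← image_offMask (facets12_and m hm)]
    exact Finset.image_subset_image h
  · rintro ⟨hne, m, hm, h⟩
    rw [← image_offMask (facets12_and m hm)] at h
    obtain ⟨s, hs, rfl⟩ := Finset.subset_image_iff.1 h
    exact ⟨s, mem_S12.2 ⟨Finset.image_nonempty.1 hne, m, hm, hs⟩, rfl⟩

theorem vertexSet_S12 : vertexSet S12 = Set.univ := by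
  refine Set.eq_univ_of_forall fun v => mem_S12.2 ⟨⟨v, by simp⟩, ?_⟩
  have : ∀ a ∈ nums, (facets12.any fun m => m.testBit a) = true := by decide +kernel
  obtain ⟨m, hm, h⟩ := List.any_eq_true.1 (this _ (num_mem_nums v))
  exact ⟨m, hm, by simpa [mem_offMask] using h⟩

theorem ncard_vertexSet_S12 : (vertexSet S12).ncard = 12 := by
  rw [vertexSet_S12, Set.ncard_univ, Nat.card_eq_fintype_card]
  decide +kernel

end Facets

/-! ## The group generated by two permutations -/

section Group

/-- The permutation `γ` is given on numbers by the table `T`. -/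
def HasTable (γ : Equiv.Perm OffDiag) (T : List ℕ) : Prop := ∀ v, num (γ v) = T.getD (num v) 0

/-- The table of the first generator. -/
def tableG : List ℕ :=
  [0, 3, 4, 12, 1, 0, 9, 13, 2, 8, 0, 6, 7, 14, 11, 0]

/-- The table of the second generator. -/
def tableH : List ℕ :=
  [0, 1, 3, 14, 9, 0, 4, 2, 13, 8, 0, 11, 7, 6, 12, 0]

/-- The table of the inverse of the first generator. -/
def tableGInv : List ℕ :=
  [0, 4, 8, 1, 2, 0, 11, 12, 9, 6, 0, 14, 3, 7, 13, 0]

/-- The table of the inverse of the second generator. -/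
def tableHInv : List ℕ :=
  [0, 1, 7, 2, 6, 0, 13, 12, 9, 4, 0, 11, 14, 8, 3, 0]

theorem hasTable_g : HasTable g tableG := by unfold HasTable; decide +kernel

theorem hasTable_h : HasTable h tableH := by unfold HasTable; decide +kernel

theorem HasTable.inv {γ : Equiv.Perm OffDiag} {T T' : List ℕ} (hT : HasTable γ T)
    (hTT : ∀ a ∈ nums, T'.getD (T.getD a 0) 0 = a) : HasTable γ⁻¹ T' := by
  intro v
  obtain ⟨w, rfl⟩ := γ.surjective v
  rw [hT w, hTT _ (num_mem_nums w)]
  simp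

theorem hasTable_g_inv : HasTable g⁻¹ tableGInv := hasTable_g.inv (by decide +kernel)

theorem hasTable_h_inv : HasTable h⁻¹ tableHInv := hasTable_h.inv (by decide +kernel)

/-- The image of a mask under the permutation given by a table. -/
def mapMask (T : List ℕ) (m : ℕ) : ℕ :=
  nums.foldr (fun a acc => bif m.testBit a then 2 ^ T.getD a 0 ||| acc else acc) 0

theorem HasTable.map_offMask {γ : Equiv.Perm OffDiag} {T : List ℕ} (hT : HasTable γ T) (m : ℕ) :
    (offMask m).map γ.toEmbedding = offMask (mapMask T m) := by
  have key : ∀ (f : ℕ → ℕ) (l : List ℕ) (j : ℕ), (l.foldr (fun a acc =>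
      bif m.testBit a then 2 ^ f a ||| acc else acc) 0).testBit j = true ↔
      ∃ a ∈ l, m.testBit a = true ∧ f a = j := by
    intro f l j
    induction l with
    | nil => simp
    | cons a l ih =>
      rw [List.foldr_cons]
      cases hb : m.testBit a
      · simp [ih, hb]
      · simp [ih, hb, Nat.testBit_or, Nat.testBit_two_pow]
  ext v
  rw [mem_offMask, mapMask, key (T.getD · 0)]
  constructor
  · intro hv
    obtain ⟨w, hw, rfl⟩ := Finset.mem_map.1 hv
    exact ⟨num w, num_mem_nums w, mem_offMask.1 hw, (hT w).symm⟩
  · rintro ⟨a, ha, h1, h2⟩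
    obtain ⟨w, rfl⟩ := exists_num_eq a ha
    exact Finset.mem_map.2 ⟨w, mem_offMask.2 h1, num_injective ((hT w).trans h2)⟩

theorem HasTable.map_mem_facetFamily {γ : Equiv.Perm OffDiag} {T : List ℕ} (hT : HasTable γ T)
    (h : ∀ m ∈ facets12, facets12.elem (mapMask T m) = true) {s : Finset OffDiag}
    (hs : s ∈ facetFamily) : s.map γ.toEmbedding ∈ facetFamily := by
  obtain ⟨m, hm, rfl⟩ := hs
  exact ⟨_, List.elem_iff.1 (h m hm), hT.map_offMask m⟩

theorem mem_aut_of_map_mem_facetFamily {γ : Equiv.Perm OffDiag}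
    (h : ∀ s ∈ facetFamily, s.map γ.toEmbedding ∈ facetFamily)
    (h' : ∀ s ∈ facetFamily, s.map (γ⁻¹).toEmbedding ∈ facetFamily) : γ ∈ Aut S12 := by
  rw [S12_eq]
  refine isIso_of_forall ?_ ?_
  · rintro t ⟨hne, f, hf, htf⟩
    exact ⟨hne.map, _, h f hf, Finset.map_subset_map.2 htf⟩
  · rintro t ⟨hne, f, hf, htf⟩
    exact ⟨hne.map, _, h' f hf, Finset.map_subset_map.2 htf⟩

theorem g_mem_aut : g ∈ Aut S12 :=
  mem_aut_of_map_mem_facetFamily (fun _ => hasTable_g.map_mem_facetFamily (by decide +kernel))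
    fun _ => hasTable_g_inv.map_mem_facetFamily (by decide +kernel)

theorem h_mem_aut : h ∈ Aut S12 :=
  mem_aut_of_map_mem_facetFamily (fun _ => hasTable_h.map_mem_facetFamily (by decide +kernel))
    fun _ => hasTable_h_inv.map_mem_facetFamily (by decide +kernel)

theorem groupGH_le_aut : groupGH ≤ Aut S12 := by
  refine (Subgroup.closure_le _).2 ?_
  rintro γ (rfl | rfl)
  exacts [g_mem_aut, h_mem_aut]

theorem map_mem_facetFamily_iff {γ : Equiv.Perm OffDiag} (hγ : γ ∈ Aut S12) {s : Finset OffDiag} :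
    s.map γ.toEmbedding ∈ facetFamily ↔ s ∈ facetFamily := by
  rw [mem_facetFamily_iff, mem_facetFamily_iff, Finset.card_map, hγ s]

theorem g_mem_groupGH : g ∈ groupGH := Subgroup.subset_closure (by simp)

theorem h_mem_groupGH : h ∈ groupGH := Subgroup.subset_closure (by simp)

/-- Every entry `(m, p, b)` of the list is obtained by a step of kind `b` from `p`, which is an
initial state or appears before. -/
def reachCheck (step : Bool → ℕ → ℕ) : List ℕ → List (ℕ × ℕ × Bool) → Bool
  | _, [] => true
  | seen, (m, p, b) :: R => seen.elem p && (m.beq (step b p) && reachCheck step (m :: seen) R)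

theorem reach_induction {step : Bool → ℕ → ℕ} {P : ℕ → Prop} (hstep : ∀ b a, P a → P (step b a)) :
    ∀ (R : List (ℕ × ℕ × Bool)) (seen : List ℕ), (∀ a ∈ seen, P a) →
      reachCheck step seen R = true → ∀ r ∈ R, P r.1
  | [], _, _, _ => by simp
  | (m, p, b) :: R, seen, hs, hR => by
    rw [reachCheck, Bool.and_eq_true, Bool.and_eq_true, List.elem_iff, natBeq_iff] at hR
    have hm : P m := hR.2.1 ▸ hstep b p (hs p hR.1)
    intro r hr
    rcases List.mem_cons.1 hr with rfl | hr
    · exact hm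
    · refine reach_induction hstep R (m :: seen) ?_ hR.2.2 r hr
      simpa [hm] using hs

/-- The facets, as images of earlier ones under one of the two generators. -/
def facetSteps : List (ℕ × ℕ × Bool) :=
  [(17158, 9040, true), (25346, 8912, true), (852, 8912, false), (2332, 17158, true), (12554,
    17158, false), (18700, 25346, true), (12610, 25346, false), (790, 852, true), (8984, 852,
    false), (4182, 2332, true), (27144, 2332, false), (20620, 12554, true), (24770, 12554,
    false), (6228, 18700, true), (30728, 18700, false), (17036, 12610, true), (8402, 12610,
    false), (286, 790, true), (8970, 790, false), (20742, 8984, true), (25408, 8984, false),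
    (666, 4182, true), (22848, 27144, true), (14480, 20620, true), (722, 6228, true), (2712,
    6228, false), (22720, 30728, true), (14608, 17036, true), (20748, 17036, false), (25098,
    8402, true), (598, 8402, false), (4126, 286, true), (24898, 8970, false), (2204, 20742,
    true), (12426, 20742, false), (19204, 25408, true), (12624, 25408, false), (2756, 22848,
    true), (10944, 22720, true), (6292, 22720, false), (16582, 14608, true), (28808, 20748,
    false), (22792, 25098, true), (20802, 25098, false), (794, 598, true), (4250, 4126, true),
    (17034, 4126, false), (18956, 24898, true), (12370, 24898, false), (2388, 19204, true),
    (14600, 19204, false), (17030, 12624, true), (2700, 6292, false), (10776, 16582, true),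
    (30848, 28808, true), (20676, 28808, false), (6340, 22792, true), (12434, 20802, false),
    (4366, 794, true), (6480, 18956, true), (26816, 14600, false), (10520, 17030, true), (19264,
    10776, false), (10896, 20676, true), (4252, 20676, false), (24714, 12434, true), (710,
    12434, false), (27200, 26816, true), (20550, 10520, true), (2884, 19264, true)]

/-- The images of the basic facets under the group. -/
def orbitFamily : Set (Finset OffDiag) :=
  {s | ∃ γ ∈ groupGH, ∃ b ∈ basicFacets12, s = b.map γ.toEmbedding}

theorem map_mem_orbitFamily {γ : Equiv.Perm OffDiag} (hγ : γ ∈ groupGH) {s : Finset OffDiag}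
    (hs : s ∈ orbitFamily) : s.map γ.toEmbedding ∈ orbitFamily := by
  obtain ⟨δ, hδ, b, hb, rfl⟩ := hs
  refine ⟨γ * δ, mul_mem hγ hδ, b, hb, ?_⟩
  rw [Finset.map_map]
  rfl

theorem basicFacets12_eq : basicFacets12 = {offMask 9040, offMask 8912} := by
  have h1 : offMask 9040 = {x 1 2, x 1 4, x 2 1, x 2 4, x 3 1} := by decide +kernel
  have h2 : offMask 8912 = {x 1 2, x 1 3, x 1 4, x 2 1, x 3 1} := by decide +kernel
  rw [h1, h2, basicFacets12]

theorem basicFacets12_subset_orbitFamily {s : Finset OffDiag} (hs : s ∈ basicFacets12) :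
    s ∈ orbitFamily := ⟨1, one_mem _, s, hs, Finset.map_refl.symm⟩

theorem orbitFamily_eq : orbitFamily = facetFamily := by
  have hb : basicFacets12 ⊆ facetFamily := by
    rw [basicFacets12_eq]
    rintro s (rfl | rfl)
    · exact ⟨_, by decide +kernel, rfl⟩
    · exact ⟨_, by decide +kernel, rfl⟩
  apply Set.Subset.antisymm
  · rintro _ ⟨γ, hγ, b, hbb, rfl⟩
    exact (map_mem_facetFamily_iff (groupGH_le_aut hγ)).2 (hb hbb)
  · rintro _ ⟨m, hm, rfl⟩
    have h0 : ∀ m ∈ [9040, 8912], offMask m ∈ orbitFamily := by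
      intro m hm
      apply basicFacets12_subset_orbitFamily
      rw [basicFacets12_eq]
      rcases List.mem_cons.1 hm with rfl | hm
      · exact Or.inl rfl
      · exact Or.inr (congrArg offMask (List.mem_singleton.1 hm))
    -- In the certificate `true` stands for `g` and `false` for `h`.
    have hR := reach_induction (P := fun m => offMask m ∈ orbitFamily)
      (step := fun b => mapMask (bif b then tableG else tableH)) (fun b m hm => ?_) facetSteps
      [9040, 8912] h0 (by decide +kernel)
    · have hc : ∀ m ∈ facets12, m ∈ [9040, 8912] ∨ ∃ r ∈ facetSteps, r.1 = m := by
        decide +kernel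
      rcases hc m hm with h | ⟨r, hr, rfl⟩
      exacts [h0 m h, hR r hr]
    · cases b
      · have := map_mem_orbitFamily h_mem_groupGH hm
        rwa [hasTable_h.map_offMask] at this
      · have := map_mem_orbitFamily g_mem_groupGH hm
        rwa [hasTable_g.map_offMask] at this

theorem S12_eq_generatedBy_orbitFamily : S12 = generatedBy orbitFamily := by
  rw [orbitFamily_eq, S12_eq]

end Group

/-! ## The automorphism group -/

section Special

/-- In hexadecimal notation, the digit `b` of the entry `a` is the third vertex of the triangle of
one of the two oriented icosahedra that contains the oriented edge `ab`. -/
def thirdTable : List ℕ :=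
  [0, 907194280107172608, 795096673700876400, 93291975969343776, 5506545005680512, 0,
    197385297007675536, 663965179108831680, 280578531170294880, 464011515768022224, 0,
    540995219794349568, 963823105791773664, 580507073675227200, 54360394851976752, 0]

/-- The third vertex of the oriented triangle at an oriented edge. -/
def third (a b : ℕ) : ℕ := (thirdTable.getD a 0 >>> (4 * b)) % 16

/-- The orientation class of an ordered triangle of one of the two icosahedra. -/
def orientation (a b c : ℕ) : Option (ZMod 4) :=
  -- The classes 0 and 2 are the two orientations of triangles of the first icosahedron, 1 and 3
  -- those of the second. The edge `ab` decides between them, as the two icosahedra share no edge.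
  bif (third a b).beq c then some (bif adjOf nbr₁ a b then 0 else 1)
  else bif (third b a).beq c then some (bif adjOf nbr₁ a b then 2 else 3) else none

/-- The triangles of the two icosahedra are characterized by the number of facets containing
them. -/
theorem length_filter_eq_three_iff : ∀ a ∈ nums, ∀ b ∈ nums, ∀ c ∈ nums,
    (facets12.filter fun m => (mask₃ a b c &&& m).beq (mask₃ a b c)).length = 3 ↔
      (orientation a b c).isSome = true := by
  decide +kernel

theorem nodup_facets12 : facets12.Nodup := by decide +kernel

theorem ncard_facets_of_subset (a b c : OffDiag) :
    {f ∈ facetFamily | {a, b, c} ⊆ f}.ncard =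
      (facets12.filter fun m => (mask₃ (num a) (num b) (num c) &&& m).beq
        (mask₃ (num a) (num b) (num c))).length := by
  have hm := mask₃_and _ (num_mem_nums a) _ (num_mem_nums b) _ (num_mem_nums c)
  set l := facets12.filter fun m => (mask₃ (num a) (num b) (num c) &&& m).beq
    (mask₃ (num a) (num b) (num c)) with hl
  have hset : {f ∈ facetFamily | {a, b, c} ⊆ f} = offMask '' (l.toFinset : Set ℕ) := by
    ext f
    constructor
    · rintro ⟨⟨m, hmf, rfl⟩, hf⟩
      refine ⟨m, ?_, rfl⟩
      rw [← offMask_mask₃] at hf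
      rw [List.coe_toFinset, Set.mem_ofPred_eq, hl, List.mem_filter, natBeq_iff]
      exact ⟨hmf, and_eq_of_offMask_subset hm hf⟩
    · rintro ⟨m, hml, rfl⟩
      rw [List.coe_toFinset, Set.mem_ofPred_eq, hl, List.mem_filter, natBeq_iff] at hml
      refine ⟨⟨m, hml.1, rfl⟩, ?_⟩
      rw [← offMask_mask₃]
      exact offMask_subset_of_and_eq hml.2
  rw [hset, Set.InjOn.ncard_image, Set.ncard_coe_finset,
    List.toFinset_card_of_nodup (nodup_facets12.filter _)]
  intro m hml n hnl h
  rw [List.coe_toFinset, Set.mem_ofPred_eq, hl] at hml hnl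
  exact offMask_injOn (facets12_and m (List.mem_of_mem_filter hml))
    (facets12_and n (List.mem_of_mem_filter hnl)) h

/-- An ordered triple of vertices spans a triangle of one of the two icosahedra. -/
def IsSpecial (a b c : OffDiag) : Prop := (orientation (num a) (num b) (num c)).isSome = true

theorem isSpecial_iff_ncard {a b c : OffDiag} :
    IsSpecial a b c ↔ {f ∈ facetFamily | {a, b, c} ⊆ f}.ncard = 3 := by
  rw [IsSpecial, ncard_facets_of_subset, length_filter_eq_three_iff _ (num_mem_nums a) _
    (num_mem_nums b) _ (num_mem_nums c)]

/-- The number of facets containing a triple is invariant under automorphisms. -/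
theorem isSpecial_map {σ : Equiv.Perm OffDiag} (hσ : σ ∈ Aut S12) {a b c : OffDiag} :
    IsSpecial (σ a) (σ b) (σ c) ↔ IsSpecial a b c := by
  rw [isSpecial_iff_ncard, isSpecial_iff_ncard, ← map_triple]
  have : {f ∈ facetFamily | ({a, b, c} : Finset OffDiag).map σ.toEmbedding ⊆ f} =
      (fun f : Finset OffDiag => f.map σ.toEmbedding) '' {f ∈ facetFamily | {a, b, c} ⊆ f} := by
    ext f
    constructor
    · rintro ⟨hf, hsub⟩
      refine ⟨f.map σ.symm.toEmbedding, ⟨?_, ?_⟩, map_symm_map σ f⟩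
      · rwa [← map_mem_facetFamily_iff hσ, map_symm_map]
      · rwa [← Finset.map_subset_map (f := σ.toEmbedding), map_symm_map]
    · rintro ⟨f, ⟨hf, hsub⟩, rfl⟩
      exact ⟨(map_mem_facetFamily_iff hσ).2 hf, Finset.map_subset_map.2 hsub⟩
  rw [this, Set.ncard_image_of_injective _ (Finset.map_injective _)]

/-- `abc` and `abd` are the only triangles of the two icosahedra at the edge `ab`. -/
def IsOpposite (a b c d : ℕ) : Bool :=
  (orientation a b c).isSome && ((orientation a b d).isSome && (!d.beq c &&
    nums.all fun e => bif (orientation a b e).isSome then e.beq c || e.beq d else true))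

/-- The image of `d` completes `ab` to a special triangle, so it is `c` or `d`; injectivity excludes
`c`, which is already fixed. -/
theorem fixed_of_isOpposite {σ : Equiv.Perm OffDiag} (hσ : σ ∈ Aut S12) {a b c d : OffDiag}
    (h : IsOpposite (num a) (num b) (num c) (num d) = true) (ha : σ a = a) (hb : σ b = b)
    (hc : σ c = c) : σ d = d := by
  simp only [IsOpposite, Bool.and_eq_true, Bool.not_eq_true', List.all_eq_true] at h
  obtain ⟨-, h2, h3, h4⟩ := h
  have h5 : IsSpecial a b (σ d) := by
    have := (isSpecial_map hσ).2 h2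
    rwa [ha, hb] at this
  have h6 := h4 _ (num_mem_nums (σ d))
  rw [h5, cond_true, Bool.or_eq_true, natBeq_iff, natBeq_iff] at h6
  rcases h6 with h6 | h6
  · have hdc : d = c := σ.injective ((num_injective h6).trans hc.symm)
    rw [hdc, ← Bool.not_eq_true, natBeq_iff] at h3
    exact absurd rfl h3
  · exact num_injective h6

/-- Starting from three vertices, each entry `(a, b, c, d)` adds the vertex `d` opposite to `c` at
the edge `ab`. -/
def spreadCheck : List ℕ → List (ℕ × ℕ × ℕ × ℕ) → Bool
  | seen, [] => nums.all seen.elem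
  | seen, (a, b, c, d) :: R => (seen.elem a && (seen.elem b && seen.elem c)) &&
      ((IsOpposite a b c d && nums.elem d) && spreadCheck (d :: seen) R)

theorem eq_one_of_spreadCheck {σ : Equiv.Perm OffDiag} (hσ : σ ∈ Aut S12) :
    ∀ (R : List (ℕ × ℕ × ℕ × ℕ)) (seen : List ℕ),
      (∀ a ∈ seen, ∃ v, num v = a ∧ σ v = v) → spreadCheck seen R = true → σ = 1
  | [], seen, hs, hR => by
    ext1 v
    rw [spreadCheck, List.all_eq_true] at hR
    obtain ⟨w, hw, hw'⟩ := hs _ (List.elem_iff.1 (hR _ (num_mem_nums v)))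
    rwa [← num_injective hw]
  | (a, b, c, d) :: R, seen, hs, hR => by
    simp only [spreadCheck, Bool.and_eq_true, List.elem_iff] at hR
    obtain ⟨⟨ha, hb, hc⟩, ⟨hO, hd⟩, hR⟩ := hR
    obtain ⟨a, rfl, ha'⟩ := hs a ha
    obtain ⟨b, rfl, hb'⟩ := hs b hb
    obtain ⟨c, rfl, hc'⟩ := hs c hc
    obtain ⟨d, rfl⟩ := exists_num_eq d hd
    refine eq_one_of_spreadCheck hσ R _ ?_ hR
    intro e he
    rcases List.mem_cons.1 he with rfl | he
    · exact ⟨d, rfl, fixed_of_isOpposite hσ hO ha' hb' hc'⟩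
    · exact hs e he

/-- Crossing edges from one special triangle to the next, in either icosahedron, reaches all twelve
vertices from the base triangle. -/
theorem eq_one_of_fixed {σ : Equiv.Perm OffDiag} (hσ : σ ∈ Aut S12) (h1 : σ (x 2 3) = x 2 3)
    (h2 : σ (x 1 2) = x 1 2) (h3 : σ (x 3 1) = x 3 1) : σ = 1 := by
  refine eq_one_of_spreadCheck hσ
    [(11, 6, 13, 4), (11, 13, 6, 8), (11, 4, 6, 9), (6, 13, 11, 12), (6, 4, 11, 7), (13, 8, 11,
      14), (13, 9, 7, 1), (13, 7, 9, 3), (4, 9, 11, 2)]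
    [num (x 2 3), num (x 1 2), num (x 3 1)] ?_ (by decide +kernel)
  intro a ha
  simp only [List.mem_cons, List.not_mem_nil, or_false] at ha
  rcases ha with rfl | rfl | rfl
  exacts [⟨_, rfl, h1⟩, ⟨_, rfl, h2⟩, ⟨_, rfl, h3⟩]

/-- The number representing an ordered triple. -/
def num₃ (a b c : ℕ) : ℕ := 256 * a + (16 * b + c)

/-- The image of an ordered triple under the permutation given by a table. -/
def map₃ (T : List ℕ) (m : ℕ) : ℕ :=
  num₃ (T.getD (m / 256) 0) (T.getD (m / 16 % 16) 0) (T.getD (m % 16) 0)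

theorem num_lt (v : OffDiag) : num v < 16 := code_lt _

theorem num₃_injective {a b c a' b' c' : OffDiag}
    (h : num₃ (num a) (num b) (num c) = num₃ (num a') (num b') (num c')) :
    a = a' ∧ b = b' ∧ c = c' := by
  have := num_lt a; have := num_lt b; have := num_lt c
  have := num_lt a'; have := num_lt b'; have := num_lt c'
  simp only [num₃] at h
  refine ⟨num_injective ?_, num_injective ?_, num_injective ?_⟩ <;> omega

theorem HasTable.map₃ {γ : Equiv.Perm OffDiag} {T : List ℕ} (hT : HasTable γ T) (a b c : OffDiag) :
    map₃ T (num₃ (num a) (num b) (num c)) = num₃ (num (γ a)) (num (γ b)) (num (γ c)) := by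
  have := num_lt a; have := num_lt b; have := num_lt c
  have h1 : num₃ (num a) (num b) (num c) / 256 = num a := by simp only [num₃]; omega
  have h2 : num₃ (num a) (num b) (num c) / 16 % 16 = num b := by simp only [num₃]; omega
  have h3 : num₃ (num a) (num b) (num c) % 16 = num c := by simp only [num₃]; omega
  rw [SimplicialSurgery.map₃, h1, h2, h3, hT a, hT b, hT c]

/-- The image of the base triple under a permutation. -/
def baseImage (γ : Equiv.Perm OffDiag) : ℕ :=
  num₃ (num (γ (x 2 3))) (num (γ (x 1 2))) (num (γ (x 3 1)))

theorem HasTable.baseImage_mul {γ : Equiv.Perm OffDiag} {T : List ℕ} (hT : HasTable γ T)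
    (δ : Equiv.Perm OffDiag) : baseImage (γ * δ) = SimplicialSurgery.map₃ T (baseImage δ) := by
  rw [baseImage, baseImage, hT.map₃]
  rfl

/-- The ordered special triangles, as images of earlier ones under one of the two generators. -/
def tripleSteps : List (ℕ × ℕ × Bool) :=
  [(1694, 2925, true), (2886, 2925, false), (2443, 1694, true), (1164, 1694, false), (1561,
    2886, true), (2964, 2886, false), (2086, 2443, true), (2267, 2443, false), (295, 1164,
    true), (2519, 1164, false), (2360, 1561, true), (1048, 1561, false), (1665, 2964, true),
    (2953, 2964, false), (585, 2086, true), (3380, 2086, false), (742, 2267, true), (3435, 2267,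
    false), (845, 295, true), (306, 295, false), (2285, 2519, true), (2146, 2519, false), (2242,
    2360, true), (2333, 1048, false), (2339, 1665, true), (1233, 1665, false), (1576, 2953,
    true), (3032, 2953, false), (920, 585, false), (3777, 3380, true), (1769, 3380, false),
    (1209, 742, true), (964, 742, false), (3734, 3435, true), (1611, 3435, false), (3102, 845,
    true), (483, 306, false), (702, 2285, true), (3526, 2285, false), (660, 2146, true), (3395,
    2146, false), (628, 2242, true), (3443, 2242, false), (2110, 2333, true), (2070, 2333,
    false), (2124, 2339, true), (2401, 1233, false), (2370, 1576, true), (1085, 1576, false),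
    (1762, 3032, true), (3202, 920, true), (3725, 920, false), (2931, 3777, true), (3185, 3777,
    false), (2488, 1769, true), (1224, 1769, false), (360, 1209, true), (3705, 964, false),
    (3204, 3734, false), (2326, 1611, true), (1179, 1611, false), (1851, 3102, true), (1820,
    3102, false), (956, 483, true), (462, 483, false), (1131, 702, true), (1652, 3526, false),
    (1153, 660, true), (905, 660, false), (3612, 3395, true), (809, 628, false), (3804, 3443,
    true), (1582, 3443, false), (715, 2110, true), (3564, 2110, false), (569, 2070, true),
    (3348, 2070, false), (535, 2124, true), (3479, 2124, false), (2195, 2401, true), (2113,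
    2401, false), (2068, 2370, true), (2534, 1085, false), (2484, 1762, true), (1219, 1762,
    false), (1828, 3202, true), (2003, 3202, false), (2862, 3725, true), (3286, 3725, false),
    (1756, 2931, true), (1825, 3185, false), (2237, 2488, false), (370, 1224, true), (2429,
    1224, false), (914, 360, true), (333, 360, false), (3112, 3705, false), (2009, 3204, false),
    (2105, 2326, true), (390, 1179, true), (747, 1851, false), (3383, 1820, true), (3175, 956,
    true), (3767, 956, false), (891, 462, true), (380, 462, false), (406, 1131, true), (2379,
    1131, false), (2513, 1652, true), (1065, 1652, false), (291, 1153, true), (3800, 905,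
    false), (2871, 3612, true), (3095, 3612, false), (3144, 809, true), (3640, 809, false),
    (3047, 3804, true), (1084, 1582, false), (1142, 715, true), (1735, 3564, false), (1000, 569,
    false), (3633, 3348, true), (786, 535, false), (1666, 3479, false), (652, 2195, true),
    (3470, 2195, false), (531, 2113, true), (3473, 2113, false), (561, 2068, true), (3353, 2068,
    false), (2233, 2534, true), (2244, 2534, false), (2145, 2484, true), (2430, 1219, false),
    (3393, 1828, true), (622, 2003, false), (2876, 2862, false), (2025, 3286, true), (1892,
    3286, false), (2535, 1756, true), (1127, 1756, false), (3510, 2237, false), (980, 370,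
    true), (2270, 2429, true), (3715, 914, false), (798, 333, true), (1858, 3112, true), (1853,
    3112, false), (3560, 2009, true), (616, 2009, false), (712, 2105, true), (468, 390, false),
    (1206, 747, true), (971, 747, false), (3789, 3383, true), (1949, 3175, true), (3250, 3767,
    false), (3627, 891, false), (983, 380, true), (388, 406, false), (2203, 2379, false), (2275,
    2513, true), (328, 1065, true), (844, 291, true), (318, 291, false), (3042, 3800, true),
    (3181, 3800, false), (1741, 2871, true), (1810, 3095, false), (3010, 3640, true), (3309,
    3640, false), (1725, 3047, true), (455, 1084, true), (473, 1142, true), (2340, 1142, false),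
    (1138, 1735, false), (3011, 3633, true), (3297, 3633, false), (3124, 786, true), (3603, 786,
    false), (1235, 1666, false), (1063, 652, true), (993, 561, false), (1560, 3353, false),
    (3512, 2233, false), (625, 2244, true), (3449, 2244, false), (659, 2145, true), (2092, 2430,
    false), (1681, 3393, false), (413, 1127, true), (3689, 3510, true), (1716, 3510, false),
    (3436, 2270, false), (2860, 3715, true), (3294, 3715, false), (3131, 798, true), (3534,
    1853, true), (3762, 3560, true), (1170, 616, true), (893, 712, false), (361, 468, false),
    (3190, 971, true), (3707, 971, false), (2942, 3789, true), (646, 1949, false), (1971, 3250,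
    false), (3682, 983, false), (801, 388, true), (3467, 2203, false), (700, 2275, true), (3735,
    844, false), (492, 318, false), (1950, 3181, true), (1862, 3181, false), (1982, 3309, true),
    (1990, 3309, false), (2414, 1725, true), (1660, 3011, true), (1985, 3297, false), (2354,
    1063, false), (3251, 993, true), (1053, 1560, false), (910, 659, false), (583, 2092, true),
    (2435, 1681, true), (2968, 3689, true), (1607, 3436, false), (2027, 3294, true), (1900,
    3294, false), (2916, 3762, true), (3622, 893, false), (3030, 3707, true), (3115, 3707,
    false), (1755, 2942, true), (3139, 3682, false), (951, 700, false), (2957, 3735, true),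
    (2889, 2916, false)]

/-- The ordered special triangles. -/
def triples : List ℕ := 2925 :: tripleSteps.map Prod.fst

theorem nodup_triples : triples.Nodup := by decide +kernel

/-- This is transitivity of the generated group on the ordered special triangles; the code 2925 is
the base triple itself. -/
theorem exists_baseImage_eq {m : ℕ} (hm : m ∈ triples) : ∃ γ ∈ groupGH, baseImage γ = m := by
  have h0 : ∃ γ ∈ groupGH, baseImage γ = 2925 := ⟨1, one_mem _, by decide +kernel⟩
  rcases List.mem_cons.1 hm with rfl | hm
  · exact h0
  obtain ⟨r, hr, rfl⟩ := List.mem_map.1 hm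
  refine reach_induction (P := fun m => ∃ γ ∈ groupGH, baseImage γ = m)
    (step := fun b => map₃ (bif b then tableG else tableH)) ?_ tripleSteps [2925] ?_
    (by decide +kernel) r hr
  swap
  · intro m hm
    rwa [List.mem_singleton.1 hm]
  rintro b _ ⟨γ, hγ, rfl⟩
  cases b
  · exact ⟨h * γ, mul_mem h_mem_groupGH hγ, hasTable_h.baseImage_mul γ⟩
  · exact ⟨g * γ, mul_mem g_mem_groupGH hγ, hasTable_g.baseImage_mul γ⟩

theorem mem_triples_of_isSpecial : ∀ a ∈ nums, ∀ b ∈ nums, ∀ c ∈ nums,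
    (orientation a b c).isSome = true → triples.elem (num₃ a b c) = true := by
  decide +kernel

theorem baseImage_mem_triples {σ : Equiv.Perm OffDiag} (hσ : σ ∈ Aut S12) :
    baseImage σ ∈ triples := by
  refine List.elem_iff.1 (mem_triples_of_isSpecial _ (num_mem_nums _) _ (num_mem_nums _) _
    (num_mem_nums _) ?_)
  have : IsSpecial (x 2 3) (x 1 2) (x 3 1) := by unfold IsSpecial; decide +kernel
  exact (isSpecial_map hσ).2 this

theorem eq_of_baseImage_eq {σ τ : Equiv.Perm OffDiag} (hσ : σ ∈ Aut S12) (hτ : τ ∈ Aut S12)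
    (h : baseImage σ = baseImage τ) : σ = τ := by
  obtain ⟨h1, h2, h3⟩ := num₃_injective h
  have : τ⁻¹ * σ = 1 := by
    apply eq_one_of_fixed (mul_mem (inv_mem hτ) hσ)
    · simp [h1]
    · simp [h2]
    · simp [h3]
  exact (inv_mul_eq_one.1 this).symm

/-- An automorphism is determined by the image of the base triple, and every possible image is
already attained in `groupGH`. -/
theorem aut_S12_eq : Aut S12 = groupGH := by
  refine le_antisymm (fun σ hσ => ?_) groupGH_le_aut
  obtain ⟨γ, hγ, h⟩ := exists_baseImage_eq (baseImage_mem_triples hσ)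
  rwa [← eq_of_baseImage_eq (groupGH_le_aut hγ) hσ h]

/-- The group acts simply transitively on the ordered special triangles: 40 triangles with six
orderings each. -/
theorem card_aut_S12 : Nat.card (Aut S12) = 240 := by
  have e : Aut S12 ≃ triples.toFinset := Equiv.ofBijective
    (fun σ => ⟨baseImage σ, List.mem_toFinset.2 (baseImage_mem_triples σ.2)⟩) (by
      constructor
      · intro σ τ h
        exact Subtype.ext (eq_of_baseImage_eq σ.2 τ.2 (congrArg Subtype.val h))
      · rintro ⟨m, hm⟩
        obtain ⟨γ, hγ, rfl⟩ := exists_baseImage_eq (List.mem_toFinset.1 hm)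
        exact ⟨⟨γ, groupGH_le_aut hγ⟩, rfl⟩)
  rw [Nat.card_congr e, Nat.card_eq_fintype_card, Fintype.card_coe,
    List.toFinset_card_of_nodup nodup_triples]
  decide +kernel

end Special

/-! ## The extension -/

section Extension

/-- A group generated by elements that permute the values of a function has a homomorphism that
records these permutations. -/
theorem exists_monoidHom_of_closure {G X M C : Type*} [Group G] [MulAction G X] [Group M]
    [MulAction M C] [FaithfulSMul M C] (F : X → Option C) (hF : ∀ c, ∃ x, F x = some c)
    {S : Set G} {H : Subgroup G} (hH : H = Subgroup.closure S)
    (hS : ∀ γ ∈ S, ∃ m : M, ∀ x, F (γ • x) = (F x).map (m • ·)) :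
    ∃ π : H →* M, ∀ (γ : H) (x : X), F (γ.1 • x) = (F x).map (π γ • ·) := by
  subst hH
  have hex : ∀ γ : Subgroup.closure S, ∃ m : M, ∀ x, F (γ.1 • x) = (F x).map (m • ·) := by
    rintro ⟨γ, hγ⟩
    induction hγ using Subgroup.closure_induction with
    | mem γ h => exact hS γ h
    | one => exact ⟨1, fun x => by simp⟩
    | mul γ δ _ _ h1 h2 =>
      obtain ⟨m, hm⟩ := h1
      obtain ⟨n, hn⟩ := h2
      refine ⟨m * n, fun x => ?_⟩
      simp only [mul_smul, hm, hn, Option.map_map] at hm hn ⊢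
      rfl
    | inv γ _ h1 =>
      obtain ⟨m, hm⟩ := h1
      refine ⟨m⁻¹, fun x => ?_⟩
      have := hm (γ⁻¹ • x)
      simp only [smul_inv_smul] at this
      simp only [this, Option.map_map]
      cases F (γ⁻¹ • x) <;> simp
  choose f hf using hex
  -- Every label occurs and `M` acts faithfully, so the induced permutation determines `m`;
  -- multiplicativity follows.
  have huniq : ∀ (γ : Subgroup.closure S) (m : M), (∀ x, F (γ.1 • x) = (F x).map (m • ·)) →
      f γ = m := by
    intro γ m hm
    refine FaithfulSMul.eq_of_smul_eq_smul (α := C) fun c => ?_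
    obtain ⟨x, hx⟩ := hF c
    have := (hf γ x).symm.trans (hm x)
    simpa [hx] using this
  refine ⟨MonoidHom.mk' f fun γ δ => huniq _ _ fun x => ?_, hf⟩
  rw [Subgroup.coe_mul, mul_smul, hf γ, hf δ, Option.map_map]
  congr 1
  ext c
  simp [mul_smul]

/-- The axes through the vertices, indexed by the projective line over `𝔽₅`. -/
def axis (a : ℕ) : Option (Fin 5) :=
  -- Positions 1 and 11, the poles of the first icosahedron, carry the point at infinity; the other
  -- entries `none` belong to no vertex.
  [none, none, some 4, some 0, some 1, none, some 0, some 3, some 3, some 2,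
    none, none, some 2, some 4, some 1, none].getD a none

/-- The colour of a pair of distinct axes; the five colours are the five one-factorizations that
are preserved by the projective linear group. -/
def colourOf : Option (Fin 5) → Option (Fin 5) → Option (Fin 5)
  | none, none => none
  | none, some i => some i
  | some i, none => some i
  -- As 3 is the inverse of 2 modulo 5, the colour is the midpoint of `i` and `j`. Colour `k` is the
  -- perfect matching `{∞, k}`, `{k - 1, k + 1}`, `{k - 2, k + 2}` of the six axes.
  | some i, some j => if i = j then none else some (3 * (i + j))

/-- The colour of a pair of vertices. -/
def colour (p : OffDiag × OffDiag) : Option (Fin 5) := colourOf (axis (num p.1)) (axis (num p.2))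

/-- The permutation of the colours induced by the first generator. -/
def colourG : Equiv.Perm (Fin 5) := Equiv.swap 0 1 * List.formPerm [2, 4, 3]

/-- The permutation of the colours induced by the second generator. -/
def colourH : Equiv.Perm (Fin 5) := finRotate 5

theorem colour_smul_g (p : OffDiag × OffDiag) : colour (g • p) = (colour p).map (colourG • ·) := by
  have : ∀ a ∈ nums, ∀ b ∈ nums, colourOf (axis (tableG.getD a 0)) (axis (tableG.getD b 0)) =
      (colourOf (axis a) (axis b)).map (colourG • ·) := by
    decide +kernel
  have := this _ (num_mem_nums p.1) _ (num_mem_nums p.2)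
  rwa [← hasTable_g, ← hasTable_g] at this

theorem colour_smul_h (p : OffDiag × OffDiag) : colour (h • p) = (colour p).map (colourH • ·) := by
  have : ∀ a ∈ nums, ∀ b ∈ nums, colourOf (axis (tableH.getD a 0)) (axis (tableH.getD b 0)) =
      (colourOf (axis a) (axis b)).map (colourH • ·) := by
    decide +kernel
  have := this _ (num_mem_nums p.1) _ (num_mem_nums p.2)
  rwa [← hasTable_h, ← hasTable_h] at this

instance : FaithfulSMul (Multiplicative (ZMod 4)) (ZMod 4) :=
  ⟨fun {m n} h => Multiplicative.toAdd.injective (by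
    have h0 : m.toAdd + 0 = n.toAdd + 0 := h 0
    simpa using h0)⟩

/-- The orientation class of a triple of vertices. -/
def orient (p : OffDiag × OffDiag × OffDiag) : Option (ZMod 4) :=
  orientation (num p.1) (num p.2.1) (num p.2.2)

/-- The chosen orientations are such that `g` preserves them from the first icosahedron to the
second and reverses them on the way back. -/
theorem orient_smul_g (p : OffDiag × OffDiag × OffDiag) :
    orient (g • p) = (orient p).map (Multiplicative.ofAdd (1 : ZMod 4) • ·) := by
  have : ∀ a ∈ nums, ∀ b ∈ nums, ∀ c ∈ nums,
      orientation (tableG.getD a 0) (tableG.getD b 0) (tableG.getD c 0) =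
        (orientation a b c).map (1 + ·) := by
    decide +kernel
  have := this _ (num_mem_nums p.1) _ (num_mem_nums p.2.1) _ (num_mem_nums p.2.2)
  rwa [← hasTable_g, ← hasTable_g, ← hasTable_g] at this

theorem orient_smul_h (p : OffDiag × OffDiag × OffDiag) :
    orient (h • p) = (orient p).map (Multiplicative.ofAdd (0 : ZMod 4) • ·) := by
  have : ∀ a ∈ nums, ∀ b ∈ nums, ∀ c ∈ nums,
      orientation (tableH.getD a 0) (tableH.getD b 0) (tableH.getD c 0) =
        (orientation a b c).map (0 + ·) := by
    decide +kernel
  have := this _ (num_mem_nums p.1) _ (num_mem_nums p.2.1) _ (num_mem_nums p.2.2)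
  rwa [← hasTable_h, ← hasTable_h, ← hasTable_h] at this

theorem exists_colour_eq : ∀ c, ∃ p, colour p = some c := by
  have : ∀ c, (nums.any fun a => nums.any fun b => colourOf (axis a) (axis b) == some c) = true := by
    decide +kernel
  intro c
  obtain ⟨a, ha, hc⟩ := List.any_eq_true.1 (this c)
  obtain ⟨b, hb, hc⟩ := List.any_eq_true.1 hc
  obtain ⟨v, rfl⟩ := exists_num_eq a ha
  obtain ⟨w, rfl⟩ := exists_num_eq b hb
  exact ⟨(v, w), beq_iff_eq.1 hc⟩

theorem exists_orient_eq : ∀ c, ∃ p, orient p = some c := by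
  have : ∀ c, (nums.any fun a => nums.any fun b => nums.any fun d =>
      orientation a b d == some c) = true := by
    decide +kernel
  intro c
  obtain ⟨a, ha, hc⟩ := List.any_eq_true.1 (this c)
  obtain ⟨b, hb, hc⟩ := List.any_eq_true.1 hc
  obtain ⟨d, hd, hc⟩ := List.any_eq_true.1 hc
  obtain ⟨u, rfl⟩ := exists_num_eq a ha
  obtain ⟨v, rfl⟩ := exists_num_eq b hb
  obtain ⟨w, rfl⟩ := exists_num_eq d hd
  exact ⟨(u, v, w), beq_iff_eq.1 hc⟩

/-- The first generator as an automorphism. -/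
def gAut : Aut S12 := ⟨g, g_mem_aut⟩

/-- The second generator as an automorphism. -/
def hAut : Aut S12 := ⟨h, h_mem_aut⟩

theorem exists_colour_hom : ∃ π : Aut S12 →* Equiv.Perm (Fin 5), π gAut = colourG ∧
    π hAut = colourH := by
  obtain ⟨π, hπ⟩ := exists_monoidHom_of_closure (M := Equiv.Perm (Fin 5)) colour exists_colour_eq
    aut_S12_eq (S := {g, h}) (by
      rintro γ (rfl | rfl)
      exacts [⟨_, colour_smul_g⟩, ⟨_, colour_smul_h⟩])
  have key : ∀ (γ : Aut S12) (m : Equiv.Perm (Fin 5)),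
      (∀ p, colour (γ.1 • p) = (colour p).map (m • ·)) → π γ = m := by
    intro γ m hm
    ext1 c
    obtain ⟨p, hp⟩ := exists_colour_eq c
    have := (hπ γ p).symm.trans (hm p)
    simpa [hp] using this
  exact ⟨π, key gAut _ colour_smul_g, key hAut _ colour_smul_h⟩

theorem exists_orient_hom : ∃ ρ : Aut S12 →* Multiplicative (ZMod 4),
    ρ gAut = Multiplicative.ofAdd 1 ∧ ρ hAut = 1 := by
  obtain ⟨ρ, hρ⟩ := exists_monoidHom_of_closure (M := Multiplicative (ZMod 4)) orient
    exists_orient_eq aut_S12_eq (S := {g, h}) (by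
      rintro γ (rfl | rfl)
      exacts [⟨_, orient_smul_g⟩, ⟨_, orient_smul_h⟩])
  have key : ∀ (γ : Aut S12) (m : Multiplicative (ZMod 4)),
      (∀ p, orient (γ.1 • p) = (orient p).map (m • ·)) → ρ γ = m := by
    intro γ m hm
    refine FaithfulSMul.eq_of_smul_eq_smul (α := ZMod 4) fun c => ?_
    obtain ⟨p, hp⟩ := exists_orient_eq c
    have := (hρ γ p).symm.trans (hm p)
    simpa [hp] using this
  exact ⟨ρ, key gAut _ orient_smul_g, key hAut _ orient_smul_h⟩

theorem closure_gAut_hAut : Subgroup.closure {gAut, hAut} = ⊤ := by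
  rw [eq_top_iff]
  rintro ⟨γ, hγ⟩ -
  have : (Subgroup.closure {gAut, hAut}).map (Aut S12).subtype = Aut S12 := by
    rw [MonoidHom.map_closure, Set.image_pair]
    exact aut_S12_eq.symm
  rw [← this] at hγ
  obtain ⟨δ, hδ, rfl⟩ := hγ
  exact hδ

/-- A 5-cycle and a transposition generate `S₅`. The transposition is the cube of `colourG`, whose
other factor is a disjoint 3-cycle. -/
theorem colour_hom_surjective {π : Aut S12 →* Equiv.Perm (Fin 5)} (hg : π gAut = colourG)
    (hh : π hAut = colourH) : Function.Surjective π := by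
  rw [← MonoidHom.range_eq_top, eq_top_iff,
    ← Equiv.Perm.closure_prime_cycle_swap (σ := colourH) (τ := Equiv.swap 0 1)
      (by simp only [Fintype.card_fin]; norm_num) isCycle_finRotate support_finRotate
      ⟨0, 1, by decide, rfl⟩, Subgroup.closure_le]
  rintro γ (rfl | rfl)
  · exact ⟨hAut, hh⟩
  · refine ⟨gAut ^ 3, ?_⟩
    rw [map_pow, hg]
    decide +kernel

/-- The sign character of the cyclic group of order four. -/
def quarterSign : Multiplicative (ZMod 4) →* ℤˣ :=
  MonoidHom.mk' (fun n => (-1) ^ (Multiplicative.toAdd n).val) (by decide +kernel)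

theorem card_ker_quarterSign : Nat.card quarterSign.ker = 2 := by
  rw [Nat.card_congr (Equiv.subtypeEquivRight (p := (· ∈ quarterSign.ker))
    (q := fun n => quarterSign n = 1) fun _ => MonoidHom.mem_ker), Nat.card_eq_fintype_card]
  decide +kernel

theorem sign_colour_eq {π : Aut S12 →* Equiv.Perm (Fin 5)}
    {ρ : Aut S12 →* Multiplicative (ZMod 4)} (hπg : π gAut = colourG) (hπh : π hAut = colourH)
    (hρg : ρ gAut = Multiplicative.ofAdd 1) (hρh : ρ hAut = 1) (γ : Aut S12) :
    Equiv.Perm.sign (π γ) = quarterSign (ρ γ) := by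
  have : Equiv.Perm.sign.comp π = quarterSign.comp ρ := by
    refine MonoidHom.eq_of_eqOn_dense closure_gAut_hAut ?_
    rintro γ (rfl | rfl)
    · change Equiv.Perm.sign (π gAut) = quarterSign (ρ gAut)
      rw [hπg, hρg]
      decide +kernel
    · change Equiv.Perm.sign (π hAut) = quarterSign (ρ hAut)
      rw [hπh, hρh]
      decide +kernel
  exact DFunLike.congr_fun this γ

theorem card_perm_five : Nat.card (Equiv.Perm (Fin 5)) = 120 := by
  rw [Nat.card_eq_fintype_card, Fintype.card_perm, Fintype.card_fin]
  rfl

theorem card_ker_eq_two {π : Aut S12 →* Equiv.Perm (Fin 5)} (hπ : Function.Surjective π) :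
    Nat.card π.ker = 2 := by
  have h1 := Subgroup.card_mul_index π.ker
  rw [Subgroup.index_ker, MonoidHom.range_eq_top.2 hπ, Subgroup.card_top, card_aut_S12,
    card_perm_five] at h1
  omega

/-- A conjugate of the only nontrivial element of `N` is again nontrivial and in `N`, hence equal to
it. -/
theorem le_center_of_card_eq_two {G : Type*} [Group G] {N : Subgroup G} [N.Normal]
    (hN : Nat.card N = 2) : N ≤ Subgroup.center G := by
  intro z hz
  rw [Subgroup.mem_center_iff]
  intro γ
  by_cases h1 : z = 1
  · simp [h1]
  obtain ⟨y, -, hy⟩ := (Nat.card_eq_two_iff' (1 : N)).1 hN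
  have h2 := hy ⟨z, hz⟩ fun h => h1 (congrArg Subtype.val h)
  have h3 := hy ⟨γ * z * γ⁻¹, Subgroup.Normal.conj_mem inferInstance z hz γ⟩ fun h => h1 (by
    have := congrArg Subtype.val h
    simpa using this)
  have h4 : γ * z * γ⁻¹ = z := congrArg Subtype.val (h3.trans h2.symm)
  rwa [mul_inv_eq_iff_eq_mul] at h4

/-- Over even permutations `ρ` takes values in the subgroup of order two. The pair `(π, ρ)` is
injective there, since `u` is the only nontrivial element of the kernel of `π` and `ρ` detects it;
both groups have order 120. -/
theorem exists_mulEquiv_comap_alternatingGroup {G : Type*} [Group G]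
    {π : G →* Equiv.Perm (Fin 5)} {ρ : G →* Multiplicative (ZMod 4)} (hG : Nat.card G = 240)
    (hπ : Function.Surjective π) (hker : Nat.card π.ker = 2)
    (hsign : ∀ γ, Equiv.Perm.sign (π γ) = quarterSign (ρ γ)) {u : G}
    (hπu : π u = 1) (hρu : ρ u ≠ 1) :
    Nonempty (Subgroup.comap π (alternatingGroup (Fin 5)) ≃*
      alternatingGroup (Fin 5) × Multiplicative (ZMod 2)) := by
  have : Fact (Nat.Prime 2) := ⟨Nat.prime_two⟩
  have hcard2 : Nat.card (Multiplicative (ZMod 2)) = 2 := by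
    rw [Nat.card_eq_fintype_card]
    rfl
  let ι : quarterSign.ker ≃* Multiplicative (ZMod 2) :=
    mulEquivOfPrimeCardEq card_ker_quarterSign hcard2
  have hmem : ∀ γ : Subgroup.comap π (alternatingGroup (Fin 5)),
      π γ.1 ∈ alternatingGroup (Fin 5) := fun γ => γ.2
  have hmem' : ∀ γ : Subgroup.comap π (alternatingGroup (Fin 5)), ρ γ.1 ∈ quarterSign.ker := by
    intro γ
    rw [MonoidHom.mem_ker, ← hsign, Equiv.Perm.mem_alternatingGroup.1 (hmem γ)]
  let Φ : Subgroup.comap π (alternatingGroup (Fin 5)) →*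
      alternatingGroup (Fin 5) × quarterSign.ker :=
    ((π.comp (Subgroup.subtype _)).codRestrict _ hmem).prod
      ((ρ.comp (Subgroup.subtype _)).codRestrict _ hmem')
  have hinj : Function.Injective Φ := by
    rw [injective_iff_map_eq_one]
    intro γ hγ
    have h1 : π γ.1 = 1 := congrArg (fun p => p.1.1) hγ
    have h2 : ρ γ.1 = 1 := congrArg (fun p => p.2.1) hγ
    by_contra hne
    obtain ⟨y, -, hy⟩ := (Nat.card_eq_two_iff' (1 : π.ker)).1 hker
    have h3 := hy ⟨γ.1, h1⟩ fun h => hne <| Subtype.ext <| by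
      have h' : γ.1 = 1 := Subtype.ext_iff.1 h
      exact h'
    have h4 := hy ⟨u, hπu⟩ fun h => hρu (by
      rw [show u = 1 from Subtype.ext_iff.1 h, map_one])
    have h5 : γ.1 = u := Subtype.ext_iff.1 (h3.trans h4.symm)
    rw [h5] at h2
    exact hρu h2
  have hcard : Nat.card (Subgroup.comap π (alternatingGroup (Fin 5))) =
      Nat.card (alternatingGroup (Fin 5) × quarterSign.ker) := by
    have h1 := Subgroup.card_mul_index (Subgroup.comap π (alternatingGroup (Fin 5)))
    have h2 := Subgroup.card_mul_index (alternatingGroup (Fin 5))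
    rw [Subgroup.index_comap_of_surjective _ hπ, hG] at h1
    rw [card_perm_five] at h2
    rw [Nat.card_prod, card_ker_quarterSign]
    have h3 : 0 < (alternatingGroup (Fin 5)).index := Nat.pos_of_ne_zero fun h => by simp [h] at h2
    apply Nat.eq_of_mul_eq_mul_right h3
    rw [h1, mul_right_comm, h2]
    norm_num
  exact ⟨(MulEquiv.ofBijective Φ ((Nat.bijective_iff_injective_and_card Φ).2 ⟨hinj, hcard⟩)).trans
    (MulEquiv.prodCongr (MulEquiv.refl _) ι)⟩

/-- The extension of the symmetric group by the kernel of the action on colours. -/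
theorem exists_extension : ∃ E : GroupExtension (Multiplicative (ZMod 2)) (Aut S12)
    (Equiv.Perm (Fin 5)), E.inl.range ≤ Subgroup.center (Aut S12) ∧ IsEmpty E.Splitting ∧
      Nonempty (Subgroup.comap E.rightHom (alternatingGroup (Fin 5)) ≃*
        alternatingGroup (Fin 5) × Multiplicative (ZMod 2)) := by
  obtain ⟨π, hπg, hπh⟩ := exists_colour_hom
  obtain ⟨ρ, hρg, hρh⟩ := exists_orient_hom
  have hsign := sign_colour_eq hπg hπh hρg hρh
  have hsurj := colour_hom_surjective hπg hπh
  have hker := card_ker_eq_two hsurj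
  have hcard2 : Nat.card (Multiplicative (ZMod 2)) = 2 := by
    rw [Nat.card_eq_fintype_card]
    rfl
  have : Fact (Nat.Prime 2) := ⟨Nat.prime_two⟩
  let ι : Multiplicative (ZMod 2) ≃* π.ker := mulEquivOfPrimeCardEq hcard2 hker
  have hrange : (π.ker.subtype.comp ι.toMonoidHom).range = π.ker := by
    rw [MonoidHom.range_comp, MonoidHom.range_eq_top.2 ι.surjective, ← MonoidHom.range_eq_map,
      Subgroup.range_subtype]
  refine ⟨⟨π.ker.subtype.comp ι.toMonoidHom, π, ?_, hrange, hsurj⟩, ?_, ⟨fun s => ?_⟩, ?_⟩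
  · exact (Subgroup.subtype_injective _).comp ι.injective
  · exact hrange.le.trans (le_center_of_card_eq_two hker)
  -- A section would lift a transposition to an element of square one, whose image in `ℤ/4` is even,
  -- against the sign `-1` of the transposition.
  · have h1 : π (s (Equiv.swap 0 1)) = Equiv.swap 0 1 := s.rightHom_splitting _
    have h2 : ρ (s (Equiv.swap 0 1)) * ρ (s (Equiv.swap 0 1)) = 1 := by
      rw [← map_mul, ← map_mul, Equiv.swap_mul_self, map_one, map_one]
    have h3 := hsign (s (Equiv.swap 0 1))
    rw [h1, Equiv.Perm.sign_swap (by decide)] at h3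
    have h4 : ∀ n, n * n = 1 → quarterSign n = 1 := by decide +kernel
    rw [h4 _ h2] at h3
    exact absurd h3 (by decide)
  -- The permutation `colourG` has order six, while `ρ` sends the sixth power of `g` to `6 = 2` in
  -- `ℤ/4`. This power is the antipodal map.
  · exact exists_mulEquiv_comap_alternatingGroup card_aut_S12 hsurj hker hsign (u := gAut ^ 6)
      (by rw [map_pow, hπg]; decide +kernel) (by rw [map_pow, hρg]; decide +kernel)

end Extension

end SimplicialSurgery

theorem theorem5 :
    -- the complex comes from an antimorphic pair of icosahedra, has twelve vertices,
    -- and consists of the images of two basic facets under the group generated by `g` and `h`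
    (IsAntimorphicPair ico₁ ico₂ ∧
      (vertexSet S12).ncard = 12 ∧
      S12 = generatedBy
        {s | ∃ γ ∈ groupGH, ∃ b ∈ basicFacets12,
          s = b.map γ.toEmbedding}) ∧
    -- for every antimorphic pair the map `φ` is well defined, and up to isomorphism the complex
    -- does not depend on the pair
    (∀ (V : Type*) [DecidableEq V] (I₁ I₂ : PreAbstractSimplicialComplex V),
      IsAntimorphicPair I₁ I₂ →
        (∀ s ∈ triangles I₁, ∃! t, Corresponds I₁ I₂ s t) ∧
        ∃ e : OffDiag ≃ V, IsIso S12
          (pairComplex I₁ I₂) e) ∧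
    -- it triangulates the product of two 2-spheres
    Triangulates S12
      (Sphere2 × Sphere2) ∧
    -- it arises from a 16-vertex simplicial subdivision of the product cell complex by a finite
    -- sequence of generalized bistellar moves
    ((vertexSet S16second).ncard = 16 ∧
      IsSubdivisionOfProduct S16second ∧
      Relation.ReflTransGen (IsGBM 4) S16second
        (S12.map Subtype.val)) ∧
    -- its full automorphism group is generated by `g` and `h`, has order 240, and is a non-split
    -- central extension of `S₅` by `ℤ/2`, the one in which the preimage of `A₅` is `A₅ × ℤ/2`
    (Aut S12 = groupGH ∧
      Nat.card (Aut S12) = 240 ∧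
      ∃ E : GroupExtension (Multiplicative (ZMod 2)) (Aut S12)
          (Equiv.Perm (Fin 5)),
        E.inl.range ≤ Subgroup.center (Aut S12) ∧
        IsEmpty E.Splitting ∧
        Nonempty (Subgroup.comap E.rightHom (alternatingGroup (Fin 5)) ≃*
          alternatingGroup (Fin 5) × Multiplicative (ZMod 2))) := by
  refine ⟨⟨isAntimorphicPair_ico, ncard_vertexSet_S12, S12_eq_generatedBy_orbitFamily⟩,
    fun V _ I₁ I₂ hI => ⟨hI.existsUnique_corresponds, hI.isIso_pairComplex⟩, ?_,
    ⟨vertexSet_S16second, ?_, ?_⟩, aut_S12_eq, card_aut_S12, exists_extension⟩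
  · obtain ⟨e⟩ := nonempty_carrier_map_homeomorph S12 Subtype.val_injective
    obtain ⟨e'⟩ := triangulates_maskComplex12
    exact ⟨e.trans ((Homeomorph.setCongr (by rw [map_S12])).trans e')⟩
  · rw [S16second_eq]
    exact isSubdivisionOfProduct_maskComplex
  · rw [S16second_eq, map_S12, ← flipChain_flips]
    exact (reflTransGen_flipChain flips facets16 chainCheck_flips).1
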